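/- Let $\Omega\subset\mathbb R^2$ be a bounded simply connected polygonal domain, decomposed into finitely many open simple polygons $K\in\mathcal T_h$ (the mesh). Assume that for some constant $C_{\mathcal T}>0$ every $K\in\mathcal T_h$, with diameter $h_K$, satisfies: (A1) the ratio between the shortest edge of $K$ and $h_K$ is larger than $C_{\mathcal T}$; (A2) $K$ is star-shaped with respect to every point of a ball of radius $C_{\mathcal T}h_K$. For $K\in\mathcal T_h$ with vertices $P_1,\dots,P_{N_K}$ put $a_K(u,v)=\int_K D^2u:D^2v$, $b_K(u,v)=\int_K uv$, and let $V_h^K$ be the space of all $v\in H^2(K)$ such that $\Delta^2v\in\mathbb P_2(K)$, the traces of $v$ and $\nabla v$ on $\partial K$ are continuous, and $v|_e\in\mathbb P_3(e)$, $\partial_nv|_e\in\mathbb P_1(e)$ for every edge $e$ of $K$. For $v\in V_h^K$ let $\Pi_K^\Delta v\in\mathbb P_2(K)$ be defined by $a_K(\Pi_K^\Delta v,q)=a_K(v,q)$ for all $q\in\mathbb P_2(K)$ and $\sum_i(\Pi_K^\Delta v)(P_i)q(P_i)=\sum_iv(P_i)q(P_i)$ for all $q\in\mathbb P_1(K)$.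 Let $$W_h^K=\Big\{v\in V_h^K:\int_K(\Pi_K^\Delta v)q=\int_Kvq\ \ \forall q\in\mathbb P_2(K)\Big\},\qquad W_h=\{v\in H^2_0(\Omega): v|_K\in W_h^K\ \ \forall K\in\mathcal T_h\}.$$ Let $s_K,s_K^0$ be symmetric positive definite bilinear forms on $W_h^K$ such that, with constants $c_0,c_1,c_2,c_3>0$, $c_0a_K(v,v)\le s_K(v,v)\le c_1a_K(v,v)$ for all $v\in W_h^K$ with $\Pi_K^\Delta v=0$, and $c_2b_K(v,v)\le s_K^0(v,v)\le c_3b_K(v,v)$ for all $v\in W_h^K$. For $u,v\in W_h$ set $$a_h(u,v)=\sum_{K}\big[a_K(\Pi_K^\Delta u,\Pi_K^\Delta v)+s_K(u-\Pi_K^\Delta u,v-\Pi_K^\Delta v)\big],$$ $$b_h(u,v)=\sum_{K}\big[b_K(\Pi_K^\Delta u,\Pi_K^\Delta v)+s^0_K(u-\Pi_K^\Delta u,v-\Pi_K^\Delta v)\big].$$ Then $W_h$ is finite dimensional; for every $f\in W_h$ there is a unique $u=:T_hf\in W_h$ with $a_h(u,v)=b_h(f,v)$ for all $v\in W_h$,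 and $T_h:W_h\to W_h$ is linear; and the spectrum of $T_h$ in $\mathbb C$ (that is, of its complexification) consists of exactly $M_h:=\dim W_h$ eigenvalues, repeated according to their multiplicities (algebraic and geometric multiplicities coincide), all of which are real and positive. -/

import Mathlib

open MeasureTheory Filter Topology Set
open scoped ContDiff TensorProduct

noncomputable section

/-- The Euclidean plane. -/
abbrev Plane : Type := EuclideanSpace ℝ (Fin 2)

/-- The classical partial derivative `∂ᵢ φ`. -/
def pderiv (i : Fin 2) (φ : Plane → ℝ) : Plane → ℝ :=
  fun x => fderiv ℝ φ x (EuclideanSpace.single i 1)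

/-- `φ ∈ C_c^∞(U)`. -/
structure IsTestFunction (U : Set Plane) (φ : Plane → ℝ) : Prop where
  smooth : ContDiff ℝ ∞ φ
  compact : HasCompactSupport φ
  support_subset : tsupport φ ⊆ U

/-! ### Sobolev spaces of order two -/

/-- The Lebesgue space `L²(U)`. -/
abbrev L2 (U : Set Plane) : Type := Lp ℝ 2 ((volume : Measure Plane).restrict U)

/-- Triples `(v, (vᵢ), (vᵢⱼ))` of `L²(U)` functions, with the (product) topology of `L²(U)`. The
space `H²(U)` is realised below as the space of those triples for which `vᵢ = ∂ᵢ v` and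
`vᵢⱼ = ∂ⱼ ∂ᵢ v` weakly, that is, a function of `H²(U)` is stored with its weak derivatives
(which it determines), and the topology is that of the `H²(U)` norm. -/
abbrev Jet (U : Set Plane) : Type := L2 U × (Fin 2 → L2 U) × (Fin 2 → Fin 2 → L2 U)

namespace Jet

variable {U : Set Plane}

/-- The underlying function of a jet. -/
abbrev fn (v : Jet U) : L2 U := v.1

/-- The first order part of a jet. -/
abbrev grad (v : Jet U) (i : Fin 2) : L2 U := v.2.1 i

/-- The second order part of a jet. -/
abbrev hess (v : Jet U) (i j : Fin 2) : L2 U := v.2.2 i j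

end Jet

/-- `w` is the weak partial derivative `∂ᵢ u` on `U`. -/
def IsWeakPartial (U : Set Plane) (i : Fin 2) (u w : L2 U) : Prop :=
  ∀ φ : Plane → ℝ, IsTestFunction U φ →
    ∫ x in U, u x * pderiv i φ x = - ∫ x in U, w x * φ x

/-- `v` consists of a smooth function `φ` and its classical derivatives, restricted to `U`. -/
def IsJetOf (U : Set Plane) (φ : Plane → ℝ) (v : Jet U) : Prop :=
  (v.fn =ᵐ[volume.restrict U] φ) ∧
  (∀ i, v.grad i =ᵐ[volume.restrict U] pderiv i φ) ∧
  (∀ i j, v.hess i j =ᵐ[volume.restrict U] pderiv j (pderiv i φ))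

theorem IsTestFunction.pderiv {U : Set Plane} {φ : Plane → ℝ} (h : IsTestFunction U φ)
    (i : Fin 2) : IsTestFunction U (pderiv i φ) where
  smooth := (h.smooth.fderiv_right (m := ∞) (by simp)).clm_apply contDiff_const
  compact := (h.compact.fderiv_apply (𝕜 := ℝ) (EuclideanSpace.single i 1))
  support_subset := (tsupport_fderiv_apply_subset ℝ _).trans h.support_subset

theorem IsTestFunction.integrable_mul {U : Set Plane} {φ : Plane → ℝ} (h : IsTestFunction U φ)
    (u : L2 U) : Integrable (fun x => u x * φ x) (volume.restrict U) :=
  have hφ : MemLp φ 2 ((volume : Measure Plane).restrict U) :=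
    (h.smooth.continuous.memLp_of_hasCompactSupport h.compact).restrict U
  MemLp.integrable_mul (Lp.memLp u) hφ

theorem IsWeakPartial.zero (U : Set Plane) (i : Fin 2) : IsWeakPartial U i 0 0 := by
  intro φ _
  have h : ∀ g : Plane → ℝ, ∫ x in U, (0 : L2 U) x * g x = 0 := fun g => by
    rw [integral_congr_ae (g := fun _ => (0 : ℝ)), integral_zero]
    filter_upwards [Lp.coeFn_zero ℝ 2 ((volume : Measure Plane).restrict U)] with x hx
    rw [hx, Pi.zero_apply, zero_mul]
  rw [h, h, neg_zero]

theorem IsWeakPartial.add {U : Set Plane} {i : Fin 2} {u w u' w' : L2 U}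
    (h : IsWeakPartial U i u w) (h' : IsWeakPartial U i u' w') :
    IsWeakPartial U i (u + u') (w + w') := by
  have key : ∀ (a b : L2 U) (φ : Plane → ℝ), IsTestFunction U φ →
      ∫ x in U, (a + b) x * φ x = (∫ x in U, a x * φ x) + ∫ x in U, b x * φ x := by
    intro a b φ hφ
    rw [← integral_add (hφ.integrable_mul a) (hφ.integrable_mul b)]
    refine integral_congr_ae ?_
    filter_upwards [Lp.coeFn_add a b] with x hx
    rw [hx, Pi.add_apply, add_mul]
  intro φ hφ
  rw [key _ _ _ (hφ.pderiv i), key _ _ _ hφ, h φ hφ, h' φ hφ]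
  ring

theorem IsWeakPartial.smul {U : Set Plane} {i : Fin 2} {u w : L2 U} (c : ℝ)
    (h : IsWeakPartial U i u w) : IsWeakPartial U i (c • u) (c • w) := by
  have key : ∀ (a : L2 U) (φ : Plane → ℝ),
      ∫ x in U, (c • a) x * φ x = c * ∫ x in U, a x * φ x := by
    intro a φ
    rw [← integral_const_mul]
    refine integral_congr_ae ?_
    filter_upwards [Lp.coeFn_smul c a] with x hx
    simp [hx, mul_assoc]
  intro φ hφ
  rw [key, key, h φ hφ]
  ring

theorem pderiv_add {φ ψ : Plane → ℝ} (hφ : ContDiff ℝ ∞ φ) (hψ : ContDiff ℝ ∞ ψ) (i : Fin 2) :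
    pderiv i (φ + ψ) = pderiv i φ + pderiv i ψ := by
  funext x
  simp only [pderiv, Pi.add_apply]
  rw [fderiv_add (hφ.differentiable (by simp) x) (hψ.differentiable (by simp) x)]
  rfl

theorem pderiv_smul (c : ℝ) {φ : Plane → ℝ} (hφ : ContDiff ℝ ∞ φ) (i : Fin 2) :
    pderiv i (c • φ) = c • pderiv i φ := by
  funext x
  simp only [pderiv, Pi.smul_apply]
  rw [fderiv_const_smul (hφ.differentiable (by simp) x)]
  rfl

theorem contDiff_pderiv {φ : Plane → ℝ} (hφ : ContDiff ℝ ∞ φ) (i : Fin 2) :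
    ContDiff ℝ ∞ (pderiv i φ) :=
  (hφ.fderiv_right (m := ∞) (by simp)).clm_apply contDiff_const

theorem IsJetOf.zero (U : Set Plane) : IsJetOf U (0 : Plane → ℝ) 0 := by
  have h0 : ∀ i, pderiv i (0 : Plane → ℝ) = 0 := fun i => by
    funext x; simp [_root_.pderiv]
  refine ⟨Lp.coeFn_zero _ _ _, fun i => ?_, fun i j => ?_⟩
  · rw [h0]; exact Lp.coeFn_zero _ _ _
  · rw [h0, h0]; exact Lp.coeFn_zero _ _ _

theorem IsJetOf.add {U : Set Plane} {φ ψ : Plane → ℝ} {v w : Jet U} (hφ : ContDiff ℝ ∞ φ)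
    (hψ : ContDiff ℝ ∞ ψ) (hv : IsJetOf U φ v) (hw : IsJetOf U ψ w) :
    IsJetOf U (φ + ψ) (v + w) := by
  refine ⟨(Lp.coeFn_add _ _).trans (hv.1.add hw.1), fun i => ?_, fun i j => ?_⟩
  · rw [pderiv_add hφ hψ]
    exact (Lp.coeFn_add _ _).trans ((hv.2.1 i).add (hw.2.1 i))
  · rw [pderiv_add hφ hψ, pderiv_add (contDiff_pderiv hφ i) (contDiff_pderiv hψ i)]
    exact (Lp.coeFn_add _ _).trans ((hv.2.2 i j).add (hw.2.2 i j))

theorem IsJetOf.smul {U : Set Plane} {φ : Plane → ℝ} {v : Jet U} (c : ℝ) (hφ : ContDiff ℝ ∞ φ)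
    (hv : IsJetOf U φ v) : IsJetOf U (c • φ) (c • v) := by
  refine ⟨(Lp.coeFn_smul _ _).trans (hv.1.const_smul c), fun i => ?_, fun i j => ?_⟩
  · rw [pderiv_smul c hφ]
    exact (Lp.coeFn_smul _ _).trans ((hv.2.1 i).const_smul c)
  · rw [pderiv_smul c hφ, pderiv_smul c (contDiff_pderiv hφ i)]
    exact (Lp.coeFn_smul _ _).trans ((hv.2.2 i j).const_smul c)

/-- The Sobolev space `H²(U)`. -/
def H2 (U : Set Plane) : Submodule ℝ (Jet U) where
  carrier := {v | (∀ i, IsWeakPartial U i v.fn (v.grad i)) ∧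
    ∀ i j, IsWeakPartial U j (v.grad i) (v.hess i j)}
  zero_mem' := ⟨fun i => IsWeakPartial.zero U i, fun _ j => IsWeakPartial.zero U j⟩
  add_mem' := fun hv hw =>
    ⟨fun i => (hv.1 i).add (hw.1 i), fun i j => (hv.2 i j).add (hw.2 i j)⟩
  smul_mem' := fun c _ hv =>
    ⟨fun i => (hv.1 i).smul c, fun i j => (hv.2 i j).smul c⟩

/-- The Sobolev space `H₀²(U)`, the closure of `C_c^∞(U)` in the `H²(U)` norm. -/
def H20 (U : Set Plane) : Submodule ℝ (Jet U) :=
  (Submodule.span ℝ {v : Jet U | ∃ φ, IsTestFunction U φ ∧ IsJetOf U φ v}).topologicalClosure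

/-- Restriction of `L²` functions to a subset. -/
def restrictL2 {U K : Set Plane} (h : K ⊆ U) : L2 U →ₗ[ℝ] L2 K where
  toFun u := ((Lp.memLp u).mono_measure (Measure.restrict_mono_set volume h)).toLp u
  map_add' u v := by
    apply Lp.ext
    have hae := ae_mono (Measure.restrict_mono_set (volume : Measure Plane) h)
    filter_upwards [MemLp.coeFn_toLp
        ((Lp.memLp (u + v)).mono_measure (Measure.restrict_mono_set volume h)),
      Lp.coeFn_add
        (((Lp.memLp u).mono_measure (Measure.restrict_mono_set volume h)).toLp u)
        (((Lp.memLp v).mono_measure (Measure.restrict_mono_set volume h)).toLp v),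
      MemLp.coeFn_toLp ((Lp.memLp u).mono_measure (Measure.restrict_mono_set volume h)),
      MemLp.coeFn_toLp ((Lp.memLp v).mono_measure (Measure.restrict_mono_set volume h)),
      hae (Lp.coeFn_add u v)] with x h1 h2 h3 h4 h5
    rw [h1, h2, h5, Pi.add_apply, Pi.add_apply, h3, h4]
  map_smul' c u := by
    apply Lp.ext
    have hae := ae_mono (Measure.restrict_mono_set (volume : Measure Plane) h)
    filter_upwards [MemLp.coeFn_toLp
        ((Lp.memLp (c • u)).mono_measure (Measure.restrict_mono_set volume h)),
      Lp.coeFn_smul c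
        (((Lp.memLp u).mono_measure (Measure.restrict_mono_set volume h)).toLp u),
      MemLp.coeFn_toLp ((Lp.memLp u).mono_measure (Measure.restrict_mono_set volume h)),
      hae (Lp.coeFn_smul c u)] with x h1 h2 h3 h5
    rw [RingHom.id_apply, h1, h2, h5, Pi.smul_apply, Pi.smul_apply, h3]

/-- Restriction of (jets of) functions to a subset. -/
def restrictJet {U K : Set Plane} (h : K ⊆ U) : Jet U →ₗ[ℝ] Jet K where
  toFun v := (restrictL2 h v.fn, fun i => restrictL2 h (v.grad i),
    fun i j => restrictL2 h (v.hess i j))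
  map_add' u v := by
    refine Prod.ext (by simp) (Prod.ext ?_ ?_)
    · funext i; exact map_add (restrictL2 h) _ _
    · funext i j; exact map_add (restrictL2 h) _ _
  map_smul' c u := by
    refine Prod.ext (by simp) (Prod.ext ?_ ?_)
    · funext i; exact map_smul (restrictL2 h) c _
    · funext i j; exact map_smul (restrictL2 h) c _

/-! ### The bilinear forms -/

/-- `a_K(u, v) = ∫_K D²u : D²v`. -/
def aForm (K : Set Plane) (u v : Jet K) : ℝ :=
  ∫ x in K, ∑ i, ∑ j, u.hess i j x * v.hess i j x

/-- `b_K(u, v) = ∫_K u v`. -/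
def bForm (K : Set Plane) (u v : Jet K) : ℝ :=
  ∫ x in K, u.fn x * v.fn x

theorem aForm_add_left (K : Set Plane) (u u' v : Jet K) :
    aForm K (u + u') v = aForm K u v + aForm K u' v := by
  have hi : ∀ u : Jet K, Integrable (fun x => ∑ i, ∑ j, u.hess i j x * v.hess i j x)
      (volume.restrict K) := fun u =>
    integrable_finsetSum _ fun i _ => integrable_finsetSum _ fun j _ =>
      (Lp.memLp (u.hess i j)).integrable_mul (Lp.memLp (v.hess i j))
  rw [aForm, aForm, aForm, ← integral_add (hi u) (hi u')]
  refine integral_congr_ae ?_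
  have h : ∀ᵐ x ∂(volume.restrict K), ∀ i j, (u + u').hess i j x = u.hess i j x + u'.hess i j x :=
    ae_all_iff.2 fun i => ae_all_iff.2 fun j => Lp.coeFn_add (u.hess i j) (u'.hess i j)
  filter_upwards [h] with x hx
  simp only [hx, add_mul, Finset.sum_add_distrib]

theorem aForm_smul_left (K : Set Plane) (c : ℝ) (u v : Jet K) :
    aForm K (c • u) v = c * aForm K u v := by
  rw [aForm, aForm, ← integral_const_mul]
  refine integral_congr_ae ?_
  have h : ∀ᵐ x ∂(volume.restrict K), ∀ i j, (c • u).hess i j x = c * u.hess i j x :=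
    ae_all_iff.2 fun i => ae_all_iff.2 fun j => Lp.coeFn_smul c (u.hess i j)
  filter_upwards [h] with x hx
  simp only [hx, mul_assoc, Finset.mul_sum]

theorem bForm_add_left (K : Set Plane) (u u' v : Jet K) :
    bForm K (u + u') v = bForm K u v + bForm K u' v := by
  have hi : ∀ u : Jet K, Integrable (fun x => u.fn x * v.fn x) (volume.restrict K) := fun u =>
    (Lp.memLp u.fn).integrable_mul (Lp.memLp v.fn)
  rw [bForm, bForm, bForm, ← integral_add (hi u) (hi u')]
  refine integral_congr_ae ?_
  filter_upwards [Lp.coeFn_add u.fn u'.fn] with x hx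
  change (u.fn + u'.fn : L2 K) x * v.fn x = _
  rw [hx, Pi.add_apply, add_mul]

theorem bForm_smul_left (K : Set Plane) (c : ℝ) (u v : Jet K) :
    bForm K (c • u) v = c * bForm K u v := by
  rw [bForm, bForm, ← integral_const_mul]
  refine integral_congr_ae ?_
  filter_upwards [Lp.coeFn_smul c u.fn] with x hx
  simp [hx, mul_assoc]

/-! ### Polynomials -/

/-- The polynomial function on the plane given by `p`. -/
def polyFun (p : MvPolynomial (Fin 2) ℝ) : Plane → ℝ := fun x => MvPolynomial.eval (fun i => x i) p

theorem contDiff_polyFun (p : MvPolynomial (Fin 2) ℝ) : ContDiff ℝ ∞ (polyFun p) := by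
  induction p using MvPolynomial.induction_on with
  | C a =>
    have : polyFun (MvPolynomial.C a) = fun _ => a := by funext x; simp [polyFun]
    rw [this]; exact contDiff_const
  | add p q hp hq =>
    have : polyFun (p + q) = fun x => polyFun p x + polyFun q x := by funext x; simp [polyFun]
    rw [this]; exact hp.add hq
  | mul_X p i hp =>
    have hX : ContDiff ℝ ∞ (fun x : Plane => x i) := by fun_prop
    have : polyFun (p * MvPolynomial.X i) = fun x => polyFun p x * x i := by
      funext x; simp [polyFun]
    rw [this]; exact hp.mul hX

theorem polyFun_add (p q : MvPolynomial (Fin 2) ℝ) :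
    polyFun (p + q) = polyFun p + polyFun q := by
  funext x; simp [polyFun]

theorem polyFun_smul (c : ℝ) (p : MvPolynomial (Fin 2) ℝ) :
    polyFun (c • p) = c • polyFun p := by
  funext x; simp [polyFun, MvPolynomial.smul_eval]

/-- `P_k(K)`, the polynomial functions of degree at most `k` on `K`. -/
def polySpace (K : Set Plane) (k : ℕ) : Submodule ℝ (Jet K) where
  carrier := {v | ∃ p : MvPolynomial (Fin 2) ℝ, p.totalDegree ≤ k ∧ IsJetOf K (polyFun p) v}
  zero_mem' := ⟨0, by simp, by
    have : polyFun 0 = 0 := by funext x; simp [polyFun]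
    rw [this]; exact IsJetOf.zero K⟩
  add_mem' := by
    rintro v w ⟨p, hp, hv⟩ ⟨q, hq, hw⟩
    refine ⟨p + q, (MvPolynomial.totalDegree_add p q).trans (max_le hp hq), ?_⟩
    rw [polyFun_add]
    exact hv.add (contDiff_polyFun p) (contDiff_polyFun q) hw
  smul_mem' := by
    rintro c v ⟨p, hp, hv⟩
    refine ⟨c • p, (MvPolynomial.totalDegree_smul_le c p).trans hp, ?_⟩
    rw [polyFun_smul]
    exact hv.smul c (contDiff_polyFun p)

/-! ### Simple polygons and their boundary -/

/-- An (open) simple polygon: a bounded open simply connected set whose boundary is a closed,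
non-self-intersecting polygonal line. Consecutive edges may be aligned, so that hanging nodes of a
mesh can be counted as vertices. -/
structure SimplePolygon where
  /-- The number of vertices. -/
  n : ℕ
  three_le : 3 ≤ n
  /-- The closed polygonal line; its `i`-th edge joins vertex `i` to the next vertex. -/
  poly : Polygon Plane n
  /-- The open set enclosed by the polygonal line. -/
  carrier : Set Plane
  isOpen : IsOpen carrier
  isBounded : Bornology.IsBounded carrier
  simplyConnected : SimplyConnectedSpace carrier
  frontier_eq : frontier carrier = poly.boundary ℝ
  vertices_injective : Function.Injective poly.vertices
  /-- Two different edges can only meet in a common end point. -/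
  edges_inter : ∀ i j, i ≠ j → ∀ x, x ∈ poly.edgeSet ℝ i → x ∈ poly.edgeSet ℝ j →
    (j = finRotate n i ∧ x = poly j) ∨ (i = finRotate n j ∧ x = poly i)

/-- The unit normal vector of the `i`-th edge (its sign depends on the orientation of the
polygonal line). -/
def SimplePolygon.normal (K : SimplePolygon) (i : Fin K.n) : Fin 2 → ℝ :=
  let P := K.poly i
  let Q := K.poly (finRotate K.n i)
  ![(Q 1 - P 1) / dist P Q, (P 0 - Q 0) / dist P Q]

/-- `g` is a polynomial of degree at most `k` on the `i`-th edge. -/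
def IsEdgePoly (K : SimplePolygon) (i : Fin K.n) (k : ℕ) (g : Plane → ℝ) : Prop :=
  ∃ p : Polynomial ℝ, p.natDegree ≤ k ∧
    ∀ t ∈ Icc (0 : ℝ) 1, g (K.poly.edgePath ℝ i t) = p.eval t

/-- The functions `f n` converge to `g` in `L²(∂K)`. -/
def TendstoL2Boundary (K : SimplePolygon) (f : ℕ → Plane → ℝ) (g : Plane → ℝ) : Prop :=
  ∀ i : Fin K.n, Tendsto
    (fun m => ∫ t in (0 : ℝ)..1,
      (f m (K.poly.edgePath ℝ i t) - g (K.poly.edgePath ℝ i t)) ^ 2) atTop (𝓝 0)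

/-- `v ∈ H²(K)` and the traces of `v` and of `∇v` on `∂K` are continuous and given by `g` and `G`;
here `g`, defined on the closure of `K`, is the continuous representative of `v`. As usual, the
traces are the continuous extension of the restriction to `∂K` from functions that are smooth up
to the boundary. -/
structure HasContTrace (K : SimplePolygon) (v : Jet K.carrier) (g : Plane → ℝ)
    (G : Fin 2 → Plane → ℝ) : Prop where
  mem_H2 : v ∈ H2 K.carrier
  continuousOn_fn : ContinuousOn g (closure K.carrier)
  ae_eq : v.fn =ᵐ[volume.restrict K.carrier] g
  continuousOn_grad : ∀ i, ContinuousOn (G i) (frontier K.carrier)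
  approx : ∃ (φ : ℕ → Plane → ℝ) (J : ℕ → Jet K.carrier),
    (∀ m, ContDiff ℝ ∞ (φ m)) ∧ (∀ m, IsJetOf K.carrier (φ m) (J m)) ∧
    Tendsto J atTop (𝓝 v) ∧ TendstoL2Boundary K φ g ∧
    ∀ i, TendstoL2Boundary K (fun m => pderiv i (φ m)) (G i)

/-- The distribution `Δ² v` is a polynomial of degree at most `k` on `U`. -/
def HasPolyBilaplacian (U : Set Plane) (k : ℕ) (v : Jet U) : Prop :=
  ∃ p : MvPolynomial (Fin 2) ℝ, p.totalDegree ≤ k ∧ ∀ φ : Plane → ℝ, IsTestFunction U φ →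
    ∫ x in U, v.fn x * Laplacian.laplacian (Laplacian.laplacian φ) x = ∫ x in U, polyFun p x * φ x

/-- Membership in the space of those `v ∈ H²(K)` such that `Δ² v ∈ P₂(K)`, `v` and `∇v` are
continuous on `∂K`, and on every edge `e` one has `v ∈ P₃(e)` and `∂ₙ v ∈ P₁(e)`. -/
def MemVK (K : SimplePolygon) (v : Jet K.carrier) : Prop :=
  HasPolyBilaplacian K.carrier 2 v ∧
  ∃ (g : Plane → ℝ) (G : Fin 2 → Plane → ℝ), HasContTrace K v g G ∧
    ∀ e : Fin K.n, IsEdgePoly K e 3 g ∧ IsEdgePoly K e 1 (fun x => ∑ i, G i x * K.normal e i)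

/-- `q` is the projection `Π_K^Δ v ∈ P₂(K)` of `v`: one has `a_K(q, r) = a_K(v, r)` for all
`r ∈ P₂(K)` and `∑ᵢ q(Pᵢ) r(Pᵢ) = ∑ᵢ v(Pᵢ) r(Pᵢ)` for all `r ∈ P₁(K)`, the sum being taken over
the vertices of `K`. The value of `v` at a vertex is that of its continuous representative. -/
def IsEnergyProj (K : SimplePolygon) (v q : Jet K.carrier) : Prop :=
  q ∈ polySpace K.carrier 2 ∧
  (∀ r ∈ polySpace K.carrier 2, aForm K.carrier q r = aForm K.carrier v r) ∧
  ∃ g h : Plane → ℝ,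
    ContinuousOn g (closure K.carrier) ∧ (v.fn =ᵐ[volume.restrict K.carrier] g) ∧
    ContinuousOn h (closure K.carrier) ∧ (q.fn =ᵐ[volume.restrict K.carrier] h) ∧
    ∀ r : MvPolynomial (Fin 2) ℝ, r.totalDegree ≤ 1 →
      ∑ i, h (K.poly i) * polyFun r (K.poly i) = ∑ i, g (K.poly i) * polyFun r (K.poly i)

/-- The projection `Π_K^Δ v`. -/
def energyProj (K : SimplePolygon) (v : Jet K.carrier) : Jet K.carrier :=
  open Classical in if h : ∃ q, IsEnergyProj K v q then h.choose else 0

/-! ### Quadratic polynomials belong to the local space -/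

theorem pderiv_polyFun (i : Fin 2) (p : MvPolynomial (Fin 2) ℝ) :
    pderiv i (polyFun p) = polyFun (MvPolynomial.pderiv i p) := by
  induction p using MvPolynomial.induction_on with
  | C a =>
    have : polyFun (MvPolynomial.C a) = fun _ => a := by funext x; simp [polyFun]
    rw [this]
    funext x
    simp [pderiv, polyFun]
  | add p q hp hq =>
    rw [polyFun_add, pderiv_add (contDiff_polyFun p) (contDiff_polyFun q), hp, hq, map_add,
      polyFun_add]
  | mul_X p j hp =>
    have : polyFun (p * MvPolynomial.X j) = fun x => polyFun p x * x j := by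
      funext x; simp [polyFun]
    rw [this]
    funext x
    have hp' := congrFun hp x
    have h1 : DifferentiableAt ℝ (polyFun p) x := (contDiff_polyFun p).differentiable (by simp) x
    have hj : HasFDerivAt (fun x : Plane => x j)
        (EuclideanSpace.proj j : Plane →L[ℝ] ℝ) x :=
      (EuclideanSpace.proj j : Plane →L[ℝ] ℝ).hasFDerivAt
    have h2 : fderiv ℝ (fun y => polyFun p y * y j) x =
        polyFun p x • (EuclideanSpace.proj j : Plane →L[ℝ] ℝ) + x j • fderiv ℝ (polyFun p) x :=
      (h1.hasFDerivAt.mul hj).fderiv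
    simp only [pderiv] at hp' ⊢
    rw [h2]
    simp only [add_apply, smul_apply, hp', smul_eq_mul]
    simp [polyFun, MvPolynomial.pderiv_X, Pi.single_apply]
    by_cases hij : j = i
    · subst hij; simp
    · simp [hij, Ne.symm hij]

theorem totalDegree_pderiv_le {k : ℕ} (i : Fin 2) {p : MvPolynomial (Fin 2) ℝ}
    (hp : p.totalDegree ≤ k + 1) : (MvPolynomial.pderiv i p).totalDegree ≤ k := by
  refine Finset.sup_le fun m hm => ?_
  have hm' : m + Finsupp.single i 1 ∈ p.support := by
    rw [MvPolynomial.mem_support_iff] at hm ⊢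
    intro h
    exact hm (by rw [MvPolynomial.coeff_pderiv, h, zero_mul])
  have := (MvPolynomial.le_totalDegree hm').trans hp
  rw [Finsupp.sum_add_index' (by simp) (by simp), Finsupp.sum_single_index (by simp)] at this
  omega

theorem pderiv_eq_zero_of_totalDegree {p : MvPolynomial (Fin 2) ℝ} (hp : p.totalDegree ≤ 0)
    (i : Fin 2) : MvPolynomial.pderiv i p = 0 := by
  rw [MvPolynomial.totalDegree_eq_zero_iff_eq_C.1 (Nat.le_zero.1 hp), MvPolynomial.pderiv_C]

theorem laplacian_eq_pderiv {φ : Plane → ℝ} (hφ : ContDiff ℝ ∞ φ) :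
    Laplacian.laplacian φ = ∑ i, pderiv i (pderiv i φ) := by
  rw [InnerProductSpace.laplacian_eq_iteratedFDeriv_orthonormalBasis φ
    (EuclideanSpace.basisFun (Fin 2) ℝ)]
  funext x
  rw [Finset.sum_apply]
  refine Finset.sum_congr rfl fun i _ => ?_
  have h1 : DifferentiableAt ℝ (fderiv ℝ φ) x :=
    (hφ.fderiv_right (m := ∞) (by simp)).differentiable (by simp) x
  have h2 : pderiv i (pderiv i φ) x = (fderiv ℝ (fderiv ℝ φ) x (EuclideanSpace.single i 1))
      (EuclideanSpace.single i 1) := by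
    change fderiv ℝ (fun y => fderiv ℝ φ y (EuclideanSpace.single i 1)) x
      (EuclideanSpace.single i 1) = _
    rw [fderiv_clm_apply h1 (differentiableAt_const _)]
    simp
  rw [h2, iteratedFDeriv_two_apply]
  simp [EuclideanSpace.basisFun_apply]

theorem IsTestFunction.laplacian {U : Set Plane} {φ : Plane → ℝ} (h : IsTestFunction U φ) :
    IsTestFunction U (Laplacian.laplacian φ) := by
  rw [laplacian_eq_pderiv h.smooth, Fin.sum_univ_two]
  exact {
    smooth := ((h.pderiv 0).pderiv 0).smooth.add ((h.pderiv 1).pderiv 1).smooth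
    compact := ((h.pderiv 0).pderiv 0).compact.add ((h.pderiv 1).pderiv 1).compact
    support_subset := (tsupport_add _ _).trans
      (union_subset ((h.pderiv 0).pderiv 0).support_subset
        ((h.pderiv 1).pderiv 1).support_subset) }

theorem IsTestFunction.integrable_mul_cont {U : Set Plane} {φ f : Plane → ℝ}
    (h : IsTestFunction U φ) (hf : ContDiff ℝ ∞ f) : Integrable (fun x => f x * φ x) :=
  (hf.continuous.mul h.smooth.continuous).integrable_of_hasCompactSupport h.compact.mul_left

theorem IsTestFunction.setIntegral {U : Set Plane} {φ : Plane → ℝ} (h : IsTestFunction U φ)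
    (f : Plane → ℝ) : ∫ x in U, f x * φ x = ∫ x, f x * φ x := by
  refine setIntegral_eq_integral_of_forall_compl_eq_zero fun x hx => ?_
  rw [image_eq_zero_of_notMem_tsupport fun h' => hx (h.support_subset h'), mul_zero]

theorem IsTestFunction.integral_by_parts {U : Set Plane} {φ f : Plane → ℝ}
    (h : IsTestFunction U φ) (hf : ContDiff ℝ ∞ f) (i : Fin 2) :
    ∫ x, f x * _root_.pderiv i φ x = - ∫ x, _root_.pderiv i f x * φ x :=
  integral_mul_fderiv_eq_neg_fderiv_mul_of_integrable
    (h.integrable_mul_cont (contDiff_pderiv hf i)) ((h.pderiv i).integrable_mul_cont hf)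
    (h.integrable_mul_cont hf) (fun x _ => hf.differentiable (by simp) x)
    (fun x _ => h.smooth.differentiable (by simp) x)

theorem IsTestFunction.integral_laplacian {U : Set Plane} {φ f : Plane → ℝ}
    (h : IsTestFunction U φ) (hf : ContDiff ℝ ∞ f) :
    ∫ x, f x * Laplacian.laplacian φ x
      = ∫ x, (∑ i, _root_.pderiv i (_root_.pderiv i f) x) * φ x := by
  have key : ∀ i, ∫ x, f x * _root_.pderiv i (_root_.pderiv i φ) x
      = ∫ x, _root_.pderiv i (_root_.pderiv i f) x * φ x := fun i => by
    rw [(h.pderiv i).integral_by_parts hf, h.integral_by_parts (contDiff_pderiv hf i), neg_neg]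
  rw [laplacian_eq_pderiv h.smooth]
  simp only [Finset.sum_apply, Finset.mul_sum, Finset.sum_mul]
  rw [integral_finsetSum _ fun i _ => ((h.pderiv i).pderiv i).integrable_mul_cont hf,
    integral_finsetSum _ fun i _ =>
      h.integrable_mul_cont (contDiff_pderiv (contDiff_pderiv hf i) i)]
  exact Finset.sum_congr rfl fun i _ => key i

theorem IsJetOf.mem_H2 {U : Set Plane} {f : Plane → ℝ} {v : Jet U} (hf : ContDiff ℝ ∞ f)
    (hv : IsJetOf U f v) : v ∈ H2 U := by
  have key : ∀ (i : Fin 2) (f : Plane → ℝ) (u w : L2 U), ContDiff ℝ ∞ f →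
      u =ᵐ[volume.restrict U] f → w =ᵐ[volume.restrict U] pderiv i f → IsWeakPartial U i u w := by
    intro i f u w hf hu hw φ hφ
    have h1 : ∫ x in U, u x * pderiv i φ x = ∫ x in U, f x * pderiv i φ x :=
      integral_congr_ae (by filter_upwards [hu] with x hx; rw [hx])
    have h2 : ∫ x in U, w x * φ x = ∫ x in U, pderiv i f x * φ x :=
      integral_congr_ae (by filter_upwards [hw] with x hx; rw [hx])
    rw [h1, h2, (hφ.pderiv i).setIntegral, hφ.setIntegral, hφ.integral_by_parts hf]
  exact ⟨fun i => key i f _ _ hf hv.1 (hv.2.1 i),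
    fun i j => key j _ _ _ (contDiff_pderiv hf i) (hv.2.1 i) (hv.2.2 i j)⟩

theorem isEdgePoly_polyFun (K : SimplePolygon) (e : Fin K.n) {k : ℕ}
    {p : MvPolynomial (Fin 2) ℝ} (hp : p.totalDegree ≤ k) : IsEdgePoly K e k (polyFun p) := by
  let P := K.poly e
  let Q := K.poly (finRotate K.n e)
  let f : Fin 2 → Polynomial ℝ := fun i =>
    Polynomial.C (Q i - P i) * Polynomial.X + Polynomial.C (P i)
  refine ⟨MvPolynomial.aeval f p, ?_, fun t _ => ?_⟩
  · simpa using MvPolynomial.aeval_natDegree_le p hp f (n := 1)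
      (fun i => Polynomial.natDegree_linear_le)
  · have h : ∀ i, (K.poly.edgePath ℝ e t) i = (f i).eval t := by
      intro i
      simp [Polygon.edgePath, AffineMap.lineMap_apply, f, P, Q]
      ring
    rw [polyFun, ← Polynomial.coe_evalRingHom, MvPolynomial.aeval_def, MvPolynomial.hom_eval₂]
    simp only [h]
    rw [← MvPolynomial.eval₂_id]
    congr 1
    ext x
    simp

theorem memVK_of_mem_polySpace (K : SimplePolygon) {v : Jet K.carrier}
    (hv : v ∈ polySpace K.carrier 2) : MemVK K v := by
  obtain ⟨p, hp, hv⟩ := hv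
  have hc := contDiff_polyFun p
  refine ⟨⟨0, by simp, fun φ hφ => ?_⟩, polyFun p, fun i => pderiv i (polyFun p),
    ⟨hv.mem_H2 hc, hc.continuous.continuousOn, hv.1,
      fun i => (contDiff_pderiv hc i).continuous.continuousOn,
      fun _ => polyFun p, fun _ => v, fun _ => hc, fun _ => hv, tendsto_const_nhds, ?_, ?_⟩,
    fun e => ⟨isEdgePoly_polyFun K e (hp.trans (by norm_num)), ?_⟩⟩
  · have h1 : ∫ x in K.carrier, v.fn x * Laplacian.laplacian (Laplacian.laplacian φ) x
        = ∫ x in K.carrier, polyFun p x * Laplacian.laplacian (Laplacian.laplacian φ) x :=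
      integral_congr_ae (by filter_upwards [hv.1] with x hx; rw [hx])
    rw [h1, hφ.laplacian.laplacian.setIntegral, hφ.laplacian.integral_laplacian hc]
    have h2 : (fun x => ∑ i, pderiv i (pderiv i (polyFun p)) x) =
        polyFun (∑ i, MvPolynomial.pderiv i (MvPolynomial.pderiv i p)) := by
      funext x
      simp only [pderiv_polyFun]
      simp [polyFun]
    have h3 : ∀ i, pderiv i (polyFun (∑ i, MvPolynomial.pderiv i (MvPolynomial.pderiv i p)))
        = 0 := by
      intro i
      rw [pderiv_polyFun, pderiv_eq_zero_of_totalDegree]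
      · funext x; simp [polyFun]
      · refine (MvPolynomial.totalDegree_finsetSum _ _).trans (Finset.sup_le fun j _ => ?_)
        exact totalDegree_pderiv_le j (totalDegree_pderiv_le j hp)
    have h4 := hφ.integral_laplacian
      (contDiff_polyFun (∑ i, MvPolynomial.pderiv i (MvPolynomial.pderiv i p)))
    simp only [h3] at h4
    have h5 : ∀ i : Fin 2, pderiv i (0 : Plane → ℝ) = 0 := fun i => by
      funext x; simp [pderiv]
    simp only [h5] at h4
    simp only [congrFun h2 _, h4]
    simp [polyFun]
  · intro e; simp
  · intro i e; simp
  · have : (fun x => ∑ i, pderiv i (polyFun p) x * K.normal e i) =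
        polyFun (∑ i, K.normal e i • MvPolynomial.pderiv i p) := by
      funext x
      simp only [pderiv_polyFun]
      simp [polyFun, MvPolynomial.smul_eval, mul_comm]
    rw [this]
    refine isEdgePoly_polyFun K e
      ((MvPolynomial.totalDegree_finsetSum _ _).trans (Finset.sup_le fun j _ => ?_))
    exact (MvPolynomial.totalDegree_smul_le _ _).trans (totalDegree_pderiv_le j hp)

theorem isEnergyProj_self (K : SimplePolygon) {v : Jet K.carrier}
    (hv : v ∈ polySpace K.carrier 2) : IsEnergyProj K v v := by
  obtain ⟨p, hp, hv'⟩ := id hv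
  have hc := (contDiff_polyFun p).continuous.continuousOn (s := closure K.carrier)
  exact ⟨hv, fun _ _ => rfl, polyFun p, polyFun p, hc, hv'.1, hc, hv'.1, fun _ _ => rfl⟩

/-! ### The local and global virtual element spaces -/

theorem continuousOn_comp_edgePath (K : SimplePolygon) (e : Fin K.n) {g : Plane → ℝ}
    (hg : ContinuousOn g (frontier K.carrier)) :
    ContinuousOn (fun t : ℝ => g (K.poly.edgePath ℝ e t)) (Icc 0 1) := by
  refine hg.comp (Continuous.continuousOn ?_) fun t ht => ?_
  · simp only [Polygon.edgePath]
    exact AffineMap.lineMap_continuous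
  · rw [K.frontier_eq]
    exact mem_iUnion.2 ⟨e, mem_image_of_mem _ ht⟩

theorem TendstoL2Boundary.add {K : SimplePolygon} {f f' : ℕ → Plane → ℝ} {g g' : Plane → ℝ}
    (hf : ∀ m, Continuous (f m)) (hf' : ∀ m, Continuous (f' m))
    (hg : ContinuousOn g (frontier K.carrier)) (hg' : ContinuousOn g' (frontier K.carrier))
    (h : TendstoL2Boundary K f g) (h' : TendstoL2Boundary K f' g') :
    TendstoL2Boundary K (fun m => f m + f' m) (g + g') := by
  intro e
  have c1 := fun m => continuousOn_comp_edgePath K e (hf m).continuousOn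
  have c2 := fun m => continuousOn_comp_edgePath K e (hf' m).continuousOn
  have c3 := continuousOn_comp_edgePath K e hg
  have c4 := continuousOn_comp_edgePath K e hg'
  have i1 : ∀ m, IntervalIntegrable (fun t => (f m (K.poly.edgePath ℝ e t)
      - g (K.poly.edgePath ℝ e t)) ^ 2) volume 0 1 := fun m =>
    ContinuousOn.intervalIntegrable (by
      rw [uIcc_of_le zero_le_one]; exact ((c1 m).sub c3).pow 2)
  have i2 : ∀ m, IntervalIntegrable (fun t => (f' m (K.poly.edgePath ℝ e t)
      - g' (K.poly.edgePath ℝ e t)) ^ 2) volume 0 1 := fun m =>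
    ContinuousOn.intervalIntegrable (by
      rw [uIcc_of_le zero_le_one]; exact ((c2 m).sub c4).pow 2)
  have i3 : ∀ m, IntervalIntegrable (fun t => ((f m + f' m) (K.poly.edgePath ℝ e t)
      - (g + g') (K.poly.edgePath ℝ e t)) ^ 2) volume 0 1 := fun m =>
    ContinuousOn.intervalIntegrable (by
      rw [uIcc_of_le zero_le_one]; exact (((c1 m).add (c2 m)).sub (c3.add c4)).pow 2)
  have hlim := ((h e).const_mul 2).add ((h' e).const_mul 2)
  simp only [mul_zero, add_zero] at hlim
  refine squeeze_zero (fun m => intervalIntegral.integral_nonneg zero_le_one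
    fun t _ => sq_nonneg _) (fun m => ?_) hlim
  rw [← intervalIntegral.integral_const_mul, ← intervalIntegral.integral_const_mul,
    ← intervalIntegral.integral_add ((i1 m).const_mul 2) ((i2 m).const_mul 2)]
  refine intervalIntegral.integral_mono_on zero_le_one (i3 m)
    (((i1 m).const_mul 2).add ((i2 m).const_mul 2)) fun t _ => ?_
  simp only [Pi.add_apply]
  nlinarith [sq_nonneg ((f m (K.poly.edgePath ℝ e t) - g (K.poly.edgePath ℝ e t))
    - (f' m (K.poly.edgePath ℝ e t) - g' (K.poly.edgePath ℝ e t)))]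

theorem TendstoL2Boundary.smul {K : SimplePolygon} {f : ℕ → Plane → ℝ} {g : Plane → ℝ} (c : ℝ)
    (h : TendstoL2Boundary K f g) : TendstoL2Boundary K (fun m => c • f m) (c • g) := by
  intro e
  have := (h e).const_mul (c ^ 2)
  rw [mul_zero] at this
  refine this.congr fun m => ?_
  rw [← intervalIntegral.integral_const_mul]
  refine intervalIntegral.integral_congr fun t _ => ?_
  simp only [Pi.smul_apply, smul_eq_mul]
  ring

theorem HasContTrace.add {K : SimplePolygon} {v v' : Jet K.carrier} {g g' : Plane → ℝ}
    {G G' : Fin 2 → Plane → ℝ} (h : HasContTrace K v g G) (h' : HasContTrace K v' g' G') :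
    HasContTrace K (v + v') (g + g') (G + G') := by
  obtain ⟨φ, J, hφ, hJ, hlim, hg, hG⟩ := h.approx
  obtain ⟨φ', J', hφ', hJ', hlim', hg', hG'⟩ := h'.approx
  refine ⟨add_mem h.mem_H2 h'.mem_H2, h.continuousOn_fn.add h'.continuousOn_fn,
    (Lp.coeFn_add _ _).trans (h.ae_eq.add h'.ae_eq),
    fun i => (h.continuousOn_grad i).add (h'.continuousOn_grad i),
    fun m => φ m + φ' m, fun m => J m + J' m, fun m => (hφ m).add (hφ' m),
    fun m => (hJ m).add (hφ m) (hφ' m) (hJ' m), hlim.add hlim', ?_, fun i => ?_⟩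
  · exact TendstoL2Boundary.add (fun m => (hφ m).continuous) (fun m => (hφ' m).continuous)
      (h.continuousOn_fn.mono frontier_subset_closure)
      (h'.continuousOn_fn.mono frontier_subset_closure) hg hg'
  · simp only [pderiv_add (hφ _) (hφ' _)]
    exact TendstoL2Boundary.add (fun m => (contDiff_pderiv (hφ m) i).continuous)
      (fun m => (contDiff_pderiv (hφ' m) i).continuous)
      (h.continuousOn_grad i) (h'.continuousOn_grad i) (hG i) (hG' i)

theorem HasContTrace.smul {K : SimplePolygon} {v : Jet K.carrier} {g : Plane → ℝ}
    {G : Fin 2 → Plane → ℝ} (c : ℝ) (h : HasContTrace K v g G) :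
    HasContTrace K (c • v) (c • g) (c • G) := by
  obtain ⟨φ, J, hφ, hJ, hlim, hg, hG⟩ := h.approx
  refine ⟨(H2 K.carrier).smul_mem c h.mem_H2, h.continuousOn_fn.const_smul c,
    (Lp.coeFn_smul _ _).trans (h.ae_eq.const_smul c),
    fun i => (h.continuousOn_grad i).const_smul c,
    fun m => c • φ m, fun m => c • J m, fun m => (hφ m).const_smul c,
    fun m => (hJ m).smul c (hφ m), hlim.const_smul c, hg.smul c, fun i => ?_⟩
  simp only [pderiv_smul c (hφ _)]
  exact (hG i).smul c

theorem IsEdgePoly.add {K : SimplePolygon} {e : Fin K.n} {k : ℕ} {g g' : Plane → ℝ}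
    (h : IsEdgePoly K e k g) (h' : IsEdgePoly K e k g') : IsEdgePoly K e k (g + g') := by
  obtain ⟨p, hp, h⟩ := h
  obtain ⟨p', hp', h'⟩ := h'
  exact ⟨p + p', (Polynomial.natDegree_add_le _ _).trans (max_le hp hp'), fun t ht => by
    simp [h t ht, h' t ht]⟩

theorem IsEdgePoly.smul {K : SimplePolygon} {e : Fin K.n} {k : ℕ} {g : Plane → ℝ} (c : ℝ)
    (h : IsEdgePoly K e k g) : IsEdgePoly K e k (c • g) := by
  obtain ⟨p, hp, h⟩ := h
  exact ⟨c • p, (Polynomial.natDegree_smul_le c p).trans hp, fun t ht => by simp [h t ht]⟩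

theorem MemVK.add {K : SimplePolygon} {v v' : Jet K.carrier} (h : MemVK K v) (h' : MemVK K v') :
    MemVK K (v + v') := by
  obtain ⟨⟨p, hp, hv⟩, g, G, hg, he⟩ := h
  obtain ⟨⟨p', hp', hv'⟩, g', G', hg', he'⟩ := h'
  refine ⟨⟨p + p', (MvPolynomial.totalDegree_add _ _).trans (max_le hp hp'), fun φ hφ => ?_⟩,
    g + g', G + G', hg.add hg', fun e => ⟨(he e).1.add (he' e).1, ?_⟩⟩
  · have h1 : ∫ x in K.carrier, (v + v').fn x * Laplacian.laplacian (Laplacian.laplacian φ) x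
        = ∫ x in K.carrier, (v.fn x * Laplacian.laplacian (Laplacian.laplacian φ) x
          + v'.fn x * Laplacian.laplacian (Laplacian.laplacian φ) x) := by
      refine integral_congr_ae ?_
      filter_upwards [Lp.coeFn_add v.fn v'.fn] with x hx
      change (v.fn + v'.fn : L2 K.carrier) x * _ = _
      rw [hx, Pi.add_apply, add_mul]
    rw [h1, integral_add (hφ.laplacian.laplacian.integrable_mul _)
      (hφ.laplacian.laplacian.integrable_mul _), hv φ hφ, hv' φ hφ, polyFun_add,
      ← integral_add (hφ.integrable_mul_cont (contDiff_polyFun p)).restrict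
        (hφ.integrable_mul_cont (contDiff_polyFun p')).restrict]
    simp [add_mul]
  · convert (he e).2.add (he' e).2 using 1
    funext x
    simp [add_mul, Finset.sum_add_distrib]

theorem MemVK.smul {K : SimplePolygon} {v : Jet K.carrier} (c : ℝ) (h : MemVK K v) :
    MemVK K (c • v) := by
  obtain ⟨⟨p, hp, hv⟩, g, G, hg, he⟩ := h
  refine ⟨⟨c • p, (MvPolynomial.totalDegree_smul_le _ _).trans hp, fun φ hφ => ?_⟩,
    c • g, c • G, hg.smul c, fun e => ⟨(he e).1.smul c, ?_⟩⟩
  · have h1 : ∫ x in K.carrier, (c • v).fn x * Laplacian.laplacian (Laplacian.laplacian φ) x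
        = ∫ x in K.carrier, c * (v.fn x * Laplacian.laplacian (Laplacian.laplacian φ) x) := by
      refine integral_congr_ae ?_
      filter_upwards [Lp.coeFn_smul c v.fn] with x hx
      change (c • v.fn : L2 K.carrier) x * _ = _
      rw [hx, Pi.smul_apply, smul_eq_mul, mul_assoc]
    rw [h1, integral_const_mul, hv φ hφ, polyFun_smul, ← integral_const_mul]
    simp [mul_assoc]
  · convert (he e).2.smul c using 1
    funext x
    simp [mul_add, mul_assoc]

theorem IsEnergyProj.add {K : SimplePolygon} {v v' q q' : Jet K.carrier}
    (h : IsEnergyProj K v q) (h' : IsEnergyProj K v' q') : IsEnergyProj K (v + v') (q + q') := by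
  obtain ⟨hq, ha, g, f, hg, hvg, hf, hqf, hP⟩ := h
  obtain ⟨hq', ha', g', f', hg', hvg', hf', hqf', hP'⟩ := h'
  refine ⟨add_mem hq hq', fun r hr => ?_, g + g', f + f', hg.add hg',
    (Lp.coeFn_add _ _).trans (hvg.add hvg'), hf.add hf',
    (Lp.coeFn_add _ _).trans (hqf.add hqf'), fun r hr => ?_⟩
  · rw [aForm_add_left, aForm_add_left, ha r hr, ha' r hr]
  · simp [add_mul, Finset.sum_add_distrib, hP r hr, hP' r hr]

theorem IsEnergyProj.smul {K : SimplePolygon} {v q : Jet K.carrier} (c : ℝ)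
    (h : IsEnergyProj K v q) : IsEnergyProj K (c • v) (c • q) := by
  obtain ⟨hq, ha, g, f, hg, hvg, hf, hqf, hP⟩ := h
  refine ⟨Submodule.smul_mem _ c hq, fun r hr => ?_, c • g, c • f, hg.const_smul c,
    (Lp.coeFn_smul _ _).trans (hvg.const_smul c), hf.const_smul c,
    (Lp.coeFn_smul _ _).trans (hqf.const_smul c), fun r hr => ?_⟩
  · rw [aForm_smul_left, aForm_smul_left, ha r hr]
  · simp only [Pi.smul_apply, smul_eq_mul, mul_assoc, ← Finset.mul_sum, hP r hr]

/-- The local virtual element space `W_h^K`: the functions `v` of the space described by `MemVK`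
with `∫_K (Π_K^Δ v) r = ∫_K v r` for all `r ∈ P₂(K)`. -/
def localSpace (K : SimplePolygon) : Submodule ℝ (Jet K.carrier) where
  carrier := {v | MemVK K v ∧ ∃ q, IsEnergyProj K v q ∧
    ∀ r ∈ polySpace K.carrier 2, bForm K.carrier q r = bForm K.carrier v r}
  zero_mem' := ⟨memVK_of_mem_polySpace K (zero_mem _), 0, isEnergyProj_self K (zero_mem _),
    fun _ _ => rfl⟩
  add_mem' := by
    rintro v v' ⟨hv, q, hq, hb⟩ ⟨hv', q', hq', hb'⟩
    exact ⟨hv.add hv', q + q', hq.add hq', fun r hr => by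
      rw [bForm_add_left, bForm_add_left, hb r hr, hb' r hr]⟩
  smul_mem' := by
    rintro c v ⟨hv, q, hq, hb⟩
    exact ⟨hv.smul c, c • q, hq.smul c, fun r hr => by
      rw [bForm_smul_left, bForm_smul_left, hb r hr]⟩

theorem polySpace_le_localSpace (K : SimplePolygon) : polySpace K.carrier 2 ≤ localSpace K :=
  fun v hv => ⟨memVK_of_mem_polySpace K hv, v, isEnergyProj_self K hv, fun _ _ => rfl⟩

theorem energyProj_spec (K : SimplePolygon) (v : localSpace K) :
    IsEnergyProj K v (energyProj K v) := by
  have h : ∃ q, IsEnergyProj K v q := v.2.2.imp fun _ h => h.1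
  rw [energyProj, dif_pos h]
  exact h.choose_spec

/-- `v - Π_K^Δ v`, as an element of `W_h^K`. -/
def projRemainder (K : SimplePolygon) (v : localSpace K) : localSpace K :=
  ⟨v - energyProj K v,
    sub_mem v.2 (polySpace_le_localSpace K (energyProj_spec K v).1)⟩

/-- The pair of stabilizing forms `s_K`, `s_K⁰` on `W_h^K`: symmetric positive definite bilinear
forms with `c₀ a_K(v, v) ≤ s_K(v, v) ≤ c₁ a_K(v, v)` for `v ∈ W_h^K` with `Π_K^Δ v = 0`, and
`c₂ b_K(v, v) ≤ s_K⁰(v, v) ≤ c₃ b_K(v, v)` for `v ∈ W_h^K`. -/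
structure IsStabilization (K : SimplePolygon) (c₀ c₁ c₂ c₃ : ℝ)
    (s s0 : LinearMap.BilinForm ℝ (localSpace K)) : Prop where
  symm : ∀ u v, s u v = s v u
  pos : ∀ v, v ≠ 0 → 0 < s v v
  symm0 : ∀ u v, s0 u v = s0 v u
  pos0 : ∀ v, v ≠ 0 → 0 < s0 v v
  bound : ∀ v : localSpace K, energyProj K v = 0 →
    c₀ * aForm K.carrier v v ≤ s v v ∧ s v v ≤ c₁ * aForm K.carrier v v
  bound0 : ∀ v : localSpace K,
    c₂ * bForm K.carrier v v ≤ s0 v v ∧ s0 v v ≤ c₃ * bForm K.carrier v v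

/-- `a_{h,K}(u, v) = a_K(Π_K^Δ u, Π_K^Δ v) + s_K(u - Π_K^Δ u, v - Π_K^Δ v)`. -/
def discreteALocal (K : SimplePolygon) (s : LinearMap.BilinForm ℝ (localSpace K))
    (u v : localSpace K) : ℝ :=
  aForm K.carrier (energyProj K u) (energyProj K v) + s (projRemainder K u) (projRemainder K v)

/-- `b_{h,K}(u, v) = b_K(Π_K^Δ u, Π_K^Δ v) + s_K⁰(u - Π_K^Δ u, v - Π_K^Δ v)`. -/
def discreteBLocal (K : SimplePolygon) (s0 : LinearMap.BilinForm ℝ (localSpace K))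
    (u v : localSpace K) : ℝ :=
  bForm K.carrier (energyProj K u) (energyProj K v) + s0 (projRemainder K u) (projRemainder K v)

/-- A bounded simply connected polygonal domain. -/
structure IsPolygonalDomain (Ω : Set Plane) : Prop where
  isOpen : IsOpen Ω
  isBounded : Bornology.IsBounded Ω
  simplyConnected : SimplyConnectedSpace Ω
  frontier_eq : ∃ S : Finset (Plane × Plane), frontier Ω = ⋃ e ∈ S, segment ℝ e.1 e.2

/-- A decomposition of `Ω` into finitely many simple polygons. -/
structure PolygonalMesh (Ω : Set Plane) where
  /-- The number of elements. -/
  numCells : ℕ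
  /-- The elements of the mesh. -/
  cell : Fin numCells → SimplePolygon
  subset : ∀ k, (cell k).carrier ⊆ Ω
  disjoint : ∀ k l, k ≠ l → Disjoint (cell k).carrier (cell l).carrier
  cover : ⋃ k, closure (cell k).carrier = closure Ω

namespace PolygonalMesh

variable {Ω : Set Plane}

/-- The mesh assumptions with constant `C`: for every element `K` the ratio between the shortest
edge and the diameter `h_K` is larger than `C`, and `K` is star-shaped with respect to every point
of a ball of radius `C h_K`. -/
structure IsRegular (M : PolygonalMesh Ω) (C : ℝ) : Prop where
  pos : 0 < C
  edge : ∀ k (i : Fin (M.cell k).n), C * Metric.diam (M.cell k).carrier <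
    dist ((M.cell k).poly i) ((M.cell k).poly (finRotate (M.cell k).n i))
  star : ∀ k, ∃ c : Plane, ∀ y ∈ Metric.ball c (C * Metric.diam (M.cell k).carrier),
    StarConvex ℝ y (M.cell k).carrier

/-- The global virtual element space `W_h = {v ∈ H₀²(Ω) : v|_K ∈ W_h^K for every element K}`. -/
def space (M : PolygonalMesh Ω) : Submodule ℝ (Jet Ω) :=
  H20 Ω ⊓ ⨅ k, (localSpace (M.cell k)).comap (restrictJet (M.subset k))

theorem restrictJet_mem (M : PolygonalMesh Ω) (k : Fin M.numCells) {v : Jet Ω}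
    (hv : v ∈ M.space) : restrictJet (M.subset k) v ∈ localSpace (M.cell k) := by
  have h1 := (Submodule.mem_inf.1 hv).2
  have h2 := (Submodule.mem_iInf _).1 h1 k
  exact Submodule.mem_comap.1 h2

/-- The restriction of `v ∈ W_h` to the `k`-th element. -/
def localPart (M : PolygonalMesh Ω) (k : Fin M.numCells) (v : M.space) : localSpace (M.cell k) :=
  ⟨restrictJet (M.subset k) v, M.restrictJet_mem k v.2⟩

/-- `a_h(u, v) = ∑_K a_{h,K}(u, v)`. -/
def discreteA (M : PolygonalMesh Ω) (s : ∀ k, LinearMap.BilinForm ℝ (localSpace (M.cell k)))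
    (u v : M.space) : ℝ :=
  ∑ k, discreteALocal (M.cell k) (s k) (M.localPart k u) (M.localPart k v)

/-- `b_h(u, v) = ∑_K b_{h,K}(u, v)`. -/
def discreteB (M : PolygonalMesh Ω) (s0 : ∀ k, LinearMap.BilinForm ℝ (localSpace (M.cell k)))
    (u v : M.space) : ℝ :=
  ∑ k, discreteBLocal (M.cell k) (s0 k) (M.localPart k u) (M.localPart k v)

/-- `T` is the discrete solution operator `T_h`: for every `f ∈ W_h`, `T f` is the unique `u ∈ W_h`
with `a_h(u, v) = b_h(f, v)` for all `v ∈ W_h`. -/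
def IsSolutionOperator (M : PolygonalMesh Ω)
    (s s0 : ∀ k, LinearMap.BilinForm ℝ (localSpace (M.cell k))) (T : Module.End ℝ M.space) : Prop :=
  ∀ f u : M.space, T f = u ↔ ∀ v : M.space, M.discreteA s u v = M.discreteB s0 f v

end PolygonalMesh

/-- The complexification of a linear operator on a real vector space. -/
abbrev complexify {V : Type*} [AddCommGroup V] [Module ℝ V] (T : Module.End ℝ V) :
    Module.End ℂ (ℂ ⊗[ℝ] V) :=
  LinearMap.baseChange ℂ T

end

/-! Once `a_h` and `b_h` are known to be symmetric positive definite on a finite dimensional space,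
`T_h` is `A⁻¹B`. It is symmetric for the inner product `a_h`, hence diagonal in a real basis, with
eigenvalues `b_h(x, x) / a_h(x, x) > 0`. The basis survives complexification, so eigenspaces and
generalized eigenspaces coincide (`LinearMap.BilinForm.exists_solution_operator`,
`complexify_spectrum_of_basis`). The work lies in finite dimensionality and definiteness.

Finite dimensionality is a uniqueness statement: `v` in `W_h^K` is determined by `Δ²v` and by the
edge polynomials of `v` and `∂ₙv`, which range over a finite dimensional space. If these data
vanish, so does the whole trace of `∇v`, the tangential part being the derivative of a zero trace.
The extension of `v` by zero is then of class `H²` on the plane. Here the divergence theorem on the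
polygon is replaced by the bound `abs_setIntegral_pderiv_le` of `∫_K ∂ᵢF` by the integrals of `|F|`
on the edges, proved by slicing along lines. To conclude `v = 0` (`eq_zero_of_biharmonic`), the
equation cannot be tested with `v` itself. Star-shapedness allows the extension of `v` to be shrunk
into `K` and mollified, which gives a true test function; the pairing is close to the energy `∫
|D²v|²`, up to a positive factor, so the energy vanishes. A compactly supported function with zero
weak Hessian on the plane is zero. Cells cover `Ω` up to a null set, so `W_h` embeds in the product
of the local spaces.

Definiteness: if `a_h(v, v) = 0`, then on each cell the remainder `v - Πv` vanishes, so `D²v = D²Πv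
= 0` there; hence `D²v = 0` on `Ω`, and `v = 0` because `v` is in `H₀²(Ω)`. If `b_h(v, v) = 0`, then
on each cell `v = Πv` is a polynomial of zero `L²` norm. The forms are bilinear because the
projection, defined by a choice, is unique (`IsEnergyProj.eq_zero`). -/

/-! ### Diagonal operators and symmetric pencils -/

section Diagonal

variable {𝕜 V ι : Type*} [Field 𝕜] [AddCommGroup V] [Module 𝕜 V]

/-- In coordinates `T - z` multiplies by `μ i - z`. A vector killed by a power of it therefore has
no coordinate with `μ i ≠ z`, which is what rules out Jordan blocks. -/
theorem Module.Basis.repr_pow_sub_apply (b : Module.Basis ι 𝕜 V) {T : Module.End 𝕜 V} {μ : ι → 𝕜}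
    (hT : ∀ i, T (b i) = μ i • b i) (z : 𝕜) (k : ℕ) (x : V) (i : ι) :
    b.repr (((T - algebraMap 𝕜 _ z) ^ k) x) i = (μ i - z) ^ k * b.repr x i := by
  have h1 : ∀ x, b.repr ((T - algebraMap 𝕜 (Module.End 𝕜 V) z) x) i
      = (μ i - z) * b.repr x i := by
    intro x
    have : (Finsupp.lapply i ∘ₗ b.repr.toLinearMap) ∘ₗ (T - algebraMap 𝕜 (Module.End 𝕜 V) z)
        = (μ i - z) • (Finsupp.lapply i ∘ₗ b.repr.toLinearMap) := by
      refine b.ext fun j => ?_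
      by_cases hij : j = i
      · subst hij; simp [hT, Module.algebraMap_end_apply]
      · simp [hT, Module.algebraMap_end_apply, hij]
    simpa using LinearMap.congr_fun this x
  induction k with
  | zero => simp
  | succ k ih => rw [pow_succ', Module.End.mul_apply, h1, ih, pow_succ']; ring

theorem Module.Basis.span_eigenvectors (b : Module.Basis ι 𝕜 V) {T : Module.End 𝕜 V} {μ : ι → 𝕜}
    (hT : ∀ i, T (b i) = μ i • b i) (z : 𝕜) :
    T.eigenspace z = Submodule.span 𝕜 (b '' {i | μ i = z}) ∧
      T.maxGenEigenspace z = Submodule.span 𝕜 (b '' {i | μ i = z}) := by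
  have h1 : Submodule.span 𝕜 (b '' {i | μ i = z}) ≤ T.eigenspace z := by
    rw [Submodule.span_le]
    rintro _ ⟨i, rfl, rfl⟩
    exact Module.End.mem_eigenspace_iff.2 (hT i)
  have h2 : T.eigenspace z ≤ T.maxGenEigenspace z :=
    Module.End.genEigenspace_le_maximal (f := T) (μ := z) (k := 1)
  have h3 : T.maxGenEigenspace z ≤ Submodule.span 𝕜 (b '' {i | μ i = z}) := by
    intro x hx
    obtain ⟨k, hk⟩ := (Module.End.mem_maxGenEigenspace T z x).1 hx
    rw [b.mem_span_image]
    intro i hi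
    by_contra hne
    have := b.repr_pow_sub_apply hT z k x i
    have hk' : ((T - algebraMap 𝕜 (Module.End 𝕜 V) z) ^ k) x = 0 := hk
    rw [hk'] at this
    have h0 : (μ i - z) ^ k ≠ 0 := pow_ne_zero _ (sub_ne_zero.2 hne)
    simp only [map_zero, Finsupp.coe_zero, Pi.zero_apply] at this
    exact (Finsupp.mem_support_iff.1 hi) ((mul_eq_zero.1 this.symm).resolve_left h0)
  exact ⟨le_antisymm (h2.trans h3) h1, le_antisymm h3 (h1.trans h2)⟩

theorem Module.Basis.finrank_eigenspace_eq_card [Fintype ι] (b : Module.Basis ι 𝕜 V)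
    {T : Module.End 𝕜 V} {μ : ι → 𝕜} (hT : ∀ i, T (b i) = μ i • b i) (z : 𝕜) :
    Module.finrank 𝕜 (T.eigenspace z) = Nat.card {i // μ i = z} ∧
      Module.finrank 𝕜 (T.maxGenEigenspace z) = Nat.card {i // μ i = z} := by
  classical
  have h := b.span_eigenvectors hT z
  have h' : Module.finrank 𝕜 (Submodule.span 𝕜 (b '' {i | μ i = z})) = Nat.card {i // μ i = z} := by
    rw [Nat.card_eq_fintype_card, ← finrank_span_eq_card (R := 𝕜)
      (b := fun i : {i // μ i = z} => b i) (b.linearIndependent.comp _ Subtype.val_injective),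
      Set.image_eq_range]
    rfl
  exact ⟨h.1 ▸ h', h.2 ▸ h'⟩

theorem Module.Basis.spectrum_eq_range [Fintype ι] (b : Module.Basis ι 𝕜 V)
    {T : Module.End 𝕜 V} {μ : ι → 𝕜} (hT : ∀ i, T (b i) = μ i • b i) :
    spectrum 𝕜 T = Set.range μ := by
  have : FiniteDimensional 𝕜 V := b.finiteDimensional_of_finite
  ext z
  rw [← Module.End.hasEigenvalue_iff_mem_spectrum, Module.End.hasEigenvalue_iff,
    (b.span_eigenvectors hT z).1, Ne, Submodule.span_eq_bot]
  constructor
  · intro h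
    push Not at h
    obtain ⟨_, ⟨i, hi, rfl⟩, -⟩ := h
    exact ⟨i, hi⟩
  · rintro ⟨i, hi⟩ h
    exact b.ne_zero i (h _ ⟨i, hi, rfl⟩)

end Diagonal

/-- A pair of symmetric positive definite forms on a finite dimensional real space can be
diagonalized simultaneously. -/
theorem LinearMap.BilinForm.exists_solution_operator {V : Type*} [AddCommGroup V] [Module ℝ V]
    [FiniteDimensional ℝ V] (A B : LinearMap.BilinForm ℝ V)
    (hAs : ∀ u v, A u v = A v u) (hA : ∀ v, v ≠ 0 → 0 < A v v)
    (hBs : ∀ u v, B u v = B v u) (hB : ∀ v, v ≠ 0 → 0 < B v v) :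
    ∃ T : Module.End ℝ V, (∀ f u, T f = u ↔ ∀ v, A u v = B f v) ∧
      ∃ (b : Module.Basis (Fin (Module.finrank ℝ V)) ℝ V) (μ : Fin (Module.finrank ℝ V) → ℝ),
        (∀ i, 0 < μ i) ∧ ∀ i, T (b i) = μ i • b i := by
  have hinj : Function.Injective A := by
    rw [← LinearMap.ker_eq_bot, LinearMap.ker_eq_bot']
    intro u hu
    by_contra h
    have := hA u h
    rw [hu] at this
    simp at this
  -- Definiteness makes `A` injective, and `V` and its dual have the same dimension; this inverse
  -- replaces the Lax–Milgram argument.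
  let e : V ≃ₗ[ℝ] Module.Dual ℝ V :=
    LinearEquiv.ofInjectiveOfFinrankEq A hinj (Subspace.dual_finrank_eq).symm
  have he : ∀ u, e u = A u := fun u => rfl
  let T : Module.End ℝ V := e.symm.toLinearMap ∘ₗ B
  have hT : ∀ f v, A (T f) v = B f v := fun f v => by
    rw [← he]; simp [T]
  have hTu : ∀ f u, T f = u ↔ ∀ v, A u v = B f v := by
    intro f u
    constructor
    · rintro rfl v; exact hT f v
    · intro h
      exact hinj (LinearMap.ext fun v => by rw [hT, h])
  -- `V` is given the inner product `A`, for which `T` is symmetric, so that the spectral theorem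
  -- applies.
  let core : InnerProductSpace.Core ℝ V :=
    { inner := fun u v => A u v
      conj_inner_symm := fun u v => hAs v u
      re_inner_nonneg := fun u => by
        by_cases h : u = 0
        · subst h; simp
        · exact (hA u h).le
      add_left := fun u v w => by simp
      smul_left := fun u v r => by simp
      definite := fun u h => by
        by_contra h0
        exact (hA u h0).ne' h }
  let _ : NormedAddCommGroup V := core.toNormedAddCommGroup
  let _ : InnerProductSpace ℝ V := InnerProductSpace.ofCore core.toCore
  have hinner : ∀ u v : V, inner ℝ u v = A u v := fun _ _ => rfl
  have hsym : T.IsSymmetric := fun u v => by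
    rw [hinner, hinner, hT, hAs, hT, hBs]
  refine ⟨T, hTu, (hsym.eigenvectorBasis rfl).toBasis, hsym.eigenvalues rfl, fun i => ?_,
    fun i => ?_⟩
  -- For an eigenvector `x`, `μ A(x, x) = A(T x, x) = B(x, x)`, and both forms are positive at `x`.
  · have h1 := hsym.apply_eigenvectorBasis rfl i
    set x := hsym.eigenvectorBasis rfl i with hx
    have hx0 : x ≠ 0 := (hsym.eigenvectorBasis rfl).toBasis.ne_zero i ∘ by simp [hx]
    have h2 := hT x x
    rw [h1] at h2
    have h3 : hsym.eigenvalues rfl i * A x x = B x x := by simpa using h2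
    exact pos_of_mul_pos_left (h3 ▸ hB x hx0) (hA x hx0).le
  · simp [hsym.apply_eigenvectorBasis rfl i]

/-- The spectrum of the complexification of a diagonalizable operator. -/
theorem complexify_spectrum_of_basis {V ι : Type*} [AddCommGroup V] [Module ℝ V] [Fintype ι]
    (b : Module.Basis ι ℝ V) (T : Module.End ℝ V) (μ : ι → ℝ) (hT : ∀ i, T (b i) = μ i • b i) :
    spectrum ℂ (complexify T) = Set.range (fun i => (μ i : ℂ)) ∧
      ∀ z : ℂ,
        Module.finrank ℂ ((complexify T).eigenspace z) = Nat.card {i // (μ i : ℂ) = z} ∧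
        Module.finrank ℂ ((complexify T).maxGenEigenspace z) = Nat.card {i // (μ i : ℂ) = z} := by
  have h : ∀ i, complexify T (b.baseChange ℂ i) = (μ i : ℂ) • b.baseChange ℂ i := by
    intro i
    rw [Module.Basis.baseChange_apply, LinearMap.baseChange_tmul, hT, TensorProduct.tmul_smul]
    rw [← algebraMap_smul ℂ (μ i)]
    rfl
  exact ⟨(b.baseChange ℂ).spectrum_eq_range h, (b.baseChange ℂ).finrank_eigenspace_eq_card h⟩

/-! ### Integrals of derivatives over open sets with polygonal boundary -/

/-- Off its frontier, the space is the disjoint union of the open sets `O` and `(closure O)ᶜ`. -/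
theorem IsPreconnected.subset_or_disjoint_of_disjoint_frontier {X : Type*} [TopologicalSpace X]
    {s O : Set X} (hs : IsPreconnected s) (hO : IsOpen O) (h : Disjoint s (frontier O)) :
    s ⊆ O ∨ Disjoint s O := by
  have hcov : s ⊆ O ∪ (closure O)ᶜ := by
    intro x hx
    by_cases h1 : x ∈ closure O
    · left
      by_contra h2
      exact Set.disjoint_left.1 h hx (by rw [hO.frontier_eq]; exact ⟨h1, h2⟩)
    · exact Or.inr h1
  have hdis : Disjoint O (closure O)ᶜ :=
    Set.disjoint_left.2 fun x hx hx' => hx' (subset_closure hx)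
  rcases hs.subset_or_subset hO isClosed_closure.isOpen_compl hdis hcov with h1 | h1
  · exact Or.inl h1
  · exact Or.inr (Set.disjoint_left.2 fun x hx hx' => h1 hx (subset_closure hx'))

/-- Between consecutive points of `S` the interval lies inside `O` or outside it, so each piece
contributes a difference of two values of `f` or nothing. The factor `2 ^ S.card` is crude: each
induction step cuts at one point and applies the bound for the remaining points to both halves. -/
theorem abs_setIntegral_deriv_le {f : ℝ → ℝ} (hf : ContDiff ℝ 1 f) {O : Set ℝ} (hO : IsOpen O)
    (S : Finset ℝ) : ∀ a b : ℝ, a ≤ b → (∀ x ∈ Ioo a b, x ∈ frontier O → x ∈ S) →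
      |∫ x in O ∩ Ioo a b, deriv f x| ≤ 2 ^ S.card * (|f a| + |f b| + 2 * ∑ s ∈ S, |f s|) := by
  have hc : Continuous (deriv f) := hf.continuous_deriv le_rfl
  induction S using Finset.induction_on with
  | empty =>
    intro a b hab h
    have hd : Disjoint (Ioo a b) (frontier O) :=
      Set.disjoint_left.2 fun x hx hx' => by simpa using h x hx hx'
    rcases isPreconnected_Ioo.subset_or_disjoint_of_disjoint_frontier hO hd with h1 | h1
    · rw [inter_eq_right.2 h1, ← integral_Ioc_eq_integral_Ioo,
        ← intervalIntegral.integral_of_le hab,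
        intervalIntegral.integral_deriv_eq_sub (fun x _ => hf.differentiable (by simp) x)
          (hc.intervalIntegrable _ _)]
      simp only [Finset.card_empty, pow_zero, one_mul, Finset.sum_empty, mul_zero, add_zero]
      have := abs_sub (f b) (f a)
      linarith
    · rw [inter_comm, h1.inter_eq]
      simp only [Measure.restrict_empty, integral_zero_measure, abs_zero]
      positivity
  | insert s S hs ih =>
    intro a b hab h
    rw [Finset.card_insert_of_notMem hs, Finset.sum_insert hs, pow_succ]
    have hp : (0 : ℝ) < 2 ^ S.card := by positivity
    have hsum : 0 ≤ ∑ s ∈ S, |f s| := Finset.sum_nonneg fun _ _ => abs_nonneg _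
    by_cases hsab : s ∈ Ioo a b
    · have h1 := ih a s hsab.1.le fun x hx hx' => by
        have := h x ⟨hx.1, hx.2.trans hsab.2⟩ hx'
        exact (Finset.mem_insert.1 this).resolve_left hx.2.ne
      have h2 := ih s b hsab.2.le fun x hx hx' => by
        have := h x ⟨hsab.1.trans hx.1, hx.2⟩ hx'
        exact (Finset.mem_insert.1 this).resolve_left hx.1.ne'
      have hint : ∀ c d : ℝ, IntegrableOn (deriv f) (O ∩ Ioo c d) := fun c d =>
        ((hc.integrableOn_Icc (a := c) (b := d)).mono_set Ioo_subset_Icc_self).mono_set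
          inter_subset_right
      have hsplit : ∫ x in O ∩ Ioo a b, deriv f x
          = (∫ x in O ∩ Ioo a s, deriv f x) + ∫ x in O ∩ Ioo s b, deriv f x := by
        rw [← setIntegral_union _ (hO.inter isOpen_Ioo).measurableSet (hint _ _) (hint _ _)]
        · refine setIntegral_congr_set ?_
          have hne : ∀ᵐ x : ℝ, x ≠ s := by
            simp [ae_iff]
          filter_upwards [hne] with x hx
          refine propext ⟨fun h => ?_, fun h => ?_⟩
          · rcases lt_or_gt_of_ne hx with h' | h'
            · exact Or.inl ⟨h.1, h.2.1, h'⟩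
            · exact Or.inr ⟨h.1, h', h.2.2⟩
          · rcases h with h | h
            · exact ⟨h.1, h.2.1, h.2.2.trans hsab.2⟩
            · exact ⟨h.1, hsab.1.trans h.2.1, h.2.2⟩
        · exact Set.disjoint_left.2 fun x hx hx' => lt_asymm hx.2.2 hx'.2.1
      rw [hsplit]
      refine (abs_add_le _ _).trans ((add_le_add h1 h2).trans ?_)
      nlinarith [abs_nonneg (f a), abs_nonneg (f b), abs_nonneg (f s),
        mul_nonneg hp.le (abs_nonneg (f a)), mul_nonneg hp.le (abs_nonneg (f b)),
        mul_nonneg hp.le (abs_nonneg (f s)), mul_nonneg hp.le hsum]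
    · have h1 := ih a b hab fun x hx hx' => by
        have := h x hx hx'
        exact (Finset.mem_insert.1 this).resolve_left fun h' => hsab (h' ▸ hx)
      refine h1.trans ?_
      nlinarith [mul_nonneg hp.le (abs_nonneg (f a)), mul_nonneg hp.le (abs_nonneg (f b)),
        mul_nonneg hp.le (abs_nonneg (f s)), mul_nonneg hp.le hsum]

/-! ### Slicing the plane along coordinate lines -/

/-- The point of the plane with `i`-th coordinate `s` and other coordinate `y`. -/
noncomputable def Plane.mkCoord (i : Fin 2) (s y : ℝ) : Plane :=
  s • EuclideanSpace.single i 1 + y • EuclideanSpace.single (i + 1) 1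

theorem Plane.mkCoord_apply_self (i : Fin 2) (s y : ℝ) : Plane.mkCoord i s y i = s := by
  fin_cases i <;> simp [Plane.mkCoord]

theorem Plane.mkCoord_apply_other (i : Fin 2) (s y : ℝ) :
    Plane.mkCoord i s y (i + 1) = y := by
  fin_cases i <;> simp [Plane.mkCoord]

theorem Plane.mkCoord_coords (i : Fin 2) (x : Plane) :
    Plane.mkCoord i (x i) (x (i + 1)) = x := by
  ext j
  fin_cases i <;> fin_cases j <;> simp [Plane.mkCoord]

/-- The pair is ordered as `(y, s)`, so that Fubini puts the integral along the direction `i`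
inside. -/
theorem Plane.measurePreserving_mkCoord (i : Fin 2) :
    MeasurePreserving (fun p : ℝ × ℝ => Plane.mkCoord i p.2 p.1) := by
  have h := (PiLp.volume_preserving_toLp (Fin 2)).comp (volume_preserving_finTwoArrow ℝ).symm
  have h0 : ∀ s y : ℝ, Plane.mkCoord 0 s y = WithLp.toLp 2 (MeasurableEquiv.finTwoArrow.symm (s, y)) := by
    intro s y
    ext j
    fin_cases j <;> simp [Plane.mkCoord]
  have h1 : ∀ s y : ℝ, Plane.mkCoord 1 s y = WithLp.toLp 2 (MeasurableEquiv.finTwoArrow.symm (y, s)) := by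
    intro s y
    ext j
    fin_cases j <;> simp [Plane.mkCoord]
  fin_cases i
  · have h2 := h.comp (Measure.measurePreserving_swap (μ := (volume : Measure ℝ))
      (ν := (volume : Measure ℝ)))
    have h3 : (fun p : ℝ × ℝ => Plane.mkCoord 0 p.2 p.1) =
        (WithLp.toLp 2 ∘ MeasurableEquiv.finTwoArrow.symm) ∘ Prod.swap := funext fun p => h0 _ _
    exact h3 ▸ h2
  · have h3 : (fun p : ℝ × ℝ => Plane.mkCoord 1 p.2 p.1) =
        WithLp.toLp 2 ∘ MeasurableEquiv.finTwoArrow.symm := funext fun p => h1 _ _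
    exact h3 ▸ h

theorem Plane.measurableEmbedding_mkCoord (i : Fin 2) :
    MeasurableEmbedding (fun p : ℝ × ℝ => Plane.mkCoord i p.2 p.1) := by
  have hc : Continuous (fun p : ℝ × ℝ => Plane.mkCoord i p.2 p.1) := by
    unfold Plane.mkCoord; fun_prop
  refine hc.measurableEmbedding fun p q h => ?_
  have h1 := congrArg (fun x : Plane => x i) h
  have h2 := congrArg (fun x : Plane => x (i + 1)) h
  simp only [Plane.mkCoord_apply_self, Plane.mkCoord_apply_other] at h1 h2
  exact Prod.ext h2 h1

theorem Plane.integral_eq_integral_mkCoord (i : Fin 2) {G : Plane → ℝ} (hG : Integrable G) :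
    ∫ x, G x = ∫ y, ∫ s, G (Plane.mkCoord i s y) := by
  rw [← (Plane.measurePreserving_mkCoord i).integral_comp (Plane.measurableEmbedding_mkCoord i)]
  exact integral_prod _ ((Plane.measurePreserving_mkCoord i).integrable_comp_of_integrable hG)

theorem Plane.hasDerivAt_mkCoord (i : Fin 2) {F : Plane → ℝ} (hF : Differentiable ℝ F) (s y : ℝ) :
    HasDerivAt (fun s => F (Plane.mkCoord i s y)) (pderiv i F (Plane.mkCoord i s y)) s := by
  have h1 : HasDerivAt (fun s => Plane.mkCoord i s y) (EuclideanSpace.single i 1) s := by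
    have := ((hasDerivAt_id s).smul_const (EuclideanSpace.single i (1 : ℝ) : Plane)).add_const
      (y • (EuclideanSpace.single (i + 1) (1 : ℝ) : Plane))
    simpa [Plane.mkCoord] using this
  exact (hF _).hasFDerivAt.comp_hasDerivAt s h1

/-- The part of the boundary integral over the segment from `P` to `Q` that is seen on the line
`x (i + 1) = y`. -/
noncomputable def segmentTrace (i : Fin 2) (P Q : Plane) (h : ℝ → ℝ) (y : ℝ) : ℝ :=
  if Q (i + 1) - P (i + 1) = 0 then 0 else
    (Icc (0 : ℝ) 1).indicator h ((y - P (i + 1)) / (Q (i + 1) - P (i + 1)))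

theorem segmentTrace_nonneg (i : Fin 2) (P Q : Plane) {h : ℝ → ℝ} (hh : ∀ t, 0 ≤ h t) (y : ℝ) :
    0 ≤ segmentTrace i P Q h y := by
  rw [segmentTrace]
  split_ifs
  · exact le_rfl
  · exact indicator_nonneg (fun t _ => hh t) _

theorem integrable_segmentTrace (i : Fin 2) (P Q : Plane) {h : ℝ → ℝ} (hh : Continuous h) :
    Integrable (segmentTrace i P Q h) := by
  by_cases hd : Q (i + 1) - P (i + 1) = 0
  · have : segmentTrace i P Q h = fun _ => 0 := by funext y; simp [segmentTrace, hd]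
    rw [this]; exact integrable_zero _ _ _
  · have h1 : Integrable ((Icc (0 : ℝ) 1).indicator h) :=
      (integrable_indicator_iff measurableSet_Icc).2 hh.integrableOn_Icc
    have h2 := (h1.comp_div hd).comp_sub_right (P (i + 1))
    refine h2.congr (ae_of_all _ fun y => ?_)
    simp [segmentTrace, hd]

/-- The transverse coordinate `y` is replaced by the parameter `t` of the segment, which produces
the transverse length as Jacobian. A segment parallel to the direction `i` contributes nothing. -/
theorem integral_segmentTrace (i : Fin 2) (P Q : Plane) (h : ℝ → ℝ) :
    ∫ y, segmentTrace i P Q h y = |Q (i + 1) - P (i + 1)| * ∫ t in (0 : ℝ)..1, h t := by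
  by_cases hd : Q (i + 1) - P (i + 1) = 0
  · simp [segmentTrace, hd]
  · simp only [segmentTrace, hd, if_false]
    rw [integral_sub_right_eq_self
      (fun y => (Icc (0 : ℝ) 1).indicator h (y / (Q (i + 1) - P (i + 1)))) (P (i + 1)),
      Measure.integral_comp_div, integral_indicator measurableSet_Icc, integral_Icc_eq_integral_Ioc,
      intervalIntegral.integral_of_le zero_le_one, smul_eq_mul]

/-- The integral of a partial derivative over an open set whose boundary lies on finitely many
segments is controlled by the boundary values. -/
theorem abs_setIntegral_pderiv_le {ι : Type*} [Fintype ι] {K : Set Plane} (hK : IsOpen K)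
    (P Q : ι → Plane) (hfr : frontier K ⊆ ⋃ e, affineSegment ℝ (P e) (Q e)) (i : Fin 2) :
    ∃ C : ℝ, 0 ≤ C ∧ ∀ F : Plane → ℝ, ContDiff ℝ 1 F → HasCompactSupport F →
      |∫ x in K, pderiv i F x|
        ≤ C * ∑ e, ∫ t in (0 : ℝ)..1, |F (AffineMap.lineMap (P e) (Q e) t)| := by
  classical
  set N := Fintype.card ι
  -- `2 ^ N` and `2` come from the bound on a line with at most `N` crossings; the sum of the
  -- transverse lengths comes from integrating over the lines.
  refine ⟨2 ^ N * 2 * ∑ e, |Q e (i + 1) - P e (i + 1)|, by positivity, fun F hF hFc => ?_⟩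
  have hpc : Continuous (pderiv i F) := by
    have := hF.continuous_fderiv (by simp)
    exact this.clm_apply continuous_const
  have hpcs : HasCompactSupport (pderiv i F) :=
    hFc.fderiv_apply (𝕜 := ℝ) (EuclideanSpace.single i 1)
  have hpi : Integrable (K.indicator (pderiv i F)) :=
    (hpc.integrable_of_hasCompactSupport hpcs).indicator hK.measurableSet
  have hlc : ∀ e, Continuous fun t : ℝ => |F (AffineMap.lineMap (P e) (Q e) t)| := fun e =>
    (hF.continuous.comp AffineMap.lineMap_continuous).abs
  obtain ⟨R, hR⟩ := hFc.isCompact.isBounded.subset_ball (0 : Plane)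
  have hzero : ∀ s y, |s| ≥ R → Plane.mkCoord i s y ∉ tsupport F := by
    intro s y hs hmem
    have h1 := hR hmem
    rw [mem_ball_zero_iff] at h1
    have h2 := PiLp.norm_apply_le (Plane.mkCoord i s y) i
    rw [Plane.mkCoord_apply_self, Real.norm_eq_abs] at h2
    linarith
  have key : ∀ᵐ y : ℝ, ‖∫ s, K.indicator (pderiv i F) (Plane.mkCoord i s y)‖ ≤
      2 ^ N * (2 * ∑ e, segmentTrace i (P e) (Q e)
        (fun t => |F (AffineMap.lineMap (P e) (Q e) t)|) y) := by
    -- Discarding finitely many lines excludes those containing a segment parallel to them; any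
    -- other segment meets a line at most once.
    have hne : ∀ᵐ y : ℝ, ∀ e, y ≠ P e (i + 1) :=
      ae_all_iff.2 fun e => by simp [ae_iff]
    filter_upwards [hne] with y hy
    set f : ℝ → ℝ := fun s => F (Plane.mkCoord i s y) with hf
    have hmk : ContDiff ℝ 1 fun s => Plane.mkCoord i s y := by
      unfold Plane.mkCoord; fun_prop
    have hmkc : Continuous fun s => Plane.mkCoord i s y := hmk.continuous
    have hfd : deriv f = fun s => pderiv i F (Plane.mkCoord i s y) := funext fun s =>
      (Plane.hasDerivAt_mkCoord i (hF.differentiable (by simp)) s y).deriv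
    set O : Set ℝ := (fun s => Plane.mkCoord i s y) ⁻¹' K with hO
    have hOo : IsOpen O := hK.preimage hmkc
    -- `E` consists of the transverse segments met by the line at height `y`, and `σ e` is the
    -- coordinate of the crossing point along the line.
    set E : Finset ι := Finset.univ.filter fun e => Q e (i + 1) - P e (i + 1) ≠ 0 ∧
      (y - P e (i + 1)) / (Q e (i + 1) - P e (i + 1)) ∈ Icc (0 : ℝ) 1 with hE
    set σ : ι → ℝ := fun e =>
      (AffineMap.lineMap (P e) (Q e) ((y - P e (i + 1)) / (Q e (i + 1) - P e (i + 1))) : Plane) i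
      with hσ
    have hσ' : ∀ e ∈ E, Plane.mkCoord i (σ e) y =
        AffineMap.lineMap (P e) (Q e) ((y - P e (i + 1)) / (Q e (i + 1) - P e (i + 1))) := by
      intro e he
      have hd : Q e (i + 1) - P e (i + 1) ≠ 0 := (Finset.mem_filter.1 he).2.1
      rw [← Plane.mkCoord_coords i (AffineMap.lineMap (P e) (Q e) _ : Plane)]
      congr 1
      simp only [AffineMap.lineMap_apply, vsub_eq_sub, vadd_eq_add, PiLp.add_apply,
        PiLp.smul_apply, PiLp.sub_apply, smul_eq_mul]
      field_simp
      ring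
    have hfrO : ∀ s ∈ Ioo (-|R|) |R|, s ∈ frontier O → s ∈ E.image σ := by
      intro s _ hs
      have h1 : Plane.mkCoord i s y ∈ frontier K :=
        hmkc.frontier_preimage_subset K hs
      obtain ⟨e, t, ht, hte⟩ := mem_iUnion.1 (hfr h1)
      have h2 : P e (i + 1) + t * (Q e (i + 1) - P e (i + 1)) = y := by
        have := congrArg (fun x : Plane => x (i + 1)) hte
        simp only [Plane.mkCoord_apply_other] at this
        rw [← this]
        simp [AffineMap.lineMap_apply]; ring
      have hd : Q e (i + 1) - P e (i + 1) ≠ 0 := by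
        intro h0
        rw [h0] at h2
        exact hy e (by linarith)
      have ht' : (y - P e (i + 1)) / (Q e (i + 1) - P e (i + 1)) = t := by
        rw [← h2]; field_simp; ring
      refine Finset.mem_image.2 ⟨e, Finset.mem_filter.2 ⟨Finset.mem_univ _, hd, ?_⟩, ?_⟩
      · rw [ht']; exact ht
      · simp only [hσ]
        rw [ht', hte, Plane.mkCoord_apply_self]
    -- The interval reaches beyond the support of `F`, so its two end points contribute zero and
    -- only crossing values remain.
    have h1 := abs_setIntegral_deriv_le (hF.comp hmk) hOo (E.image σ) (-|R|) |R|
      (by linarith [abs_nonneg R]) hfrO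
    change |∫ x in O ∩ Ioo (-|R|) |R|, deriv f x| ≤ 2 ^ (E.image σ).card *
      (|f (-|R|)| + |f (|R|)| + 2 * ∑ s ∈ E.image σ, |f s|) at h1
    have h2 : ∫ s, K.indicator (pderiv i F) (Plane.mkCoord i s y)
        = ∫ x in O ∩ Ioo (-|R|) |R|, deriv f x := by
      rw [← integral_indicator (hOo.inter isOpen_Ioo).measurableSet]
      congr 1
      funext s
      have e1 : s ∈ O ↔ Plane.mkCoord i s y ∈ K := Iff.rfl
      by_cases hs : s ∈ Ioo (-|R|) |R|
      · simp only [indicator_apply, mem_inter_iff, e1, hfd, hs, and_true]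
      · have hs' : |s| ≥ R := by
          by_contra h
          push Not at h
          exact hs (abs_lt.1 (h.trans_le (le_abs_self R)))
        have h3 : pderiv i F (Plane.mkCoord i s y) = 0 :=
          image_eq_zero_of_notMem_tsupport fun h => hzero s y hs'
            (tsupport_fderiv_apply_subset ℝ (EuclideanSpace.single i (1 : ℝ)) h)
        simp only [indicator_apply, mem_inter_iff, hs, and_false, if_false, h3, ite_self]
    have h3 : f (-|R|) = 0 := image_eq_zero_of_notMem_tsupport (f := F)
      (hzero _ y (by rw [abs_neg, abs_abs]; exact le_abs_self R))
    have h4 : f (|R|) = 0 := image_eq_zero_of_notMem_tsupport (f := F)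
      (hzero _ y (by rw [abs_abs]; exact le_abs_self R))
    rw [h2, Real.norm_eq_abs]
    refine h1.trans ?_
    rw [h3, h4, abs_zero, add_zero, zero_add]
    have h5 : (E.image σ).card ≤ N := Finset.card_image_le.trans (Finset.card_le_univ _)
    have h6 : ∑ s ∈ E.image σ, |f s| ≤ ∑ e, segmentTrace i (P e) (Q e)
        (fun t => |F (AffineMap.lineMap (P e) (Q e) t)|) y := by
      refine (Finset.sum_image_le_of_nonneg (fun _ _ => abs_nonneg _)).trans ?_
      have h7 : ∀ e ∈ E, |f (σ e)| = segmentTrace i (P e) (Q e)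
          (fun t => |F (AffineMap.lineMap (P e) (Q e) t)|) y := by
        intro e he
        have h8 := (Finset.mem_filter.1 he).2
        simp only [segmentTrace, h8.1, if_false, indicator_of_mem h8.2, hf]
        rw [hσ' e he]
      rw [Finset.sum_congr rfl h7]
      exact Finset.sum_le_sum_of_subset_of_nonneg (Finset.subset_univ _)
        fun e _ _ => segmentTrace_nonneg i _ _ (fun _ => abs_nonneg _) y
    have h7 : (2 : ℝ) ^ (E.image σ).card ≤ 2 ^ N := pow_le_pow_right₀ (by norm_num) h5
    gcongr
  rw [← integral_indicator hK.measurableSet, Plane.integral_eq_integral_mkCoord i hpi,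
    ← Real.norm_eq_abs]
  have hgi : Integrable fun y => 2 ^ N * (2 * ∑ e, segmentTrace i (P e) (Q e)
        (fun t => |F (AffineMap.lineMap (P e) (Q e) t)|) y) :=
    ((integrable_finsetSum _ fun e _ => integrable_segmentTrace i (P e) (Q e) (hlc e)).const_mul
      2).const_mul _
  refine (norm_integral_le_of_norm_le hgi key).trans ?_
  rw [integral_const_mul, integral_const_mul,
    integral_finsetSum _ fun e _ => integrable_segmentTrace i (P e) (Q e) (hlc e)]
  simp only [integral_segmentTrace]
  rw [mul_assoc, mul_assoc]
  refine mul_le_mul_of_nonneg_left (mul_le_mul_of_nonneg_left ?_ (by norm_num)) (by positivity)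
  rw [Finset.sum_mul]
  refine Finset.sum_le_sum fun e _ => mul_le_mul_of_nonneg_left ?_ (abs_nonneg _)
  exact Finset.single_le_sum
    (f := fun e => ∫ t in (0 : ℝ)..1, |F (AffineMap.lineMap (P e) (Q e) t)|)
    (fun e _ => intervalIntegral.integral_nonneg zero_le_one fun _ _ => abs_nonneg _)
    (Finset.mem_univ e)

/-! ### Continuity of affine changes of variables in `L²` -/

theorem map_smul_add_volume {r : ℝ} (hr : r ≠ 0) (w : Plane) :
    Measure.map (fun x : Plane => r • x + w) volume
      = ENNReal.ofReal |(r ^ 2)⁻¹| • (volume : Measure Plane) := by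
  have h1 : (fun x : Plane => r • x + w) = (fun x => x + w) ∘ fun x => r • x := rfl
  have h2 := Measure.map_addHaar_smul (volume : Measure Plane) hr
  rw [finrank_euclideanSpace_fin] at h2
  rw [h1, ← Measure.map_map (measurable_add_const w) (measurable_const_smul r), h2,
    Measure.map_smul, (measurePreserving_add_right volume w).map_eq]

/-- The change of variables produces the factor `1 / r ≤ 2`. What matters is uniformity for `r` near
`1`, as required by the density argument. -/
theorem eLpNorm_comp_smul_add_le {f : Plane → ℝ} (hf : AEStronglyMeasurable f volume) {r : ℝ}
    (hr : 1 / 2 ≤ r) (w : Plane) :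
    eLpNorm (fun x => f (r • x + w)) 2 volume ≤ 2 * eLpNorm f 2 volume := by
  have hr0 : r ≠ 0 := by linarith
  have hmap := map_smul_add_volume hr0 w
  have hm : Measurable (fun x : Plane => r • x + w) := by fun_prop
  have h1 : eLpNorm (f ∘ fun x : Plane => r • x + w) 2 volume
      = eLpNorm f 2 (Measure.map (fun x : Plane => r • x + w) volume) := by
    refine (eLpNorm_map_measure ?_ hm.aemeasurable).symm
    rw [hmap]
    exact hf.smul_measure _
  change eLpNorm (f ∘ fun x : Plane => r • x + w) 2 volume ≤ _
  rw [h1, hmap]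
  have hc : ENNReal.ofReal |(r ^ 2)⁻¹| ≠ 0 := by
    rw [Ne, ENNReal.ofReal_eq_zero, not_le]
    positivity
  rw [eLpNorm_smul_measure_of_ne_zero hc, smul_eq_mul]
  gcongr
  have h4 : |(r ^ 2)⁻¹| ≤ 4 := by
    rw [abs_of_nonneg (by positivity), inv_le_comm₀ (by positivity) (by norm_num)]
    nlinarith
  calc ENNReal.ofReal |(r ^ 2)⁻¹| ^ (1 / (2 : ENNReal)).toReal
      ≤ ENNReal.ofReal 4 ^ (1 / (2 : ENNReal)).toReal := by gcongr
    _ = 2 := by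
      rw [ENNReal.ofReal_rpow_of_pos (by norm_num)]
      have : (4 : ℝ) ^ (1 / (2 : ENNReal)).toReal = 2 := by
        rw [show (4 : ℝ) = 2 ^ (2 : ℝ) by norm_num, ← Real.rpow_mul (by norm_num)]
        simp
      rw [this]; simp

/-- For `p` near `(1, 0)` the difference lives in one fixed ball, where uniform continuity makes it
uniformly small. -/
theorem tendsto_eLpNorm_comp_smul_add_of_continuous {g : Plane → ℝ} (hg : Continuous g)
    (hgc : HasCompactSupport g) :
    Tendsto (fun p : ℝ × Plane => eLpNorm (fun x => g (p.1 • x + p.2) - g x) 2 volume)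
      (𝓝 (1, 0)) (𝓝 0) := by
  obtain ⟨R, hR0, hR⟩ := hgc.isCompact.isBounded.subset_ball_lt 0 (0 : Plane)
  -- Outside `B`, for `p.1 > 1/2` and `‖p.2‖ < 1/2`, the norm of `p.1 • x + p.2` still exceeds `R`.
  set B : Set Plane := Metric.closedBall 0 (2 * R + 2) with hB
  have hBfin : volume B ^ (1 / (2 : ENNReal).toReal) ≠ ⊤ :=
    ENNReal.rpow_ne_top_of_nonneg (by positivity) measure_closedBall_lt_top.ne
  have hg0 : ∀ x : Plane, R ≤ ‖x‖ → g x = 0 := fun x hx =>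
    image_eq_zero_of_notMem_tsupport fun h => by
      have := hR h
      rw [mem_ball_zero_iff] at this
      linarith
  rw [ENNReal.tendsto_nhds_zero]
  intro ε hε
  obtain ⟨δ, hδ0, hδ⟩ : ∃ δ : ℝ, 0 < δ ∧
      ‖δ‖ₑ * volume B ^ (1 / (2 : ENNReal).toReal) ≤ ε := by
    have hlim : Tendsto (fun δ : ℝ => ‖δ‖ₑ * volume B ^ (1 / (2 : ENNReal).toReal))
        (𝓝[>] 0) (𝓝 0) := by
      have h1 : Tendsto (fun δ : ℝ => ‖δ‖ₑ) (𝓝[>] 0) (𝓝 0) := by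
        have : Tendsto (fun δ : ℝ => ‖δ‖ₑ) (𝓝 0) (𝓝 ‖(0 : ℝ)‖ₑ) := continuous_enorm.tendsto 0
        rw [enorm_zero] at this
        exact this.mono_left nhdsWithin_le_nhds
      simpa using ENNReal.Tendsto.mul_const h1 (Or.inr hBfin)
    obtain ⟨δ, h1, h2⟩ := ((ENNReal.tendsto_nhds_zero.1 hlim ε hε).and
      self_mem_nhdsWithin).exists
    exact ⟨δ, h2, h1⟩
  have huc := hgc.uniformContinuous_of_continuous hg
  obtain ⟨η, hη0, hη⟩ := Metric.uniformContinuous_iff.1 huc δ hδ0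
  -- On `B` the point moves by at most `|p.1 - 1| ‖x‖ + ‖p.2‖ < κ (2R + 3) < η`.
  set κ : ℝ := min (1 / 2) (η / (2 * R + 4)) with hκ
  have hκ0 : 0 < κ := by positivity
  have hev : ∀ᶠ p : ℝ × Plane in 𝓝 (1, 0), dist p (1, 0) < κ := Metric.ball_mem_nhds _ hκ0
  filter_upwards [hev] with p hp
  rw [Prod.dist_eq, max_lt_iff, dist_zero_right, Real.dist_eq] at hp
  obtain ⟨hp1, hp2⟩ := hp
  have hκ1 : κ ≤ 1 / 2 := min_le_left _ _
  have hκ2 : κ * (2 * R + 4) ≤ η := by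
    rw [← le_div_iff₀ (by positivity)]; exact min_le_right _ _
  have hp1' := abs_lt.1 hp1
  have hbd : ∀ x, ‖g (p.1 • x + p.2) - g x‖ ≤ B.indicator (fun _ => δ) x := by
    intro x
    by_cases hx : x ∈ B
    · rw [indicator_of_mem hx, ← dist_eq_norm]
      refine (hη ?_).le
      rw [hB, mem_closedBall_zero_iff] at hx
      have h1 : p.1 • x + p.2 - x = (p.1 - 1) • x + p.2 := by module
      rw [dist_eq_norm, h1]
      refine (norm_add_le _ _).trans_lt ?_
      rw [norm_smul, Real.norm_eq_abs]
      have : |p.1 - 1| * ‖x‖ ≤ κ * (2 * R + 2) :=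
        mul_le_mul hp1.le hx (norm_nonneg _) hκ0.le
      nlinarith
    · rw [indicator_of_notMem hx]
      rw [hB, mem_closedBall_zero_iff, not_le] at hx
      have h1 : g x = 0 := hg0 x (by linarith)
      have h2 : g (p.1 • x + p.2) = 0 := by
        refine hg0 _ ?_
        have h3 := norm_sub_le_norm_add (p.1 • x) p.2
        rw [norm_smul, Real.norm_eq_abs, abs_of_pos (by linarith)] at h3
        nlinarith
      rw [h1, h2]; simp
  refine (eLpNorm_mono_real hbd).trans ?_
  rwa [eLpNorm_indicator_const measurableSet_closedBall (by norm_num) (by norm_num)]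

theorem tendsto_eLpNorm_comp_smul_add {f : Plane → ℝ} (hf : MemLp f 2 volume) :
    Tendsto (fun p : ℝ × Plane => eLpNorm (fun x => f (p.1 • x + p.2) - f x) 2 volume)
      (𝓝 (1, 0)) (𝓝 0) := by
  rw [ENNReal.tendsto_nhds_zero]
  intro ε hε
  have hε4 : ε / 4 ≠ 0 := (ENNReal.div_pos hε.ne' (by norm_num)).ne'
  -- The error splits into the transformed `f - g`, whose norm at most doubles, the displacement of
  -- `g`, and `f - g`: in all `2 + 1 + 1` quarters of `ε`.
  obtain ⟨g, hgc, hfg, hg, hgL⟩ := hf.exists_hasCompactSupport_eLpNorm_sub_le (by norm_num) hε4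
  have h1 := ENNReal.tendsto_nhds_zero.1 (tendsto_eLpNorm_comp_smul_add_of_continuous hg hgc)
    (ε / 4) (pos_iff_ne_zero.2 hε4)
  have h2 : ∀ᶠ p : ℝ × Plane in 𝓝 (1, 0), 1 / 2 < p.1 :=
    (continuous_fst.tendsto _).eventually (lt_mem_nhds (by norm_num))
  filter_upwards [h1, h2] with p hp hp2
  have hp0 : p.1 ≠ 0 := by linarith
  have hqm : Measure.QuasiMeasurePreserving (fun x : Plane => p.1 • x + p.2) volume volume :=
    ⟨by fun_prop, by rw [map_smul_add_volume hp0]; exact Measure.smul_absolutelyContinuous⟩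
  have hfgm : AEStronglyMeasurable (f - g) volume := hf.1.sub hgL.1
  have e1 : (fun x => f (p.1 • x + p.2) - f x) = ((fun x => (f - g) (p.1 • x + p.2)) +
      (fun x => g (p.1 • x + p.2) - g x)) - (f - g) := by
    funext x
    simp only [Pi.add_apply, Pi.sub_apply]
    ring
  have m1 : AEStronglyMeasurable (fun x => (f - g) (p.1 • x + p.2)) volume :=
    hfgm.comp_quasiMeasurePreserving hqm
  have m2 : AEStronglyMeasurable (fun x => g (p.1 • x + p.2) - g x) volume :=
    (by fun_prop : Continuous fun x => g (p.1 • x + p.2) - g x).aestronglyMeasurable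
  rw [e1]
  have t1 := eLpNorm_sub_le (p := 2) (m1.add m2) hfgm (by norm_num)
  have t2 := eLpNorm_add_le (p := 2) m1 m2 (by norm_num)
  have t3 := eLpNorm_comp_smul_add_le hfgm hp2.le p.2
  calc _ ≤ _ := t1
    _ ≤ (2 * (ε / 4) + ε / 4) + ε / 4 := by
      refine add_le_add (t2.trans (add_le_add (t3.trans ?_) hp)) hfg
      gcongr
    _ = 4 * (ε / 4) := by ring
    _ = ε := ENNReal.mul_div_cancel (by norm_num) (by norm_num)

theorem enorm_integral_mul_le {α : Type*} [MeasurableSpace α] {μ : Measure α} {u f : α → ℝ}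
    (hu : AEStronglyMeasurable u μ) (hf : AEStronglyMeasurable f μ) :
    ‖∫ x, u x * f x ∂μ‖ₑ ≤ eLpNorm u 2 μ * eLpNorm f 2 μ := by
  refine (enorm_integral_le_lintegral_enorm _).trans ?_
  rw [← eLpNorm_one_eq_lintegral_enorm]
  have h : eLpNorm (u • f) 1 μ ≤ eLpNorm u 2 μ * eLpNorm f 2 μ :=
    eLpNorm_smul_le_mul_eLpNorm hf hu
  have e : (fun x => u x * f x) = u • f := rfl
  rw [e]
  exact h

/-- By Cauchy–Schwarz this reduces to continuity of affine changes of variables in `L²`. Applied to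
the Hessian, it says that the energy is nearly unchanged when one factor is slightly dilated and
shifted. -/
theorem tendsto_integral_comp_smul_add_mul {f : Plane → ℝ} (hf : MemLp f 2 volume) :
    Tendsto (fun p : ℝ × Plane => ∫ x, f (p.1 • x + p.2) * f x) (𝓝 (1, 0))
      (𝓝 (∫ x, f x ^ 2)) := by
  have hlim : Tendsto (fun p : ℝ × Plane =>
      eLpNorm (fun x => f (p.1 • x + p.2) - f x) 2 volume * eLpNorm f 2 volume)
      (𝓝 (1, 0)) (𝓝 0) := by
    simpa using ENNReal.Tendsto.mul_const (tendsto_eLpNorm_comp_smul_add hf) (Or.inr hf.2.ne)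
  have h2 : ∀ᶠ p : ℝ × Plane in 𝓝 (1, 0), 1 / 2 < p.1 :=
    (continuous_fst.tendsto _).eventually (lt_mem_nhds (by norm_num))
  have hle : ∀ᶠ p : ℝ × Plane in 𝓝 (1, 0),
      edist (∫ x, f (p.1 • x + p.2) * f x) (∫ x, f x ^ 2) ≤
        eLpNorm (fun x => f (p.1 • x + p.2) - f x) 2 volume * eLpNorm f 2 volume := by
    filter_upwards [h2] with p hp
    have hp0 : p.1 ≠ 0 := by linarith
    have hqm : Measure.QuasiMeasurePreserving (fun x : Plane => p.1 • x + p.2) volume volume :=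
      ⟨by fun_prop, by rw [map_smul_add_volume hp0]; exact Measure.smul_absolutelyContinuous⟩
    have m1 : MemLp (fun x => f (p.1 • x + p.2)) 2 volume :=
      ⟨hf.1.comp_quasiMeasurePreserving hqm,
        (eLpNorm_comp_smul_add_le hf.1 hp.le p.2).trans_lt
          (ENNReal.mul_lt_top (by norm_num) hf.2)⟩
    have e1 : (∫ x, f (p.1 • x + p.2) * f x) - ∫ x, f x ^ 2
        = ∫ x, (f (p.1 • x + p.2) - f x) * f x := by
      have i1 : Integrable (fun x => f (p.1 • x + p.2) * f x) := m1.integrable_mul hf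
      rw [← integral_sub i1 hf.integrable_sq]
      refine integral_congr_ae (ae_of_all _ fun x => ?_)
      dsimp only
      ring
    rw [edist_eq_enorm_sub, e1]
    exact enorm_integral_mul_le (m1.1.sub hf.1) hf.1
  rw [tendsto_iff_edist_tendsto_0]
  exact tendsto_of_tendsto_of_tendsto_of_le_of_le' tendsto_const_nhds hlim
    (Eventually.of_forall fun _ => zero_le) hle

/-! ### Weak derivatives on the plane and mollification -/

/-- `g` is the weak partial derivative `∂ᵢ f` on the whole plane. -/
def IsPlaneWeakPartial (i : Fin 2) (f g : Plane → ℝ) : Prop :=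
  ∀ ψ : Plane → ℝ, IsTestFunction univ ψ → ∫ x, f x * pderiv i ψ x = - ∫ x, g x * ψ x

/-- The convolution `ρ ⋆ f`. -/
noncomputable def mollify (ρ f : Plane → ℝ) : Plane → ℝ :=
  convolution ρ f (ContinuousLinearMap.lsmul ℝ ℝ) volume

theorem pderiv_comp_affine {ψ : Plane → ℝ} (hψ : Differentiable ℝ ψ) (i : Fin 2) (r : ℝ)
    (w x : Plane) : pderiv i (fun x => ψ (r • x + w)) x = r * pderiv i ψ (r • x + w) := by
  have h1 : HasFDerivAt (fun x : Plane => r • x + w) (r • ContinuousLinearMap.id ℝ Plane) x :=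
    ((hasFDerivAt_id x).const_smul r).add_const w
  have h2 := ((hψ (r • x + w)).hasFDerivAt.comp x h1).fderiv
  change fderiv ℝ (ψ ∘ fun x => r • x + w) x _ = _
  rw [h2]
  simp [pderiv]

theorem IsTestFunction.comp_affine {ψ : Plane → ℝ} (hψ : IsTestFunction univ ψ) {r : ℝ}
    (hr : r ≠ 0) (w : Plane) : IsTestFunction univ fun x => ψ (r • x + w) where
  smooth := hψ.smooth.comp (by fun_prop)
  compact := hψ.compact.comp_homeomorph
    ((Homeomorph.smulOfNeZero r hr).trans (Homeomorph.addRight w))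
  support_subset := subset_univ _

theorem integral_comp_smul_add (h : Plane → ℝ) (r : ℝ) (w : Plane) :
    ∫ x, h (r • x + w) = |(r ^ 2)⁻¹| * ∫ x, h x := by
  have := Measure.integral_comp_smul (volume : Measure Plane) (fun x => h (x + w)) r
  rw [this, integral_add_right_eq_self, finrank_euclideanSpace_fin, smul_eq_mul]

theorem IsPlaneWeakPartial.comp_affine {i : Fin 2} {f g : Plane → ℝ}
    (h : IsPlaneWeakPartial i f g) {r : ℝ} (hr : r ≠ 0) (w : Plane) :
    IsPlaneWeakPartial i (fun x => f (r • x + w)) (fun x => r * g (r • x + w)) := by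
  intro ψ hψ
  have hinv : ∀ x : Plane, r⁻¹ • (r • x + w) + -(r⁻¹ • w) = x := by
    intro x
    rw [smul_add, smul_smul, inv_mul_cancel₀ hr, one_smul]
    abel
  have h1 := integral_comp_smul_add
    (fun y => f y * pderiv i ψ (r⁻¹ • y + -(r⁻¹ • w))) r w
  have h2 := integral_comp_smul_add
    (fun y => r * g y * ψ (r⁻¹ • y + -(r⁻¹ • w))) r w
  simp only [hinv] at h1 h2
  rw [h1, h2, ← mul_neg]
  congr 1
  have h3 := h _ (hψ.comp_affine (inv_ne_zero hr) (-(r⁻¹ • w)))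
  simp only [pderiv_comp_affine (hψ.smooth.differentiable (by simp))] at h3
  have h4 : ∫ y, f y * pderiv i ψ (r⁻¹ • y + -(r⁻¹ • w)) =
      r * ∫ y, f y * (r⁻¹ * pderiv i ψ (r⁻¹ • y + -(r⁻¹ • w))) := by
    rw [← integral_const_mul]
    refine integral_congr_ae (ae_of_all _ fun y => ?_)
    dsimp only
    field_simp
  rw [h4, h3, mul_neg, ← integral_const_mul]
  simp only [mul_assoc]

section Mollify

variable {ρ f g : Plane → ℝ}

theorem mollify_apply (ρ f : Plane → ℝ) (x : Plane) : mollify ρ f x = ∫ t, ρ (x - t) * f t :=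
  convolution_lsmul_swap

theorem contDiff_mollify (hρ : IsTestFunction univ ρ) (hf : LocallyIntegrable f volume) :
    ContDiff ℝ ∞ (mollify ρ f) :=
  HasCompactSupport.contDiff_convolution_left _ hρ.compact hρ.smooth hf

theorem pderiv_mollify (hρ : IsTestFunction univ ρ) (hf : LocallyIntegrable f volume) (i : Fin 2) :
    pderiv i (mollify ρ f) = mollify (pderiv i ρ) f := by
  funext x
  have hρ1 : ContDiff ℝ 1 ρ := hρ.smooth.of_le (by simp)
  have h1 := (HasCompactSupport.hasFDerivAt_convolution_left (μ := volume)
    (ContinuousLinearMap.lsmul ℝ ℝ) hρ.compact hρ1 hf x).fderiv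
  have h2 := (hρ.compact.fderiv (𝕜 := ℝ)).convolutionExists_left (μ := volume)
    ((ContinuousLinearMap.lsmul ℝ ℝ : ℝ →L[ℝ] ℝ →L[ℝ] ℝ).precompL Plane)
    (hρ1.continuous_fderiv (by simp)) hf x
  change fderiv ℝ (mollify ρ f) x _ = _
  rw [mollify, h1, convolution_def, ContinuousLinearMap.integral_apply h2]
  rfl

theorem IsPlaneWeakPartial.pderiv_mollify {i : Fin 2} (h : IsPlaneWeakPartial i f g)
    (hρ : IsTestFunction univ ρ) (hf : LocallyIntegrable f volume) :
    pderiv i (mollify ρ f) = mollify ρ g := by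
  rw [_root_.pderiv_mollify hρ hf]
  funext x
  rw [mollify_apply, mollify_apply]
  -- The weak derivative is tested with `t ↦ ρ (x - t)`; the sign from the reflection cancels the
  -- one in the definition.
  have h1 := h _ (hρ.comp_affine (r := -1) (by norm_num) x)
  simp only [pderiv_comp_affine (hρ.smooth.differentiable (by simp))] at h1
  have e : ∀ t : Plane, (-1 : ℝ) • t + x = x - t := fun t => by
    rw [neg_one_smul]; abel
  simp only [e] at h1
  have h2 : ∫ t, f t * (-1 * pderiv i ρ (x - t)) = - ∫ t, pderiv i ρ (x - t) * f t := by
    rw [← integral_neg]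
    refine integral_congr_ae (ae_of_all _ fun t => ?_)
    dsimp only
    ring
  rw [h2, neg_inj] at h1
  rw [h1]
  simp only [mul_comm]

open scoped Pointwise in
theorem tsupport_mollify_subset {B K : Set Plane} (hρ : tsupport ρ ⊆ B) (hB : IsCompact B)
    (hf : Function.support f ⊆ K) (hK : IsCompact K) : tsupport (mollify ρ f) ⊆ B + K :=
  closure_minimal ((support_convolution_subset _).trans
    (add_subset_add ((subset_tsupport ρ).trans hρ) hf)) (hB.add hK).isClosed

end Mollify

/-- A sequence of mollifiers. -/
noncomputable def bumpSeq (n : ℕ) : ContDiffBump (0 : Plane) where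
  rIn := 1 / (n + 1 : ℝ)
  rOut := 2 * (1 / (n + 1 : ℝ))
  rIn_pos := by positivity
  rIn_lt_rOut := by
    have : (0 : ℝ) < 1 / (n + 1 : ℝ) := by positivity
    linarith

theorem tendsto_bumpSeq_rOut : Tendsto (fun n => (bumpSeq n).rOut) atTop (𝓝 0) := by
  simpa [bumpSeq] using (tendsto_one_div_add_atTop_nhds_zero_nat (𝕜 := ℝ)).const_mul 2

theorem isTestFunction_normed (φ : ContDiffBump (0 : Plane)) :
    IsTestFunction univ (φ.normed volume) where
  smooth := φ.contDiff_normed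
  compact := φ.hasCompactSupport_normed
  support_subset := subset_univ _

/-- A compactly supported function with vanishing weak gradient vanishes. -/
theorem ae_eq_zero_of_isPlaneWeakPartial_zero {f : Plane → ℝ} (hf : LocallyIntegrable f volume)
    (hfc : HasCompactSupport f) (h : ∀ i, IsPlaneWeakPartial i f 0) : f =ᵐ[volume] 0 := by
  -- A mollification is smooth with zero gradient, hence constant, and it vanishes outside a compact
  -- set.
  have h0 : ∀ n, mollify ((bumpSeq n).normed volume) f = 0 := by
    intro n
    have hρ := isTestFunction_normed (bumpSeq n)
    have hs := contDiff_mollify hρ hf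
    have hd : ∀ x, fderiv ℝ (mollify ((bumpSeq n).normed volume) f) x = 0 := by
      intro x
      refine ContinuousLinearMap.coe_injective
        ((EuclideanSpace.basisFun (Fin 2) ℝ).toBasis.ext fun i => ?_)
      have := congrFun ((h i).pderiv_mollify hρ hf) x
      rw [mollify_apply ((bumpSeq n).normed volume) 0] at this
      simpa [pderiv] using this
    have hcs : HasCompactSupport (mollify ((bumpSeq n).normed volume) f) :=
      HasCompactSupport.convolution _ hρ.compact hfc
    obtain ⟨y, hy⟩ : ∃ y, y ∉ tsupport (mollify ((bumpSeq n).normed volume) f) := by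
      by_contra hcon
      push Not at hcon
      have := hcs.isCompact
      rw [eq_univ_of_forall hcon] at this
      exact noncompact_univ Plane this
    funext x
    rw [is_const_of_fderiv_eq_zero (hs.differentiable (by simp)) hd x y]
    exact image_eq_zero_of_notMem_tsupport hy
  -- `K = 2` is the ratio of outer to inner radius in `bumpSeq`.
  have hae := ContDiffBump.ae_convolution_tendsto_right_of_locallyIntegrable (φ := bumpSeq)
    (l := atTop) (K := 2) tendsto_bumpSeq_rOut (Eventually.of_forall fun n => le_rfl) hf
  filter_upwards [hae] with x hx
  have h1 : ∀ n, convolution ((bumpSeq n).normed volume) f (ContinuousLinearMap.lsmul ℝ ℝ)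
      volume x = 0 := fun n => congrFun (h0 n) x
  simp only [h1] at hx
  exact (tendsto_nhds_unique hx tendsto_const_nhds)

/-! ### Bilaplacians, and pairings with mollifications -/

theorem pderiv_comm {φ : Plane → ℝ} (hφ : ContDiff ℝ ∞ φ) (i j : Fin 2) :
    pderiv i (pderiv j φ) = pderiv j (pderiv i φ) := by
  have key : ∀ i j x, pderiv i (pderiv j φ) x = fderiv ℝ (fderiv ℝ φ) x
      (EuclideanSpace.single i 1) (EuclideanSpace.single j 1) := by
    intro i j x
    have h1 : DifferentiableAt ℝ (fderiv ℝ φ) x :=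
      (hφ.fderiv_right (m := ∞) (by simp)).differentiable (by simp) x
    change fderiv ℝ (fun y => fderiv ℝ φ y (EuclideanSpace.single j 1)) x _ = _
    rw [fderiv_clm_apply h1 (differentiableAt_const _)]
    simp
  funext x
  rw [key, key]
  exact (hφ.contDiffAt.isSymmSndFDerivAt
    (by rw [minSmoothness_of_isRCLikeNormedField]; exact WithTop.coe_le_coe.2 (le_top : (2 : ℕ∞) ≤ ⊤))).eq _ _

/-- The derivatives are ordered so that integrating the outer two by parts against `v` produces
exactly `v.hess i j`, paired with the inner two on `φ`. -/
theorem laplacian_laplacian_eq {φ : Plane → ℝ} (hφ : ContDiff ℝ ∞ φ) :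
    Laplacian.laplacian (Laplacian.laplacian φ) =
      ∑ i, ∑ j, pderiv i (pderiv j (pderiv j (pderiv i φ))) := by
  have h2 : ∀ j, ContDiff ℝ ∞ (pderiv j (pderiv j φ)) := fun j =>
    contDiff_pderiv (contDiff_pderiv hφ j) j
  have hs : ContDiff ℝ ∞ (∑ j, pderiv j (pderiv j φ)) := by
    rw [Fin.sum_univ_two]; exact (h2 0).add (h2 1)
  rw [laplacian_eq_pderiv hφ, laplacian_eq_pderiv hs]
  refine Finset.sum_congr rfl fun i _ => ?_
  rw [Fin.sum_univ_two, pderiv_add (h2 0) (h2 1),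
    pderiv_add (contDiff_pderiv (h2 0) i) (contDiff_pderiv (h2 1) i), Fin.sum_univ_two]
  have key : ∀ j, pderiv i (pderiv i (pderiv j (pderiv j φ)))
      = pderiv i (pderiv j (pderiv j (pderiv i φ))) := fun j => by
    rw [pderiv_comm (contDiff_pderiv hφ j) i j, pderiv_comm hφ i j]
  rw [key, key]

/-- The pairing of a function with a mollification, as an average of shifted pairings. -/
theorem integral_mul_mollify {ρ f g : Plane → ℝ} (hρ : IsTestFunction univ ρ)
    (hf : MemLp f 2 volume) (hg : MemLp g 2 volume) :
    Integrable (fun z => ρ z * ∫ x, g (x - z) * f x) ∧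
      ∫ x, f x * mollify ρ g x = ∫ z, ρ z * ∫ x, g (x - z) * f x := by
  have hρi : Integrable ρ := hρ.smooth.continuous.integrable_of_hasCompactSupport hρ.compact
  -- Fubini needs a majorant of `f(x) ρ(z) g(x - z)`: by `|a b| ≤ a² + b²`, the absolute values of
  -- this product and of the next one suffice.
  have i1 : Integrable (fun p : Plane × Plane => f p.1 ^ 2 * ρ p.2) (volume.prod volume) :=
    hf.integrable_sq.mul_prod hρi
  have i2 : Integrable (fun p : Plane × Plane => ρ p.2 * g (p.1 - p.2) ^ 2)
      (volume.prod volume) :=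
    hρi.convolution_integrand (ContinuousLinearMap.lsmul ℝ ℝ) hg.integrable_sq
  have hm : AEStronglyMeasurable (fun p : Plane × Plane => f p.1 * (ρ p.2 * g (p.1 - p.2)))
      (volume.prod volume) := by
    refine (hf.1.comp_fst).mul ((hρ.smooth.continuous.comp continuous_snd).aestronglyMeasurable.mul
      (hg.1.comp_quasiMeasurePreserving ?_))
    exact quasiMeasurePreserving_sub _ _
  have hi : Integrable (fun p : Plane × Plane => f p.1 * (ρ p.2 * g (p.1 - p.2)))
      (volume.prod volume) := by
    refine (i1.norm.add i2.norm).mono' hm (ae_of_all _ fun p => ?_)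
    simp only [Pi.add_apply, norm_mul, Real.norm_eq_abs, abs_pow, sq_abs]
    have h1 := abs_nonneg (ρ p.2)
    have h2 : |f p.1| * |g (p.1 - p.2)| ≤ f p.1 ^ 2 + g (p.1 - p.2) ^ 2 := by
      rw [← sq_abs (f p.1), ← sq_abs (g (p.1 - p.2))]
      nlinarith [sq_nonneg (|f p.1| - |g (p.1 - p.2)|), sq_nonneg (|f p.1|),
        sq_nonneg (|g (p.1 - p.2)|)]
    nlinarith [mul_le_mul_of_nonneg_left h2 h1]
  have e1 : ∫ x, f x * mollify ρ g x = ∫ x, ∫ z, f x * (ρ z * g (x - z)) := by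
    refine integral_congr_ae (ae_of_all _ fun x => ?_)
    dsimp only
    rw [integral_const_mul]
    rfl
  have e2 : ∀ z, ∫ x, f x * (ρ z * g (x - z)) = ρ z * ∫ x, g (x - z) * f x := by
    intro z
    rw [← integral_const_mul]
    refine integral_congr_ae (ae_of_all _ fun x => ?_)
    dsimp only
    ring
  have i3 := hi.integral_prod_right
  simp only [e2] at i3
  refine ⟨i3, ?_⟩
  rw [e1, integral_integral_swap hi]
  simp only [e2]

/-! ### Extension by zero -/

section ZeroExt

variable {U : Set Plane}

/-- The extension by zero of a function on `U`. -/
noncomputable def zeroExt (u : L2 U) : Plane → ℝ := U.indicator u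

theorem memLp_zeroExt (hU : MeasurableSet U) (u : L2 U) : MemLp (zeroExt u) 2 volume :=
  (memLp_indicator_iff_restrict hU).2 (Lp.memLp u)

theorem integral_zeroExt_mul (hU : MeasurableSet U) (u : L2 U) (h : Plane → ℝ) :
    ∫ x, zeroExt u x * h x = ∫ x in U, u x * h x := by
  rw [← integral_indicator hU]
  refine integral_congr_ae (ae_of_all _ fun x => ?_)
  exact (indicator_mul_left U (fun x => u x) h).symm

theorem support_zeroExt_subset (u : L2 U) : Function.support (zeroExt u) ⊆ U :=
  support_indicator_subset

theorem hasCompactSupport_zeroExt (hU : Bornology.IsBounded U) (u : L2 U) :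
    HasCompactSupport (zeroExt u) :=
  HasCompactSupport.of_support_subset_isCompact hU.isCompact_closure
    ((support_zeroExt_subset u).trans subset_closure)

theorem eq_zero_of_zeroExt (hU : MeasurableSet U) {u : L2 U} (h : zeroExt u =ᵐ[volume] 0) :
    u = 0 := by
  rw [Lp.eq_zero_iff_ae_eq_zero]
  filter_upwards [ae_restrict_of_ae h, ae_restrict_mem hU] with x hx hxU
  rwa [zeroExt, indicator_of_mem hxU] at hx

theorem zeroExt_zero (hU : MeasurableSet U) : zeroExt (0 : L2 U) =ᵐ[volume] 0 := by
  have h := (ae_restrict_iff' hU).1 (Lp.coeFn_zero ℝ 2 ((volume : Measure Plane).restrict U))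
  filter_upwards [h] with x hx
  by_cases hxU : x ∈ U
  · rw [zeroExt, indicator_of_mem hxU]
    exact hx hxU
  · simp [zeroExt, indicator_of_notMem hxU]

/-- The functional `u ↦ ∫_U u w`. -/
noncomputable def pairing {w : Plane → ℝ} (hw : MemLp w 2 (volume.restrict U)) : L2 U →L[ℝ] ℝ :=
  innerSL ℝ (hw.toLp w)

theorem pairing_apply {w : Plane → ℝ} (hw : MemLp w 2 (volume.restrict U)) (u : L2 U) :
    pairing hw u = ∫ x in U, u x * w x := by
  rw [pairing, innerSL_apply_apply, L2.inner_def]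
  refine integral_congr_ae ?_
  filter_upwards [hw.coeFn_toLp] with x hx
  rw [hx]
  simp

theorem IsTestFunction.memLp {V : Set Plane} {φ : Plane → ℝ} (h : IsTestFunction V φ) :
    MemLp φ 2 ((volume : Measure Plane).restrict U) :=
  (h.smooth.continuous.memLp_of_hasCompactSupport h.compact).restrict U

/-- The extension by zero of `v` has the extensions by zero of the derivatives of `v` as weak
derivatives on the whole plane. -/
def Jet.ZeroExtendable (v : Jet U) : Prop :=
  (∀ i, IsPlaneWeakPartial i (zeroExt v.fn) (zeroExt (v.grad i))) ∧
    ∀ i j, IsPlaneWeakPartial j (zeroExt (v.grad i)) (zeroExt (v.hess i j))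

/-- For fixed `ψ` each identity says that a continuous linear functional of the jet vanishes. It
does so on test functions, by integration by parts on the plane, hence on the closure of their span.
-/
theorem zeroExtendable_of_mem_H20 (hU : IsOpen U) {v : Jet U} (hv : v ∈ H20 U) :
    v.ZeroExtendable := by
  -- The kernel of `ℓ` is closed, so it contains the closure as soon as it contains the jets of test
  -- functions.
  have key : ∀ ℓ : Jet U →L[ℝ] ℝ, (∀ φ J, IsTestFunction U φ → IsJetOf U φ J → ℓ J = 0) →
      ℓ v = 0 := by
    intro ℓ hℓ
    have h1 : H20 U ≤ LinearMap.ker (ℓ : Jet U →ₗ[ℝ] ℝ) := by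
      refine Submodule.topologicalClosure_minimal _ (Submodule.span_le.2 ?_)
        (isClosed_singleton.preimage ℓ.continuous)
      rintro J ⟨φ, hφ, hJ⟩
      exact hℓ φ J hφ hJ
    exact h1 hv
  have base : ∀ (i : Fin 2) (φ ψ : Plane → ℝ) (u w : L2 U), IsTestFunction U φ →
      IsTestFunction univ ψ → u =ᵐ[volume.restrict U] φ → w =ᵐ[volume.restrict U] pderiv i φ →
      (∫ x in U, u x * pderiv i ψ x) + ∫ x in U, w x * ψ x = 0 := by
    intro i φ ψ u w hφ hψ hu hw
    have e1 : ∫ x in U, u x * pderiv i ψ x = ∫ x, pderiv i ψ x * φ x := by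
      rw [← hφ.setIntegral]
      refine integral_congr_ae ?_
      filter_upwards [hu] with x hx
      rw [hx, mul_comm]
    have e2 : ∫ x in U, w x * ψ x = ∫ x, ψ x * pderiv i φ x := by
      rw [← (hφ.pderiv i).setIntegral]
      refine integral_congr_ae ?_
      filter_upwards [hw] with x hx
      rw [hx, mul_comm]
    rw [e1, e2, hφ.integral_by_parts hψ.smooth]
    ring
  let gradL : Fin 2 → Jet U →L[ℝ] L2 U := fun i =>
    (ContinuousLinearMap.proj (R := ℝ) (φ := fun _ : Fin 2 => L2 U) i).comp
      ((ContinuousLinearMap.fst ℝ _ _).comp (ContinuousLinearMap.snd ℝ (L2 U) _))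
  let hessL : Fin 2 → Fin 2 → Jet U →L[ℝ] L2 U := fun i j =>
    (ContinuousLinearMap.proj (R := ℝ) (φ := fun _ : Fin 2 => L2 U) j).comp
      ((ContinuousLinearMap.proj (R := ℝ) (φ := fun _ : Fin 2 => Fin 2 → L2 U) i).comp
        ((ContinuousLinearMap.snd ℝ _ _).comp (ContinuousLinearMap.snd ℝ (L2 U) _)))
  constructor
  · intro i ψ hψ
    rw [integral_zeroExt_mul hU.measurableSet, integral_zeroExt_mul hU.measurableSet,
      eq_neg_iff_add_eq_zero, ← pairing_apply (hψ.pderiv i).memLp, ← pairing_apply hψ.memLp]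
    refine key ((pairing (hψ.pderiv i).memLp).comp (ContinuousLinearMap.fst ℝ _ _) +
      (pairing hψ.memLp).comp (gradL i)) fun φ J hφ hJ => ?_
    change pairing _ J.fn + pairing _ (J.grad i) = 0
    rw [pairing_apply, pairing_apply]
    exact base i φ ψ _ _ hφ hψ hJ.1 (hJ.2.1 i)
  · intro i j ψ hψ
    rw [integral_zeroExt_mul hU.measurableSet, integral_zeroExt_mul hU.measurableSet,
      eq_neg_iff_add_eq_zero, ← pairing_apply (hψ.pderiv j).memLp, ← pairing_apply hψ.memLp]
    refine key ((pairing (hψ.pderiv j).memLp).comp (gradL i) +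
      (pairing hψ.memLp).comp (hessL i j)) fun φ J hφ hJ => ?_
    change pairing _ (J.grad i) + pairing _ (J.hess i j) = 0
    rw [pairing_apply, pairing_apply]
    exact base j _ ψ _ _ (hφ.pderiv i) hψ (hJ.2.1 i) (hJ.2.2 i j)

theorem IsPlaneWeakPartial.congr_right {i : Fin 2} {f g g' : Plane → ℝ}
    (h : IsPlaneWeakPartial i f g) (hg : g =ᵐ[volume] g') : IsPlaneWeakPartial i f g' := by
  intro ψ hψ
  rw [h ψ hψ]
  congr 1
  refine integral_congr_ae ?_
  filter_upwards [hg] with x hx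
  rw [hx]

theorem IsPlaneWeakPartial.const_mul {i : Fin 2} {f g : Plane → ℝ}
    (h : IsPlaneWeakPartial i f g) (c : ℝ) :
    IsPlaneWeakPartial i (fun x => c * f x) (fun x => c * g x) := by
  intro ψ hψ
  simp only [mul_assoc, integral_const_mul, h ψ hψ, mul_neg]

/-- Compact support on the plane lets a vanishing weak gradient kill the function; this is used for
the first derivatives and then for `v` itself. -/
theorem Jet.ZeroExtendable.eq_zero (hU : IsOpen U) (hb : Bornology.IsBounded U) {v : Jet U}
    (hv : v.ZeroExtendable) (hh : ∀ i j, v.hess i j = 0) : v = 0 := by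
  have key : ∀ u : L2 U, (∀ i, ∃ w : L2 U, w = 0 ∧
      IsPlaneWeakPartial i (zeroExt u) (zeroExt w)) → u = 0 := by
    intro u hu
    refine eq_zero_of_zeroExt hU.measurableSet (ae_eq_zero_of_isPlaneWeakPartial_zero
      ((memLp_zeroExt hU.measurableSet u).locallyIntegrable (by norm_num))
      (hasCompactSupport_zeroExt hb u) fun i => ?_)
    obtain ⟨w, rfl, hw⟩ := hu i
    exact hw.congr_right (zeroExt_zero hU.measurableSet)
  have hgrad : ∀ i, v.grad i = 0 := fun i => key _ fun j => ⟨_, hh i j, hv.2 i j⟩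
  have hfn : v.fn = 0 := key _ fun i => ⟨_, hgrad i, hv.1 i⟩
  exact Prod.ext hfn (Prod.ext (funext hgrad) (funext fun i => funext fun j => hh i j))

end ZeroExt

/-! ### Uniqueness for the biharmonic problem -/

/-- The point `x` lies between `c` and a point of `closure K`. Replacing the latter by a nearby
point of `K` is compensated by moving the centre within the ball, so the inward dilation of the
closed set lies in `K` itself. -/
theorem contract_mem_of_starConvex {K : Set Plane} {c : Plane} {r : ℝ} (hr : 0 < r)
    (hstar : ∀ y ∈ Metric.ball c r, StarConvex ℝ y K) {s : ℝ} (hs : 1 < s) {x : Plane}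
    (hx : s • x + (1 - s) • c ∈ closure K) : x ∈ K := by
  have hs0 : 0 < s := by linarith
  obtain ⟨y, hy, hxy⟩ := Metric.mem_closure_iff.1 hx (r * (s - 1)) (by nlinarith)
  set d : Plane := s • x + (1 - s) • c - y with hd
  rw [dist_eq_norm, ← hd] at hxy
  have hs1 : s - 1 ≠ 0 := by linarith
  -- This is the displaced centre: the tolerance `r (s - 1)` was chosen so that it stays within the
  -- ball.
  have hc' : c + (s - 1)⁻¹ • d ∈ Metric.ball c r := by
    rw [mem_ball_iff_norm, add_sub_cancel_left, norm_smul, norm_inv, Real.norm_eq_abs,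
      abs_of_pos (by linarith), inv_mul_lt_iff₀ (by linarith)]
    linarith
  have h1 := hstar _ hc' hy (a := (s - 1) / s) (b := 1 / s) (div_nonneg (by linarith) hs0.le)
    (by positivity) (by field_simp; ring)
  convert h1 using 1
  have e : (1 / s) • y = (1 / s) • (s • x + (1 - s) • c - d) := by rw [hd]; congr 1; abel
  rw [e]
  match_scalars <;> field_simp <;> ring

theorem integral_bilaplacian {U : Set Plane} {v : Jet U} (hv : v ∈ H2 U) {φ : Plane → ℝ}
    (hφ : IsTestFunction U φ) :
    ∫ x in U, v.fn x * Laplacian.laplacian (Laplacian.laplacian φ) x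
      = ∑ i, ∑ j, ∫ x in U, v.hess i j x * pderiv j (pderiv i φ) x := by
  have key : ∀ i j, ∫ x in U, v.fn x * pderiv i (pderiv j (pderiv j (pderiv i φ))) x
      = ∫ x in U, v.hess i j x * pderiv j (pderiv i φ) x := fun i j => by
    rw [hv.1 i _ (((hφ.pderiv i).pderiv j).pderiv j), hv.2 i j _ ((hφ.pderiv i).pderiv j), neg_neg]
  have hi : ∀ i j, Integrable
      (fun x => v.fn x * pderiv i (pderiv j (pderiv j (pderiv i φ))) x) (volume.restrict U) :=
    fun i j => ((((hφ.pderiv i).pderiv j).pderiv j).pderiv i).integrable_mul _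
  rw [laplacian_laplacian_eq hφ.smooth]
  simp only [Finset.sum_apply, Finset.mul_sum]
  rw [integral_finsetSum _ fun i _ => integrable_finsetSum _ fun j _ => hi i j]
  refine Finset.sum_congr rfl fun i _ => ?_
  rw [integral_finsetSum _ fun j _ => hi i j]
  exact Finset.sum_congr rfl fun j _ => key i j

/-- On a domain that is star-shaped with respect to a ball, a biharmonic function whose extension
by zero is of class `H²` vanishes. -/
theorem eq_zero_of_biharmonic {K : Set Plane} (hK : IsOpen K) (hb : Bornology.IsBounded K)
    {c : Plane} {r : ℝ} (hr : 0 < r) (hstar : ∀ y ∈ Metric.ball c r, StarConvex ℝ y K)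
    {v : Jet K} (hv : v ∈ H2 K) (hext : v.ZeroExtendable)
    (hbi : ∀ φ, IsTestFunction K φ →
      ∫ x in K, v.fn x * Laplacian.laplacian (Laplacian.laplacian φ) x = 0) : v = 0 := by
  have hm := hK.measurableSet
  set F : Fin 2 → Fin 2 → Plane → ℝ := fun i j => zeroExt (v.hess i j) with hF
  have hFL : ∀ i j, MemLp (F i j) 2 volume := fun i j => memLp_zeroExt hm _
  have hloc : ∀ {f : Plane → ℝ}, MemLp f 2 volume → LocallyIntegrable f volume := fun hf =>
    hf.locallyIntegrable (by norm_num)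
  have hnn : ∀ i j, 0 ≤ ∫ x, F i j x ^ 2 := fun i j => integral_nonneg fun x => sq_nonneg _
  -- the energy vanishes
  have hQ : ∑ i, ∑ j, ∫ x, F i j x ^ 2 = 0 := by
    by_contra hne
    have hQpos : 0 < ∑ i, ∑ j, ∫ x, F i j x ^ 2 :=
      lt_of_le_of_ne (Finset.sum_nonneg fun i _ => Finset.sum_nonneg fun j _ => hnn i j)
        (Ne.symm hne)
    -- `H` pairs the Hessian with an affine transform of itself. It tends to the energy at the
    -- identity, hence is positive near `(1, 0)`; the test function below turns the equation into
    -- the vanishing of a weighted average of such values.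
    set H : ℝ × Plane → ℝ := fun p => ∑ i, ∑ j, ∫ x, F i j (p.1 • x + p.2) * F i j x with hH
    have hHlim : Tendsto H (𝓝 (1, 0)) (𝓝 (∑ i, ∑ j, ∫ x, F i j x ^ 2)) :=
      tendsto_finsetSum _ fun i _ => tendsto_finsetSum _ fun j _ =>
        tendsto_integral_comp_smul_add_mul (hFL i j)
    obtain ⟨η, hη0, hη⟩ := Metric.eventually_nhds_iff.1 (hHlim.eventually (lt_mem_nhds hQpos))
    -- the dilation
    obtain ⟨s, hs1, hs2⟩ : ∃ s : ℝ, 1 < s ∧ (s - 1) * (1 + ‖c‖) < η / 2 := by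
      refine ⟨1 + η / (4 * (1 + ‖c‖)), by linarith [show 0 < η / (4 * (1 + ‖c‖)) by positivity], ?_⟩
      rw [add_sub_cancel_left, div_mul_eq_mul_div, mul_comm 4, mul_comm η,
        mul_div_mul_left _ _ (by positivity)]
      linarith
    have hs0 : 0 < s := by linarith
    set b : Plane := (1 - s) • c with hbdef
    have hbn : ‖b‖ < η / 2 := by
      rw [hbdef, norm_smul, Real.norm_eq_abs, abs_sub_comm, abs_of_pos (by linarith)]
      nlinarith [norm_nonneg c]
    have hsη : s - 1 < η := by nlinarith [norm_nonneg c]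
    let e : Plane ≃ₜ Plane := (Homeomorph.smulOfNeZero s hs0.ne').trans (Homeomorph.addRight b)
    -- `A` contains the support of the contracted extension. It is a compact part of `K`, which
    -- leaves a margin `δ` for mollification.
    set A : Set Plane := e ⁻¹' closure K with hA
    have hAc : IsCompact A := e.isCompact_preimage.2 hb.isCompact_closure
    have hAK : A ⊆ K := fun x hx => contract_mem_of_starConvex hr hstar hs1 hx
    obtain ⟨δ, hδ0, hδ⟩ := hAc.exists_thickening_subset_open hK hAK
    -- Radius below `δ` keeps the test function supported in `K`; radius below `η / (2 * s)` makes
    -- `‖s • z‖ < η / 2` on the support of the mollifier.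
    obtain ⟨n, hn1, hn2⟩ := ((tendsto_bumpSeq_rOut.eventually (gt_mem_nhds hδ0)).and
      (tendsto_bumpSeq_rOut.eventually
        (gt_mem_nhds (show 0 < η / (2 * s) by positivity)))).exists
    set ρ : Plane → ℝ := (bumpSeq n).normed volume with hρdef
    have hρ : IsTestFunction univ ρ := isTestFunction_normed _
    have hρt : tsupport ρ ⊆ Metric.closedBall 0 (bumpSeq n).rOut :=
      (bumpSeq n).tsupport_normed_eq.subset
    -- the test function
    have hdil : ∀ u : L2 K, MemLp (fun x => zeroExt u (s • x + b)) 2 volume := fun u => by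
      have hqm : Measure.QuasiMeasurePreserving (fun x : Plane => s • x + b) volume volume :=
        ⟨by fun_prop, by rw [map_smul_add_volume hs0.ne']
                         exact Measure.smul_absolutelyContinuous⟩
      exact ⟨(memLp_zeroExt hm u).1.comp_quasiMeasurePreserving hqm,
        (eLpNorm_comp_smul_add_le (memLp_zeroExt hm u).1 (by linarith) b).trans_lt
          (ENNReal.mul_lt_top (by norm_num) (memLp_zeroExt hm u).2)⟩
    set φ : Plane → ℝ := mollify ρ (fun x => zeroExt v.fn (s • x + b)) with hφdef
    have hsupp : tsupport φ ⊆ K := by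
      have h1 : Function.support (fun x => zeroExt v.fn (s • x + b)) ⊆ A := fun x hx =>
        subset_closure (support_zeroExt_subset v.fn hx)
      refine (tsupport_mollify_subset hρt (isCompact_closedBall _ _) h1 hAc).trans ?_
      refine Subset.trans ?_ hδ
      rintro _ ⟨z, hz, a, ha, rfl⟩
      refine Metric.mem_thickening_iff.2 ⟨a, ha, ?_⟩
      rw [dist_eq_norm]
      simp only [add_sub_cancel_right]
      exact (mem_closedBall_zero_iff.1 hz).trans_lt hn1
    have hφ : IsTestFunction K φ :=
      ⟨contDiff_mollify hρ (hloc (hdil _)),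
        HasCompactSupport.of_support_subset_isCompact hb.isCompact_closure
          ((subset_tsupport _).trans (hsupp.trans subset_closure)), hsupp⟩
    have hφ1 : ∀ i, pderiv i φ = mollify ρ (fun x => s * zeroExt (v.grad i) (s • x + b)) :=
      fun i => ((hext.1 i).comp_affine hs0.ne' b).pderiv_mollify hρ (hloc (hdil _))
    have hφ2 : ∀ i j, pderiv j (pderiv i φ) = mollify ρ (fun x => s * (s * F i j (s • x + b))) :=
      fun i j => by
        rw [hφ1]
        exact (((hext.2 i j).comp_affine hs0.ne' b).const_mul s).pderiv_mollify hρ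
          (hloc ((hdil _).const_mul s))
    have hpair : ∀ i j, Integrable (fun z => ρ z * ∫ x, F i j (s • (x - z) + b) * F i j x) ∧
        ∫ x in K, v.hess i j x * pderiv j (pderiv i φ) x
          = s ^ 2 * ∫ z, ρ z * ∫ x, F i j (s • (x - z) + b) * F i j x := by
      intro i j
      have h1 := integral_mul_mollify hρ (hFL i j) (hdil (v.hess i j))
      refine ⟨h1.1, ?_⟩
      rw [← integral_zeroExt_mul hm, hφ2, ← h1.2, ← integral_const_mul]
      refine integral_congr_ae (ae_of_all _ fun x => ?_)
      dsimp only
      rw [mollify_apply, mollify_apply]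
      have : ∫ t, ρ (x - t) * (s * (s * F i j (s • t + b)))
          = s ^ 2 * ∫ t, ρ (x - t) * F i j (s • t + b) := by
        rw [← integral_const_mul]
        refine integral_congr_ae (ae_of_all _ fun t => ?_)
        dsimp only
        ring
      rw [this]
      simp only [hF]
      ring
    have h0 := hbi φ hφ
    rw [integral_bilaplacian hv hφ] at h0
    simp only [(hpair _ _).2, ← Finset.mul_sum] at h0
    have h0' := (mul_eq_zero.1 h0).resolve_left (by positivity)
    -- Translating by `z` before the dilation only changes the shift from `b` to `b - s • z`, so the
    -- tested equation is an average of values of `H`.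
    have hHz : ∀ z, ρ z * H (s, b - s • z)
        = ∑ i, ∑ j, ρ z * ∫ x, F i j (s • (x - z) + b) * F i j x := by
      intro z
      simp only [hH, Finset.mul_sum]
      refine Finset.sum_congr rfl fun i _ => Finset.sum_congr rfl fun j _ => ?_
      congr 1
      refine integral_congr_ae (ae_of_all _ fun x => ?_)
      dsimp only
      rw [smul_sub, show s • x + (b - s • z) = s • x - s • z + b by abel]
    have hint : Integrable fun z => ρ z * H (s, b - s • z) := by
      simp only [hHz]
      exact integrable_finsetSum _ fun i _ => integrable_finsetSum _ fun j _ => (hpair i j).1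
    have hzero : ∫ z, ρ z * H (s, b - s • z) = 0 := by
      simp only [hHz]
      rw [integral_finsetSum _ fun i _ => integrable_finsetSum _ fun j _ => (hpair i j).1]
      simp only [fun i => integral_finsetSum Finset.univ fun j _ => (hpair i j).1]
      exact h0'
    have hHpos : ∀ z, ρ z ≠ 0 → 0 < H (s, b - s • z) := by
      intro z hz
      have hz' : ‖z‖ < η / (2 * s) :=
        (mem_closedBall_zero_iff.1 (hρt (subset_tsupport _ hz))).trans_lt hn2
      refine hη ?_
      rw [Prod.dist_eq, max_lt_iff, Real.dist_eq, abs_of_pos (by linarith), dist_zero_right]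
      refine ⟨hsη, (norm_sub_le _ _).trans_lt ?_⟩
      have : ‖s • z‖ < η / 2 := by
        rw [norm_smul, Real.norm_eq_abs, abs_of_pos hs0]
        rw [lt_div_iff₀ (by positivity)] at hz' ⊢
        linarith
      linarith
    have hρ0 : ∀ z, 0 ≤ ρ z := fun z => (bumpSeq n).nonneg_normed z
    have hnonneg : ∀ z, 0 ≤ ρ z * H (s, b - s • z) := by
      intro z
      by_cases hz : ρ z = 0
      · rw [hz, zero_mul]
      · exact mul_nonneg (hρ0 z) (hHpos z hz).le
    -- `H` is positive wherever `ρ` is nonzero, so a zero average forces `ρ = 0` almost everywhere,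
    -- against `∫ ρ = 1`.
    have hae := (integral_eq_zero_iff_of_nonneg hnonneg hint).1 hzero
    have hρae : ρ =ᵐ[volume] 0 := by
      filter_upwards [hae] with z hz
      by_contra hz0
      exact (mul_ne_zero hz0 (hHpos z hz0).ne') hz
    have h1 : ∫ z, ρ z = 1 := (bumpSeq n).integral_normed
    rw [integral_congr_ae hρae] at h1
    simp at h1
  refine hext.eq_zero hK hb fun i j => eq_zero_of_zeroExt hm ?_
  have h1 : ∫ x, F i j x ^ 2 = 0 := by
    have h2 := (Finset.sum_eq_zero_iff_of_nonneg fun i _ =>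
      Finset.sum_nonneg fun j _ => hnn i j).1 hQ i (Finset.mem_univ i)
    exact (Finset.sum_eq_zero_iff_of_nonneg fun j _ => hnn i j).1 h2 j (Finset.mem_univ j)
  have h2 := (integral_eq_zero_iff_of_nonneg (fun x => sq_nonneg (F i j x))
    (hFL i j).integrable_sq).1 h1
  filter_upwards [h2] with x hx
  exact pow_eq_zero_iff (two_ne_zero) |>.1 hx

/-! ### Functions with vanishing traces -/

/-- Expand `0 ≤ ∫ (|k| - m)²`, where `m` is the mean of `|k|`. -/
theorem sq_integral_abs_le {k : ℝ → ℝ} (hk : ContinuousOn k (Icc 0 1)) :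
    (∫ t in (0 : ℝ)..1, |k t|) ^ 2 ≤ ∫ t in (0 : ℝ)..1, k t ^ 2 := by
  rw [← uIcc_of_le zero_le_one] at hk
  set m := ∫ t in (0 : ℝ)..1, |k t| with hm
  have h1 : 0 ≤ ∫ t in (0 : ℝ)..1, (|k t| - m) ^ 2 :=
    intervalIntegral.integral_nonneg zero_le_one fun t _ => sq_nonneg _
  have e : ∀ t, (|k t| - m) ^ 2 = (k t ^ 2 - 2 * m * |k t|) + m ^ 2 := fun t => by
    rw [sub_sq, sq_abs]; ring
  have i1 : IntervalIntegrable (fun t => k t ^ 2) volume 0 1 := (hk.pow 2).intervalIntegrable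
  have i2 : IntervalIntegrable (fun t => 2 * m * |k t|) volume 0 1 :=
    (continuousOn_const.mul hk.abs).intervalIntegrable
  simp only [e] at h1
  rw [intervalIntegral.integral_add (i1.sub i2) intervalIntegrable_const,
    intervalIntegral.integral_sub i1 i2, intervalIntegral.integral_const_mul, ← hm] at h1
  simp only [intervalIntegral.integral_const, sub_zero, smul_eq_mul, one_mul] at h1
  nlinarith

theorem tendsto_integral_abs_of_sq {k : ℕ → ℝ → ℝ} (hk : ∀ m, ContinuousOn (k m) (Icc 0 1))
    (h : Tendsto (fun m => ∫ t in (0 : ℝ)..1, k m t ^ 2) atTop (𝓝 0)) :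
    Tendsto (fun m => ∫ t in (0 : ℝ)..1, |k m t|) atTop (𝓝 0) := by
  have h1 := h.sqrt
  rw [Real.sqrt_zero] at h1
  exact squeeze_zero (fun m => intervalIntegral.integral_nonneg zero_le_one fun t _ => abs_nonneg _)
    (fun m => Real.le_sqrt_of_sq_le (sq_integral_abs_le (hk m))) h1

theorem tendsto_integral_mul_of_sq {k : ℕ → ℝ → ℝ} (hk : ∀ m, ContinuousOn (k m) (Icc 0 1))
    (h : Tendsto (fun m => ∫ t in (0 : ℝ)..1, k m t ^ 2) atTop (𝓝 0)) {η : ℝ → ℝ}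
    (hη : Continuous η) : Tendsto (fun m => ∫ t in (0 : ℝ)..1, k m t * η t) atTop (𝓝 0) := by
  obtain ⟨M, hM⟩ := isCompact_Icc.exists_bound_of_continuousOn (f := η) (s := Icc (0 : ℝ) 1)
    hη.continuousOn
  have h1 := (tendsto_integral_abs_of_sq hk h).const_mul M
  rw [mul_zero] at h1
  refine squeeze_zero_norm (fun m => ?_) h1
  have hk' := hk m
  rw [← uIcc_of_le zero_le_one] at hk'
  rw [← intervalIntegral.integral_const_mul]
  refine intervalIntegral.norm_integral_le_of_norm_le zero_le_one (ae_of_all _ fun t ht => ?_)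
    (continuousOn_const.mul hk'.abs).intervalIntegrable
  rw [norm_mul, mul_comm, Real.norm_eq_abs (k m t)]
  exact mul_le_mul_of_nonneg_right (hM t (Ioc_subset_Icc_self ht)) (abs_nonneg _)

theorem pderiv_mul {f g : Plane → ℝ} (hf : Differentiable ℝ f) (hg : Differentiable ℝ g)
    (i : Fin 2) (x : Plane) :
    pderiv i (f * g) x = f x * pderiv i g x + pderiv i f x * g x := by
  have := ((hf x).hasFDerivAt.mul (hg x).hasFDerivAt).fderiv
  simp only [pderiv]
  rw [this]
  simp
  ring

theorem SimplePolygon.frontier_subset_segments (K : SimplePolygon) :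
    frontier K.carrier ⊆ ⋃ e, affineSegment ℝ (K.poly e) (K.poly (finRotate K.n e)) := by
  rw [K.frontier_eq]
  exact Subset.rfl

/-- Limits of smooth functions whose boundary values tend to zero can be extended by zero. -/
theorem isPlaneWeakPartial_of_tendsto (K : SimplePolygon) (i : Fin 2) {f : ℕ → Plane → ℝ}
    {a b : ℕ → L2 K.carrier} {u w : L2 K.carrier} {h : Plane → ℝ}
    (hf : ∀ m, ContDiff ℝ ∞ (f m))
    (ha : ∀ m, a m =ᵐ[volume.restrict K.carrier] f m)
    (hb : ∀ m, b m =ᵐ[volume.restrict K.carrier] pderiv i (f m))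
    (hau : Tendsto a atTop (𝓝 u)) (hbw : Tendsto b atTop (𝓝 w))
    (hbd : TendstoL2Boundary K f h)
    (h0 : ∀ e, ∀ t ∈ Icc (0 : ℝ) 1, h (K.poly.edgePath ℝ e t) = 0) :
    IsPlaneWeakPartial i (zeroExt u) (zeroExt w) := by
  have hm := K.isOpen.measurableSet
  intro ψ hψ
  rw [integral_zeroExt_mul hm, integral_zeroExt_mul hm, eq_neg_iff_add_eq_zero,
    ← pairing_apply (hψ.pderiv i).memLp, ← pairing_apply hψ.memLp]
  obtain ⟨C, hC0, hC⟩ := abs_setIntegral_pderiv_le K.isOpen (fun e => K.poly e)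
    (fun e => K.poly (finRotate K.n e)) K.frontier_subset_segments i
  have hlim := (((pairing (U := K.carrier) (hψ.pderiv i).memLp).continuous.tendsto u).comp hau).add
    (((pairing (U := K.carrier) hψ.memLp).continuous.tendsto w).comp hbw)
  refine tendsto_nhds_unique hlim ?_
  -- By the product rule the defect in integration by parts is the integral of `∂ᵢ(f m ψ)` over `K`,
  -- which the edge values of `f m` control; these tend to zero in `L²`.
  have hD : ∀ m, pairing (hψ.pderiv i).memLp (a m) + pairing hψ.memLp (b m)
      = ∫ x in K.carrier, pderiv i (f m * ψ) x := by
    intro m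
    have i1 : Integrable (fun x => a m x * pderiv i ψ x) (volume.restrict K.carrier) :=
      (Lp.memLp (a m)).integrable_mul (hψ.pderiv i).memLp
    have i2 : Integrable (fun x => b m x * ψ x) (volume.restrict K.carrier) :=
      (Lp.memLp (b m)).integrable_mul hψ.memLp
    rw [pairing_apply, pairing_apply, ← integral_add i1 i2]
    refine integral_congr_ae ?_
    filter_upwards [ha m, hb m] with x h1 h2
    rw [h1, h2, pderiv_mul ((hf m).differentiable (by simp)) (hψ.smooth.differentiable (by simp))]
  have hcont : ∀ m e, Continuous fun t : ℝ => f m (K.poly.edgePath ℝ e t) := fun m e =>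
    (hf m).continuous.comp AffineMap.lineMap_continuous
  have hsq : ∀ e, Tendsto (fun m => ∫ t in (0 : ℝ)..1, f m (K.poly.edgePath ℝ e t) ^ 2) atTop
      (𝓝 0) := by
    intro e
    refine (hbd e).congr fun m => intervalIntegral.integral_congr fun t ht => ?_
    rw [uIcc_of_le zero_le_one] at ht
    rw [h0 e t ht, sub_zero]
  have habs : ∀ e, Tendsto (fun m => ∫ t in (0 : ℝ)..1,
      |(f m * ψ) (AffineMap.lineMap (K.poly e) (K.poly (finRotate K.n e)) t)|) atTop (𝓝 0) := by
    intro e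
    have hψc : Continuous fun t : ℝ => |ψ (K.poly.edgePath ℝ e t)| :=
      (hψ.smooth.continuous.comp AffineMap.lineMap_continuous).abs
    have h1 := tendsto_integral_mul_of_sq (k := fun m t => |f m (K.poly.edgePath ℝ e t)|)
      (fun m => (hcont m e).abs.continuousOn) (by simpa only [sq_abs] using hsq e) hψc
    simp only [← abs_mul] at h1
    exact h1
  have hlim2 := (tendsto_finsetSum Finset.univ fun e _ => habs e).const_mul C
  simp only [Finset.sum_const_zero, mul_zero] at hlim2
  refine squeeze_zero_norm (fun m => ?_) hlim2
  simp only [Function.comp_apply]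
  rw [hD, Real.norm_eq_abs]
  exact hC _ (((hf m).mul hψ.smooth).of_le (by simp)) hψ.compact.mul_left

/-- The link between `g` and `G` passes only through the approximations `φ m`. Their derivative
along the edge is integrated by parts against a bump `η`, and the `L²` limits on the edge give `∫ Γ
η = 0`; the fundamental lemma and continuity conclude. -/
theorem HasContTrace.tangential {K : SimplePolygon} {v : Jet K.carrier} {g : Plane → ℝ}
    {G : Fin 2 → Plane → ℝ} (h : HasContTrace K v g G) (e : Fin K.n)
    (hg : ∀ t ∈ Icc (0 : ℝ) 1, g (K.poly.edgePath ℝ e t) = 0) :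
    ∀ t ∈ Icc (0 : ℝ) 1, ∑ i, G i (K.poly.edgePath ℝ e t) *
      (K.poly (finRotate K.n e) i - K.poly e i) = 0 := by
  obtain ⟨φ, J, hφ, -, -, hφg, hφG⟩ := h.approx
  set τ : Fin 2 → ℝ := fun i => K.poly (finRotate K.n e) i - K.poly e i with hτ
  set γ : ℝ → Plane := fun t => K.poly.edgePath ℝ e t with hγ
  have hγd : ∀ t, HasDerivAt γ (K.poly (finRotate K.n e) - K.poly e) t := fun t =>
    AffineMap.hasDerivAt_lineMap
  have hγc : Continuous γ := AffineMap.lineMap_continuous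
  have hvec : K.poly (finRotate K.n e) - K.poly e
      = ∑ i, τ i • (EuclideanSpace.single i (1 : ℝ) : Plane) := by
    ext j
    fin_cases j <;> simp [τ, Fin.sum_univ_two]
  have hd : ∀ m t, HasDerivAt (fun t => φ m (γ t)) (∑ i, pderiv i (φ m) (γ t) * τ i) t := by
    intro m t
    have h1 := (((hφ m).differentiable (by simp)) (γ t)).hasFDerivAt.comp_hasDerivAt t (hγd t)
    have h2 : fderiv ℝ (φ m) (γ t) (K.poly (finRotate K.n e) - K.poly e)
        = ∑ i, pderiv i (φ m) (γ t) * τ i := by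
      rw [hvec, map_sum]
      refine Finset.sum_congr rfl fun i _ => ?_
      rw [map_smul, smul_eq_mul, mul_comm, pderiv]
    exact h2 ▸ h1
  have hGc : ∀ i, ContinuousOn (fun t => G i (γ t)) (Icc 0 1) := fun i =>
    continuousOn_comp_edgePath K e (h.continuousOn_grad i)
  have hpc : ∀ m i, Continuous fun t => pderiv i (φ m) (γ t) := fun m i =>
    (contDiff_pderiv (hφ m) i).continuous.comp hγc
  set Γ : ℝ → ℝ := fun t => ∑ i, G i (γ t) * τ i with hΓ
  have hΓc : ContinuousOn Γ (Icc 0 1) :=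
    continuousOn_finsetSum _ fun i _ => (hGc i).mul continuousOn_const
  have key : ∀ η : ℝ → ℝ, ContDiff ℝ ∞ η → HasCompactSupport η → tsupport η ⊆ Ioo 0 1 →
      ∫ t in (0 : ℝ)..1, Γ t * η t = 0 := by
    intro η hη _ hηs
    have hη1 : ContDiff ℝ 1 η := hη.of_le (by simp)
    have hη'c : Continuous (deriv η) := hη1.continuous_deriv le_rfl
    -- The bump vanishes at both end points, so no boundary term appears.
    have h0 : η 0 = 0 := image_eq_zero_of_notMem_tsupport fun h => (hηs h).1.ne rfl
    have h1 : η 1 = 0 := image_eq_zero_of_notMem_tsupport fun h => (hηs h).2.ne rfl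
    have hparts : ∀ m, ∫ t in (0 : ℝ)..1, (∑ i, pderiv i (φ m) (γ t) * τ i) * η t
        = - ∫ t in (0 : ℝ)..1, φ m (γ t) * deriv η t := by
      intro m
      have := intervalIntegral.integral_mul_deriv_eq_deriv_mul (a := 0) (b := 1)
        (fun t _ => hd m t) (fun t _ => ((hη1.differentiable (by simp)) t).hasDerivAt)
        ((continuous_finsetSum _ fun i _ => (hpc m i).mul continuous_const).intervalIntegrable _ _)
        (hη'c.intervalIntegrable _ _)
      rw [this, h0, h1]
      simp
    have hlim1 : Tendsto (fun m => ∫ t in (0 : ℝ)..1, φ m (γ t) * deriv η t) atTop (𝓝 0) := by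
      refine tendsto_integral_mul_of_sq
        (fun m => ((hφ m).continuous.comp hγc).continuousOn) ?_ hη'c
      refine (hφg e).congr fun m => intervalIntegral.integral_congr fun t ht => ?_
      rw [uIcc_of_le zero_le_one] at ht
      rw [hg t ht, sub_zero]
      rfl
    have hlim2 : ∀ i, Tendsto (fun m => ∫ t in (0 : ℝ)..1,
        (pderiv i (φ m) (γ t) - G i (γ t)) * (τ i * η t)) atTop (𝓝 0) := fun i =>
      tendsto_integral_mul_of_sq (fun m => (hpc m i).continuousOn.sub (hGc i)) (hφG i e)
        (continuous_const.mul hη.continuous)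
    have hlim3 := (tendsto_finsetSum Finset.univ fun i _ => hlim2 i)
    have hGc' := hGc
    simp only [← uIcc_of_le (zero_le_one (α := ℝ))] at hGc'
    have e1 : ∀ m, ∑ i, ∫ t in (0 : ℝ)..1, (pderiv i (φ m) (γ t) - G i (γ t)) * (τ i * η t)
        = - (∫ t in (0 : ℝ)..1, φ m (γ t) * deriv η t) - ∫ t in (0 : ℝ)..1, Γ t * η t := by
      intro m
      have hii : ∀ i, IntervalIntegrable
          (fun t => (pderiv i (φ m) (γ t) - G i (γ t)) * (τ i * η t)) volume 0 1 := fun i =>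
        (((hpc m i).continuousOn.sub (hGc' i)).mul
          (continuous_const.mul hη.continuous).continuousOn).intervalIntegrable
      have i1 : IntervalIntegrable (fun t => (∑ i, pderiv i (φ m) (γ t) * τ i) * η t)
          volume 0 1 :=
        ((continuous_finsetSum _ fun i _ => (hpc m i).mul continuous_const).mul
          hη.continuous).intervalIntegrable _ _
      have i2 : IntervalIntegrable (fun t => Γ t * η t) volume 0 1 := by
        have := hΓc
        rw [← uIcc_of_le (zero_le_one (α := ℝ))] at this
        exact (this.mul hη.continuous.continuousOn).intervalIntegrable
      rw [← hparts, ← intervalIntegral.integral_sub i1 i2,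
        ← intervalIntegral.integral_finsetSum fun i _ => hii i]
      refine intervalIntegral.integral_congr fun t _ => ?_
      simp only [hΓ, Finset.sum_mul, ← Finset.sum_sub_distrib]
      refine Finset.sum_congr rfl fun i _ => ?_
      ring
    simp only [e1, Finset.sum_const_zero] at hlim3
    have hlim4 := hlim1.neg.sub_const (∫ t in (0 : ℝ)..1, Γ t * η t)
    have := tendsto_nhds_unique hlim3 hlim4
    rw [neg_zero, zero_sub] at this
    linarith
  have hae : ∀ᵐ t : ℝ, t ∈ Ioo (0 : ℝ) 1 → Γ t = 0 := by
    refine isOpen_Ioo.ae_eq_zero_of_integral_contDiff_smul_eq_zero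
      ((hΓc.mono Ioo_subset_Icc_self).locallyIntegrableOn measurableSet_Ioo) fun η hη hηc hηs => ?_
    rw [← key η hη hηc hηs, intervalIntegral.integral_of_le zero_le_one,
      integral_Ioc_eq_integral_Ioo]
    rw [← setIntegral_eq_integral_of_forall_compl_eq_zero (s := Ioo (0 : ℝ) 1)]
    · simp only [smul_eq_mul, mul_comm]
    · intro t ht
      rw [image_eq_zero_of_notMem_tsupport fun h' => ht (hηs h'), zero_smul]
  have hioo : EqOn Γ 0 (Ioo 0 1) :=
    Measure.eqOn_open_of_ae_eq ((ae_restrict_iff' measurableSet_Ioo).2 hae) isOpen_Ioo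
      (hΓc.mono Ioo_subset_Icc_self) continuousOn_const
  exact hioo.of_subset_closure hΓc continuousOn_const Ioo_subset_Icc_self
    (by rw [closure_Ioo zero_ne_one])

theorem SimplePolygon.vertex_ne_next (K : SimplePolygon) (e : Fin K.n) :
    K.poly e ≠ K.poly (finRotate K.n e) := by
  intro h
  have h1 := K.vertices_injective h
  have h2 : e ∈ (finRotate K.n).support := by
    rw [support_finRotate_of_le (by have := K.three_le; omega)]
    exact Finset.mem_univ e
  exact (Equiv.Perm.mem_support.1 h2) h1.symm

/-- Tangent and normal span the plane, so both components of `G` vanish on every edge. The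
approximants and their first derivatives then all have edge values tending to zero. -/
theorem HasContTrace.zeroExtendable {K : SimplePolygon} {v : Jet K.carrier} {g : Plane → ℝ}
    {G : Fin 2 → Plane → ℝ} (h : HasContTrace K v g G)
    (hg : ∀ e, ∀ t ∈ Icc (0 : ℝ) 1, g (K.poly.edgePath ℝ e t) = 0)
    (hn : ∀ e, ∀ t ∈ Icc (0 : ℝ) 1,
      ∑ i, G i (K.poly.edgePath ℝ e t) * K.normal e i = 0) : v.ZeroExtendable := by
  have hG : ∀ i e, ∀ t ∈ Icc (0 : ℝ) 1, G i (K.poly.edgePath ℝ e t) = 0 := by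
    intro i e t ht
    have h1 := h.tangential e (hg e) t ht
    have h2 := hn e t ht
    have hne := K.vertex_ne_next e
    have hd : dist (K.poly e) (K.poly (finRotate K.n e)) ≠ 0 := dist_ne_zero.2 hne
    simp only [Fin.sum_univ_two, SimplePolygon.normal, Matrix.cons_val_zero,
      Matrix.cons_val_one] at h1 h2
    set P := K.poly e
    set Q := K.poly (finRotate K.n e)
    set x := G 0 (K.poly.edgePath ℝ e t)
    set y := G 1 (K.poly.edgePath ℝ e t)
    have h3 : x * (Q 1 - P 1) + y * (P 0 - Q 0) = 0 := by
      field_simp at h2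
      simpa using h2
    have hpos : 0 < (Q 0 - P 0) ^ 2 + (Q 1 - P 1) ^ 2 := by
      by_contra hcon
      refine hne ?_
      have e0 : Q 0 - P 0 = 0 := by nlinarith [sq_nonneg (Q 0 - P 0), sq_nonneg (Q 1 - P 1)]
      have e1 : Q 1 - P 1 = 0 := by nlinarith [sq_nonneg (Q 0 - P 0), sq_nonneg (Q 1 - P 1)]
      ext j
      fin_cases j
      · simp only [Fin.zero_eta]; linarith
      · simp only [Fin.mk_one]; linarith
    -- The relations `h1` and `h3` form a linear system in `x`, `y` whose determinant is minus the
    -- squared length of the edge.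
    have hx : x * ((Q 0 - P 0) ^ 2 + (Q 1 - P 1) ^ 2) = 0 := by
      linear_combination (Q 0 - P 0) * h1 + (Q 1 - P 1) * h3
    have hy : y * ((Q 0 - P 0) ^ 2 + (Q 1 - P 1) ^ 2) = 0 := by
      linear_combination (Q 1 - P 1) * h1 - (Q 0 - P 0) * h3
    fin_cases i
    · exact (mul_eq_zero.1 hx).resolve_right hpos.ne'
    · exact (mul_eq_zero.1 hy).resolve_right hpos.ne'
  obtain ⟨φ, J, hφ, hJ, hlim, hφg, hφG⟩ := h.approx
  have hlim1 : Tendsto (fun m => (J m).fn) atTop (𝓝 v.fn) := (continuous_fst.tendsto v).comp hlim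
  have hlim' := (continuous_snd.tendsto v).comp hlim
  have hlim2 : ∀ i, Tendsto (fun m => (J m).grad i) atTop (𝓝 (v.grad i)) := fun i =>
    (((continuous_apply i).comp continuous_fst).tendsto v.2).comp hlim'
  have hlim3 : ∀ i j, Tendsto (fun m => (J m).hess i j) atTop (𝓝 (v.hess i j)) := fun i j =>
    ((by fun_prop : Continuous fun p : (Fin 2 → L2 K.carrier) × (Fin 2 → Fin 2 → L2 K.carrier) =>
      p.2 i j).tendsto v.2).comp hlim'
  exact ⟨fun i => isPlaneWeakPartial_of_tendsto K i hφ (fun m => (hJ m).1)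
      (fun m => (hJ m).2.1 i) hlim1 (hlim2 i) hφg hg,
    fun i j => isPlaneWeakPartial_of_tendsto K j (fun m => contDiff_pderiv (hφ m) i)
      (fun m => (hJ m).2.1 i) (fun m => (hJ m).2.2 i j) (hlim2 i) (hlim3 i j) (hφG i) (hG i)⟩

/-! ### Finite dimensionality of the local spaces -/

/-- Traces and polynomials are only asserted to exist, so the data are a relation rather than a
function of `v`. The relation embeds in `N` and surjects onto `V`, which makes a proof of
well-definedness superfluous. -/
theorem finiteDimensional_of_relation {𝕜 V N : Type*} [Field 𝕜] [AddCommGroup V] [Module 𝕜 V]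
    [AddCommGroup N] [Module 𝕜 N] [FiniteDimensional 𝕜 N] (R : Submodule 𝕜 (V × N))
    (htot : ∀ v, ∃ n, (v, n) ∈ R) (hinj : ∀ v, (v, (0 : N)) ∈ R → v = 0) :
    FiniteDimensional 𝕜 V := by
  have h1 : Function.Injective ((LinearMap.snd 𝕜 V N).comp R.subtype) := by
    rw [← LinearMap.ker_eq_bot, LinearMap.ker_eq_bot']
    rintro ⟨⟨v, n⟩, hv⟩ h
    have hn : n = 0 := h
    subst hn
    have h0 : v = 0 := hinj v hv
    subst h0
    rfl
  have h2 : FiniteDimensional 𝕜 R := FiniteDimensional.of_injective _ h1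
  have h3 : Function.Surjective ((LinearMap.fst 𝕜 V N).comp R.subtype) := fun v =>
    let ⟨n, hn⟩ := htot v
    ⟨⟨(v, n), hn⟩, rfl⟩
  exact Module.Finite.of_surjective _ h3

/-- The data of a function of the local space: its bilaplacian, its values on the edges and its
normal derivatives on the edges. -/
abbrev LocalData (n : ℕ) : Type :=
  MvPolynomial.restrictTotalDegree (Fin 2) ℝ 2 ×
    -- The bound in `degreeLT` is strict: `4` and `2` stand for `P₃` and `P₁`.
    (Fin n → Polynomial.degreeLT ℝ 4) × (Fin n → Polynomial.degreeLT ℝ 2)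

/-- The functions of `V_h^K` with their data. -/
def localDataRelation (K : SimplePolygon) : Submodule ℝ (Jet K.carrier × LocalData K.n) where
  carrier := {x |
    (∀ φ, ∀ hφ : IsTestFunction K.carrier φ, pairing hφ.laplacian.laplacian.memLp x.1.fn
      = ∫ y in K.carrier, polyFun x.2.1 y * φ y) ∧
    ∃ (g : Plane → ℝ) (G : Fin 2 → Plane → ℝ), HasContTrace K x.1 g G ∧
      ∀ e, ∀ t ∈ Icc (0 : ℝ) 1,
        g (K.poly.edgePath ℝ e t) = (x.2.2.1 e : Polynomial ℝ).eval t ∧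
        ∑ i, G i (K.poly.edgePath ℝ e t) * K.normal e i
          = (x.2.2.2 e : Polynomial ℝ).eval t}
  zero_mem' := by
    obtain ⟨-, g, G, h, -⟩ := memVK_of_mem_polySpace K (zero_mem (polySpace K.carrier 2))
    refine ⟨fun φ hφ => ?_, (0 : ℝ) • g, (0 : ℝ) • G, ?_, fun e t _ => ?_⟩
    · simp [polyFun, Jet.fn]
    · simpa using h.smul 0
    · simp
  add_mem' := by
    rintro x y ⟨hx, g, G, hg, he⟩ ⟨hy, g', G', hg', he'⟩
    refine ⟨fun φ hφ => ?_, g + g', G + G', hg.add hg', fun e t ht => ⟨?_, ?_⟩⟩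
    · have h1 : (x + y).1.fn = x.1.fn + y.1.fn := rfl
      have h2 : polyFun ((x + y).2.1 : MvPolynomial (Fin 2) ℝ)
          = polyFun x.2.1 + polyFun y.2.1 := polyFun_add _ _
      rw [h1, map_add, hx φ hφ, hy φ hφ, h2,
        ← integral_add (hφ.integrable_mul_cont (contDiff_polyFun _)).restrict
          (hφ.integrable_mul_cont (contDiff_polyFun _)).restrict]
      simp [add_mul]
    · simp [(he e t ht).1, (he' e t ht).1]
    · simp [(he e t ht).2.symm, (he' e t ht).2.symm, add_mul, Finset.sum_add_distrib]
  smul_mem' := by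
    rintro c x ⟨hx, g, G, hg, he⟩
    refine ⟨fun φ hφ => ?_, c • g, c • G, hg.smul c, fun e t ht => ⟨?_, ?_⟩⟩
    · have h1 : (c • x).1.fn = c • x.1.fn := rfl
      have h2 : polyFun ((c • x).2.1 : MvPolynomial (Fin 2) ℝ) = c • polyFun x.2.1 :=
        polyFun_smul _ _
      rw [h1, map_smul, hx φ hφ, h2, smul_eq_mul, ← integral_const_mul]
      simp [mul_assoc]
    · simp [(he e t ht).1]
    · simp [(he e t ht).2.symm, mul_add, mul_assoc]

theorem MemVK.exists_localData {K : SimplePolygon} {v : Jet K.carrier} (h : MemVK K v) :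
    ∃ d, (v, d) ∈ localDataRelation K := by
  obtain ⟨⟨p, hp, hv⟩, g, G, hg, he⟩ := h
  choose q hq1 hq2 using fun e => (he e).1
  choose r hr1 hr2 using fun e => (he e).2
  have hdeg : ∀ {p : Polynomial ℝ} {n : ℕ}, p.natDegree ≤ n → p ∈ Polynomial.degreeLT ℝ (n + 1) :=
    fun {p n} hp => Polynomial.mem_degreeLT.2
      (Polynomial.degree_le_natDegree.trans_lt (by exact_mod_cast Nat.lt_succ_of_le hp))
  refine ⟨(⟨p, (MvPolynomial.mem_restrictTotalDegree _ _ _).2 hp⟩,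
    fun e => ⟨q e, hdeg (hq1 e)⟩, fun e => ⟨r e, hdeg (hr1 e)⟩), fun φ hφ => ?_, g, G, hg,
    fun e t ht => ⟨hq2 e t ht, hr2 e t ht⟩⟩
  rw [pairing_apply]
  exact hv φ hφ

theorem finiteDimensional_localSpace (K : SimplePolygon) {c : Plane} {r : ℝ} (hr : 0 < r)
    (hstar : ∀ y ∈ Metric.ball c r, StarConvex ℝ y K.carrier) :
    FiniteDimensional ℝ (localSpace K) := by
  refine finiteDimensional_of_relation (N := LocalData K.n)
    ((localDataRelation K).comap ((localSpace K).subtype.prodMap LinearMap.id))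
    (fun v => v.2.1.exists_localData) fun v hv => ?_
  obtain ⟨h1, g, G, hg, he⟩ := hv
  refine Subtype.ext (eq_zero_of_biharmonic K.isOpen K.isBounded hr hstar hg.mem_H2
    (hg.zeroExtendable (fun e t ht => ?_) fun e t ht => ?_) fun φ hφ => ?_)
  · exact (he e t ht).1.trans (by simp)
  · exact (he e t ht).2.trans (by simp)
  · have := h1 φ hφ
    rw [pairing_apply] at this
    exact this.trans (by simp [polyFun])

/-! ### The energy projection is linear -/

theorem IsJetOf.eq_zero {U : Set Plane} (hU : IsOpen U) {φ : Plane → ℝ} {v : Jet U}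
    (hv : IsJetOf U φ v) (h : EqOn φ 0 U) : v = 0 := by
  have hd : ∀ (i : Fin 2) (f : Plane → ℝ), EqOn f 0 U → EqOn (pderiv i f) 0 U := by
    intro i f hf x hx
    have : f =ᶠ[𝓝 x] fun _ => 0 := by
      filter_upwards [hU.mem_nhds hx] with y hy using hf hy
    simp [pderiv, this.fderiv_eq]
  have key : ∀ (u : L2 U) (f : Plane → ℝ), u =ᵐ[volume.restrict U] f → EqOn f 0 U → u = 0 := by
    intro u f hu hf
    rw [Lp.eq_zero_iff_ae_eq_zero]
    filter_upwards [hu, ae_restrict_mem hU.measurableSet] with x h1 h2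
    rw [h1, hf h2]
  exact Prod.ext (key _ _ hv.1 h) (Prod.ext
    (funext fun i => key _ _ (hv.2.1 i) (hd i _ h))
    (funext fun i => funext fun j => key _ _ (hv.2.2 i j) (hd j _ (hd i _ h))))

/-- Differentiating in a variable that occurs multiplies the coefficient by a positive exponent, so
the monomial survives. Hence degrees can be read off from derivatives. -/
theorem exists_mem_support_pderiv {p : MvPolynomial (Fin 2) ℝ} {m : Fin 2 →₀ ℕ}
    (hm : m ∈ p.support) (hm0 : m ≠ 0) : ∃ i, ∃ m' ∈ (MvPolynomial.pderiv i p).support,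
      m = m' + Finsupp.single i 1 := by
  obtain ⟨i, hi⟩ := Finsupp.ne_iff.1 hm0
  have hmm : m = m - Finsupp.single i 1 + Finsupp.single i 1 :=
    (tsub_add_cancel_of_le (Finsupp.single_le_iff.2 (Nat.one_le_iff_ne_zero.2 hi))).symm
  refine ⟨i, m - Finsupp.single i 1, ?_, hmm⟩
  rw [MvPolynomial.mem_support_iff, MvPolynomial.coeff_pderiv, ← hmm]
  exact mul_ne_zero (MvPolynomial.mem_support_iff.1 hm) (by positivity)

theorem totalDegree_le_zero_of_pderiv {p : MvPolynomial (Fin 2) ℝ}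
    (h : ∀ i, MvPolynomial.pderiv i p = 0) : p.totalDegree ≤ 0 := by
  refine Finset.sup_le fun m hm => ?_
  by_cases hm0 : m = 0
  · subst hm0; simp
  · obtain ⟨i, m', hm', -⟩ := exists_mem_support_pderiv hm hm0
    simp [h] at hm'

theorem totalDegree_le_of_pderiv {p : MvPolynomial (Fin 2) ℝ} {k : ℕ}
    (h : ∀ i, (MvPolynomial.pderiv i p).totalDegree ≤ k) : p.totalDegree ≤ k + 1 := by
  refine Finset.sup_le fun m hm => ?_
  by_cases hm0 : m = 0
  · subst hm0; simp
  · obtain ⟨i, m', hm', rfl⟩ := exists_mem_support_pderiv hm hm0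
    have h2 := (MvPolynomial.le_totalDegree hm').trans (h i)
    rw [Finsupp.sum_add_index' (by simp) (by simp), Finsupp.sum_single_index (by simp)]
    omega

/-! ### Affine functions vanishing at the vertices, and uniqueness of the projection -/

theorem SimplePolygon.vertex_mem_frontier (K : SimplePolygon) (e : Fin K.n) :
    K.poly e ∈ frontier K.carrier := by
  rw [K.frontier_eq]
  exact mem_iUnion.2 ⟨e, left_mem_affineSegment ℝ _ _⟩

theorem SimplePolygon.nonempty (K : SimplePolygon) : K.carrier.Nonempty := by
  by_contra h
  rw [not_nonempty_iff_eq_empty] at h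
  have h1 := K.vertex_mem_frontier ⟨0, by have := K.three_le; omega⟩
  rw [h, frontier_empty] at h1
  exact h1

/-- A line is connected, so if it avoided the frontier it would stay in the bounded set `K.carrier`.
-/
theorem SimplePolygon.exists_mem_frontier_line (K : SimplePolygon) {x d : Plane}
    (hx : x ∈ K.carrier) (hd : d ≠ 0) : ∃ t : ℝ, x + t • d ∈ frontier K.carrier := by
  by_contra hcon
  push Not at hcon
  have hpre : IsPreconnected (range fun t : ℝ => x + t • d) :=
    isPreconnected_range (by fun_prop)
  have hdis : Disjoint (range fun t : ℝ => x + t • d) (frontier K.carrier) := by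
    rw [Set.disjoint_left]
    rintro _ ⟨t, rfl⟩
    exact hcon t
  rcases hpre.subset_or_disjoint_of_disjoint_frontier K.isOpen hdis with h | h
  · obtain ⟨R, hR0, hR⟩ := K.isBounded.subset_ball_lt 0 (0 : Plane)
    have hd0 : 0 < ‖d‖ := norm_pos_iff.2 hd
    -- At this parameter the point has norm at least `R`.
    have h1 := hR (h ⟨(R + ‖x‖) / ‖d‖, rfl⟩)
    rw [mem_ball_zero_iff] at h1
    have h2 := norm_sub_le_norm_add (((R + ‖x‖) / ‖d‖) • d) x
    rw [norm_smul, Real.norm_eq_abs, abs_of_nonneg (by positivity), div_mul_cancel₀ _ hd0.ne',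
      add_comm _ x] at h2
    simp only at h1
    linarith
  · exact Set.disjoint_left.1 h ⟨0, by simp⟩ hx

/-- An affine function vanishing at the vertices vanishes on every edge, hence on the frontier.
Through a point of `K` runs a line on which it is constant, and this line meets the frontier. No
choice of three non-collinear vertices is needed. -/
theorem SimplePolygon.polyFun_eq_zero_of_vertices (K : SimplePolygon)
    {p : MvPolynomial (Fin 2) ℝ} (hp : p.totalDegree ≤ 1) (h : ∀ e, polyFun p (K.poly e) = 0) :
    EqOn (polyFun p) 0 K.carrier := by
  have hfr : EqOn (polyFun p) 0 (frontier K.carrier) := by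
    intro x hx
    rw [K.frontier_eq] at hx
    obtain ⟨e, t, ht, rfl⟩ := mem_iUnion.1 hx
    obtain ⟨q, hq, hqe⟩ := isEdgePoly_polyFun K e hp
    obtain ⟨a, b, rfl⟩ := Polynomial.exists_eq_X_add_C_of_natDegree_le_one hq
    have h0 := hqe 0 (by simp)
    have h1 := hqe 1 (by simp)
    simp only [Polygon.edgePath, AffineMap.lineMap_apply_zero, AffineMap.lineMap_apply_one] at h0 h1
    rw [h] at h0 h1
    simp only [Polynomial.eval_add, Polynomial.eval_mul, Polynomial.eval_C, Polynomial.eval_X,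
      mul_zero, zero_add, mul_one] at h0 h1
    have h2 := hqe t ht
    simp only [Polygon.edgePath] at h2
    rw [h2]
    have ha : a = 0 := by linarith
    simp [← h0, ha]
  intro x hx
  have hc : ∀ i, ∃ b : ℝ, MvPolynomial.pderiv i p = MvPolynomial.C b := fun i =>
    ⟨_, MvPolynomial.totalDegree_eq_zero_iff_eq_C.1
      (Nat.le_zero.1 (totalDegree_pderiv_le i (k := 0) hp))⟩
  choose b hb using hc
  -- `d` is the gradient turned by a right angle, or any nonzero vector when the gradient is zero.
  obtain ⟨d, hd0, hd⟩ : ∃ d : Plane, d ≠ 0 ∧ b 0 * d 0 + b 1 * d 1 = 0 := by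
    by_cases h0 : b 0 = 0 ∧ b 1 = 0
    · refine ⟨EuclideanSpace.single 0 1, fun h => ?_, by simp [h0.1]⟩
      simpa using congrArg (fun x : Plane => x 0) h
    · refine ⟨!₂[-b 1, b 0], fun h => h0 ⟨?_, ?_⟩, by simp; ring⟩
      · simpa using congrArg (fun x : Plane => x 1) h
      · simpa using congrArg (fun x : Plane => x 0) h
  obtain ⟨t, ht⟩ := K.exists_mem_frontier_line hx hd0
  have hderiv : ∀ t : ℝ, HasDerivAt (fun t : ℝ => polyFun p (x + t • d)) 0 t := by
    intro t
    have h1 : HasDerivAt (fun t : ℝ => x + t • d) d t := by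
      simpa using ((hasDerivAt_id t).smul_const d).const_add x
    have h2 := (((contDiff_polyFun p).differentiable (by simp)) (x + t • d)).hasFDerivAt
      |>.comp_hasDerivAt t h1
    have hvec : d = ∑ i, d i • (EuclideanSpace.single i (1 : ℝ) : Plane) := by
      ext j
      fin_cases j <;> simp [Fin.sum_univ_two]
    have h3 : fderiv ℝ (polyFun p) (x + t • d) d = 0 := by
      have e : ∀ i y, fderiv ℝ (polyFun p) y (EuclideanSpace.single i 1) = b i := fun i y => by
        have := congrFun (pderiv_polyFun i p) y
        rw [hb] at this
        simpa [pderiv, polyFun] using this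
      refine (congrArg _ hvec).trans ?_
      rw [map_sum, Fin.sum_univ_two]
      simp only [map_smul, e, smul_eq_mul]
      linarith
    exact h3 ▸ h2
  have hconst := is_const_of_deriv_eq_zero (fun t => (hderiv t).differentiableAt)
    (fun t => (hderiv t).deriv) 0 t
  simp only [zero_smul, add_zero] at hconst
  rw [hconst]
  exact hfr ht

theorem aForm_comm (K : Set Plane) (u v : Jet K) : aForm K u v = aForm K v u := by
  simp only [aForm, mul_comm]

theorem bForm_comm (K : Set Plane) (u v : Jet K) : bForm K u v = bForm K v u := by
  simp only [bForm, mul_comm]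

theorem aForm_self_nonneg (K : Set Plane) (u : Jet K) : 0 ≤ aForm K u u :=
  integral_nonneg fun _ => Finset.sum_nonneg fun _ _ => Finset.sum_nonneg fun _ _ =>
    mul_self_nonneg _

theorem bForm_self_nonneg (K : Set Plane) (u : Jet K) : 0 ≤ bForm K u u :=
  integral_nonneg fun _ => mul_self_nonneg _

theorem hess_eq_zero_of_aForm {K : Set Plane} {u : Jet K} (h : aForm K u u = 0) (i j : Fin 2) :
    u.hess i j = 0 := by
  have hint : Integrable (fun x => ∑ i, ∑ j, u.hess i j x * u.hess i j x) (volume.restrict K) :=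
    integrable_finsetSum _ fun i _ => integrable_finsetSum _ fun j _ =>
      (Lp.memLp (u.hess i j)).integrable_mul (Lp.memLp (u.hess i j))
  have h1 := (integral_eq_zero_iff_of_nonneg (fun x => Finset.sum_nonneg fun _ _ =>
    Finset.sum_nonneg fun _ _ => mul_self_nonneg _) hint).1 h
  rw [Lp.eq_zero_iff_ae_eq_zero]
  filter_upwards [h1] with x hx
  have h2 := (Finset.sum_eq_zero_iff_of_nonneg fun i _ => Finset.sum_nonneg fun j _ =>
    mul_self_nonneg _).1 hx i (Finset.mem_univ i)
  have h3 := (Finset.sum_eq_zero_iff_of_nonneg fun j _ => mul_self_nonneg _).1 h2 j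
    (Finset.mem_univ j)
  exact mul_self_eq_zero.1 h3

theorem fn_eq_zero_of_bForm {K : Set Plane} {u : Jet K} (h : bForm K u u = 0) : u.fn = 0 := by
  have hint : Integrable (fun x => u.fn x * u.fn x) (volume.restrict K) :=
    (Lp.memLp u.fn).integrable_mul (Lp.memLp u.fn)
  have h1 := (integral_eq_zero_iff_of_nonneg (fun x => mul_self_nonneg _) hint).1 h
  rw [Lp.eq_zero_iff_ae_eq_zero]
  filter_upwards [h1] with x hx
  exact mul_self_eq_zero.1 hx

theorem eq_zero_of_mem_polySpace {K : Set Plane} (hK : IsOpen K) {k : ℕ} {q : Jet K}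
    (hq : q ∈ polySpace K k) (h : q.fn = 0) : q = 0 := by
  obtain ⟨p, -, hp⟩ := hq
  refine hp.eq_zero hK ?_
  have h1 : polyFun p =ᵐ[volume.restrict K] fun _ => 0 := by
    filter_upwards [hp.1, (Lp.eq_zero_iff_ae_eq_zero).1 h] with x h1 h2
    rw [← h1, h2, Pi.zero_apply]
  exact Measure.eqOn_open_of_ae_eq h1 hK (contDiff_polyFun p).continuous.continuousOn
    continuousOn_const

theorem eqOn_closure_of_ae_eq {K : Set Plane} (hK : IsOpen K) {f g : Plane → ℝ}
    (hf : ContinuousOn f (closure K)) (hg : ContinuousOn g (closure K))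
    (h : f =ᵐ[volume.restrict K] g) : EqOn f g (closure K) :=
  (Measure.eqOn_open_of_ae_eq h hK (hf.mono subset_closure)
    (hg.mono subset_closure)).of_subset_closure hf hg subset_closure Subset.rfl

/-- Testing the energy identity with `q` itself gives a zero Hessian, so `q` is affine. It is then
admissible in the vertex condition, which becomes `∑ q(Pᵢ)² = 0`. The resulting uniqueness makes the
chosen `energyProj` linear. -/
theorem IsEnergyProj.eq_zero {K : SimplePolygon} {q : Jet K.carrier} (h : IsEnergyProj K 0 q) :
    q = 0 := by
  obtain ⟨hq, ha, g, f, hg, hvg, hf, hqf, hP⟩ := h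
  have haq : aForm K.carrier q q = 0 := by
    rw [ha q hq, ← zero_smul ℝ (0 : Jet K.carrier), aForm_smul_left, zero_mul]
  have hhess := hess_eq_zero_of_aForm haq
  obtain ⟨p, hp, hpq⟩ := hq
  have hp2 : ∀ i j, MvPolynomial.pderiv j (MvPolynomial.pderiv i p) = 0 := by
    intro i j
    have hC := MvPolynomial.totalDegree_eq_zero_iff_eq_C.1 (Nat.le_zero.1
      (totalDegree_pderiv_le j (k := 0) (totalDegree_pderiv_le i (k := 1) hp)))
    have h1 : polyFun (MvPolynomial.pderiv j (MvPolynomial.pderiv i p))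
        =ᵐ[volume.restrict K.carrier] fun _ => 0 := by
      have h2 := hpq.2.2 i j
      rw [pderiv_polyFun, pderiv_polyFun] at h2
      filter_upwards [h2, (Lp.eq_zero_iff_ae_eq_zero).1 (hhess i j)] with x h3 h4
      rw [← h3, h4, Pi.zero_apply]
    have h2 := Measure.eqOn_open_of_ae_eq h1 K.isOpen
      (contDiff_polyFun _).continuous.continuousOn continuousOn_const
    obtain ⟨x, hx⟩ := K.nonempty
    have h3 := h2 hx
    rw [hC] at h3 ⊢
    simp only [polyFun, MvPolynomial.eval_C] at h3
    rw [h3, map_zero]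
  have hp1 : p.totalDegree ≤ 1 :=
    totalDegree_le_of_pderiv fun i => totalDegree_le_zero_of_pderiv (hp2 i)
  have hcp := (contDiff_polyFun p).continuous.continuousOn (s := closure K.carrier)
  have hfp : EqOn f (polyFun p) (closure K.carrier) :=
    eqOn_closure_of_ae_eq K.isOpen hf hcp (hqf.symm.trans hpq.1)
  have hg0 : EqOn g 0 (closure K.carrier) :=
    eqOn_closure_of_ae_eq K.isOpen hg continuousOn_const
      (hvg.symm.trans (Lp.coeFn_zero ℝ 2 (volume.restrict K.carrier)))
  have hvc : ∀ e, K.poly e ∈ closure K.carrier := fun e =>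
    frontier_subset_closure (K.vertex_mem_frontier e)
  have hsum := hP p hp1
  simp only [hfp (hvc _), hg0 (hvc _), Pi.zero_apply, zero_mul, Finset.sum_const_zero] at hsum
  have hvert : ∀ e, polyFun p (K.poly e) = 0 := fun e =>
    mul_self_eq_zero.1 ((Finset.sum_eq_zero_iff_of_nonneg fun e _ => mul_self_nonneg _).1 hsum e
      (Finset.mem_univ e))
  exact hpq.eq_zero K.isOpen (K.polyFun_eq_zero_of_vertices hp1 hvert)

theorem IsEnergyProj.unique {K : SimplePolygon} {v q q' : Jet K.carrier}
    (h : IsEnergyProj K v q) (h' : IsEnergyProj K v q') : q = q' := by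
  have h1 := h.add (h'.smul (-1))
  rw [neg_one_smul, neg_one_smul, add_neg_cancel] at h1
  exact add_neg_eq_zero.1 h1.eq_zero

/-- The energy projection as a linear map. -/
noncomputable def energyProjLinear (K : SimplePolygon) : localSpace K →ₗ[ℝ] Jet K.carrier where
  toFun v := energyProj K v
  map_add' u v := (energyProj_spec K (u + v)).unique
    ((energyProj_spec K u).add (energyProj_spec K v))
  map_smul' c v := (energyProj_spec K (c • v)).unique ((energyProj_spec K v).smul c)

/-- The map `v ↦ v - Π v` as a linear map. -/
noncomputable def projRemainderLinear (K : SimplePolygon) : localSpace K →ₗ[ℝ] localSpace K where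
  toFun := projRemainder K
  map_add' u v := Subtype.ext (by
    have := (energyProjLinear K).map_add u v
    simp only [energyProjLinear, LinearMap.coe_mk, AddHom.coe_mk] at this
    simp only [projRemainder, Submodule.coe_add] at this ⊢
    rw [this]; abel)
  map_smul' c v := Subtype.ext (by
    have := (energyProjLinear K).map_smul c v
    simp only [energyProjLinear, LinearMap.coe_mk, AddHom.coe_mk] at this
    simp only [projRemainder, Submodule.coe_smul, RingHom.id_apply] at this ⊢
    rw [this, smul_sub])

/-! ### The mesh covers the domain up to a null set -/

theorem volume_affineSegment (P Q : Plane) : volume (affineSegment ℝ P Q) = 0 := by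
  have hsub : affineSegment ℝ P Q ⊆ affineSpan ℝ {P, Q} := by
    rintro _ ⟨t, -, rfl⟩
    exact AffineMap.lineMap_mem_affineSpan_pair t P Q
  refine measure_mono_null hsub (Measure.addHaar_affineSubspace _ _ fun h => ?_)
  have h1 := (collinear_iff_finrank_le_one (k := ℝ)).1 (collinear_pair ℝ P Q)
  rw [← direction_affineSpan, h, AffineSubspace.direction_top, finrank_top,
    finrank_euclideanSpace_fin] at h1
  omega

theorem SimplePolygon.volume_frontier (K : SimplePolygon) : volume (frontier K.carrier) = 0 :=
  measure_mono_null K.frontier_subset_segments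
    (measure_iUnion_null fun _ => volume_affineSegment _ _)

theorem restrictL2_ae_eq {U K : Set Plane} (h : K ⊆ U) (u : L2 U) :
    restrictL2 h u =ᵐ[volume.restrict K] u :=
  MemLp.coeFn_toLp ((Lp.memLp u).mono_measure (Measure.restrict_mono_set volume h))

namespace PolygonalMesh

variable {Ω : Set Plane}

/-- The closures of the cells cover `Ω`, and the frontiers, finite unions of segments, are null
sets. -/
theorem ae_mem_cell (M : PolygonalMesh Ω) :
    ∀ᵐ x ∂(volume.restrict Ω), ∃ k, x ∈ (M.cell k).carrier := by
  have h1 : ∀ᵐ x : Plane, ∀ k, x ∉ frontier (M.cell k).carrier :=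
    ae_all_iff.2 fun k => measure_eq_zero_iff_ae_notMem.1 (M.cell k).volume_frontier
  have h2 : ∀ᵐ x : Plane, x ∈ Ω → ∃ k, x ∈ (M.cell k).carrier := by
    filter_upwards [h1] with x hx hxΩ
    have h3 : x ∈ ⋃ k, closure (M.cell k).carrier := M.cover ▸ subset_closure hxΩ
    obtain ⟨k, hk⟩ := mem_iUnion.1 h3
    refine ⟨k, ?_⟩
    by_contra hxk
    exact hx k (by rw [(M.cell k).isOpen.frontier_eq]; exact ⟨hk, hxk⟩)
  rw [ae_iff] at h2 ⊢
  refine le_antisymm ?_ zero_le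
  -- Measurability of `Ω` is not available here, so that of the complement of the open union of
  -- cells is used to evaluate the restricted measure.
  have hnull : NullMeasurableSet {x | ¬∃ k, x ∈ (M.cell k).carrier} := by
    have : {x | ¬∃ k, x ∈ (M.cell k).carrier} = (⋃ k, (M.cell k).carrier)ᶜ := by
      ext x; simp
    rw [this]
    exact (isOpen_iUnion fun k => (M.cell k).isOpen).measurableSet.compl.nullMeasurableSet
  rw [Measure.restrict_apply₀ (hnull.mono_ac Measure.restrict_le_self.absolutelyContinuous), ← h2]
  exact measure_mono fun x hx h => hx.1 (h hx.2)

theorem eq_zero_of_restrictL2 (M : PolygonalMesh Ω) {u : L2 Ω}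
    (h : ∀ k, restrictL2 (M.subset k) u = 0) : u = 0 := by
  have hk : ∀ k, ∀ᵐ x ∂(volume.restrict (M.cell k).carrier), u x = 0 := by
    intro k
    filter_upwards [restrictL2_ae_eq (M.subset k) u, Lp.eq_zero_iff_ae_eq_zero.1 (h k)]
      with x h1 h2
    rw [← h1, h2, Pi.zero_apply]
  have hk' : ∀ᵐ x : Plane, ∀ k, x ∈ (M.cell k).carrier → u x = 0 :=
    ae_all_iff.2 fun k => (ae_restrict_iff' (M.cell k).isOpen.measurableSet).1 (hk k)
  rw [Lp.eq_zero_iff_ae_eq_zero]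
  filter_upwards [M.ae_mem_cell, ae_restrict_of_ae hk'] with x ⟨k, hx⟩ h2
  exact h2 k hx

theorem eq_zero_of_localPart (M : PolygonalMesh Ω) {v : M.space} (h : ∀ k, M.localPart k v = 0) :
    v = 0 := by
  have hk : ∀ k, restrictJet (M.subset k) (v : Jet Ω) = 0 := fun k => congrArg Subtype.val (h k)
  have h1 : (v : Jet Ω).fn = 0 :=
    M.eq_zero_of_restrictL2 fun k => congrArg (fun w : Jet _ => w.fn) (hk k)
  have h2 : ∀ i, (v : Jet Ω).grad i = 0 := fun i =>
    M.eq_zero_of_restrictL2 fun k => congrArg (fun w : Jet _ => w.grad i) (hk k)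
  have h3 : ∀ i j, (v : Jet Ω).hess i j = 0 := fun i j =>
    M.eq_zero_of_restrictL2 fun k => congrArg (fun w : Jet _ => w.hess i j) (hk k)
  exact Subtype.ext (Prod.ext h1 (Prod.ext (funext h2) (funext fun i => funext fun j => h3 i j)))

/-- Restriction to an element as a linear map. -/
noncomputable def localPartLinear (M : PolygonalMesh Ω) (k : Fin M.numCells) :
    M.space →ₗ[ℝ] localSpace (M.cell k) where
  toFun := M.localPart k
  map_add' _ _ := Subtype.ext (map_add (restrictJet (M.subset k)) _ _)
  map_smul' c _ := Subtype.ext (map_smul (restrictJet (M.subset k)) c _)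

theorem IsRegular.finiteDimensional {M : PolygonalMesh Ω} {C : ℝ} (h : M.IsRegular C) :
    FiniteDimensional ℝ M.space := by
  have hloc : ∀ k, FiniteDimensional ℝ (localSpace (M.cell k)) := by
    intro k
    obtain ⟨c, hc⟩ := h.star k
    refine finiteDimensional_localSpace (M.cell k) (mul_pos h.pos ?_) hc
    have e : Fin (M.cell k).n := ⟨0, by have := (M.cell k).three_le; omega⟩
    have hb := (M.cell k).isBounded
    -- The diameter is at least the length of an edge, so the ball in the star-shapedness condition
    -- has positive radius.
    refine (dist_pos.2 ((M.cell k).vertex_ne_next e)).trans_le ?_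
    rw [← Metric.diam_closure]
    exact Metric.dist_le_diam_of_mem hb.closure
      (frontier_subset_closure ((M.cell k).vertex_mem_frontier _))
      (frontier_subset_closure ((M.cell k).vertex_mem_frontier _))
  refine FiniteDimensional.of_injective (LinearMap.pi M.localPartLinear) ?_
  rw [← LinearMap.ker_eq_bot, LinearMap.ker_eq_bot']
  exact fun v hv => M.eq_zero_of_localPart fun k => congrFun hv k

end PolygonalMesh

/-! ### The discrete forms -/

/-- `a_K` as a bilinear form. -/
noncomputable def aBilin (K : Set Plane) : LinearMap.BilinForm ℝ (Jet K) :=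
  LinearMap.mk₂ ℝ (aForm K) (aForm_add_left K) (aForm_smul_left K)
    (fun u v w => by simp only [aForm_comm K u, aForm_add_left])
    (fun c u v => by simp only [aForm_comm K u, aForm_smul_left, smul_eq_mul])

/-- `b_K` as a bilinear form. -/
noncomputable def bBilin (K : Set Plane) : LinearMap.BilinForm ℝ (Jet K) :=
  LinearMap.mk₂ ℝ (bForm K) (bForm_add_left K) (bForm_smul_left K)
    (fun u v w => by simp only [bForm_comm K u, bForm_add_left])
    (fun c u v => by simp only [bForm_comm K u, bForm_smul_left, smul_eq_mul])

/-- The local form built from a form on the projections and a form on the remainders. -/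
noncomputable def localDiscreteBilin (K : SimplePolygon)
    (a : LinearMap.BilinForm ℝ (Jet K.carrier)) (s : LinearMap.BilinForm ℝ (localSpace K)) :
    LinearMap.BilinForm ℝ (localSpace K) :=
  a.compl₁₂ (energyProjLinear K) (energyProjLinear K) +
    s.compl₁₂ (projRemainderLinear K) (projRemainderLinear K)

theorem eq_energyProj_of_projRemainder {K : SimplePolygon} {v : localSpace K}
    (h : projRemainder K v = 0) : (v : Jet K.carrier) = energyProj K v :=
  sub_eq_zero.1 (congrArg Subtype.val h)

theorem self_nonneg_of_pos {V : Type*} [AddCommGroup V] [Module ℝ V]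
    {s : LinearMap.BilinForm ℝ V} (h : ∀ v, v ≠ 0 → 0 < s v v) (v : V) : 0 ≤ s v v := by
  by_cases hv : v = 0
  · subst hv; simp
  · exact (h v hv).le

theorem eq_zero_of_self_eq_zero {V : Type*} [AddCommGroup V] [Module ℝ V]
    {s : LinearMap.BilinForm ℝ V} (h : ∀ v, v ≠ 0 → 0 < s v v) {v : V} (hv : s v v = 0) :
    v = 0 := by
  by_contra hne
  exact (h v hne).ne' hv

/-- Both summands vanish: the stabilization gives `v = Πv`, and the energy of `Πv` is zero. On a
single cell `v` may still be affine, so definiteness of `a_h` has to come from the boundary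
conditions on `Ω`. -/
theorem hess_eq_zero_of_discreteALocal {K : SimplePolygon}
    {s : LinearMap.BilinForm ℝ (localSpace K)} (hs : ∀ v, v ≠ 0 → 0 < s v v) {v : localSpace K}
    (h : discreteALocal K s v v = 0) (i j : Fin 2) : (v : Jet K.carrier).hess i j = 0 := by
  have h1 := aForm_self_nonneg K.carrier (energyProj K v)
  have h2 := self_nonneg_of_pos hs (projRemainder K v)
  rw [discreteALocal] at h
  have h3 := eq_zero_of_self_eq_zero hs (v := projRemainder K v) (by linarith)
  rw [eq_energyProj_of_projRemainder h3]
  exact hess_eq_zero_of_aForm (by linarith) i j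

/-- In contrast to `a_h`, the form is definite on each cell: `v = Πv` is a polynomial with zero `L²`
norm. -/
theorem eq_zero_of_discreteBLocal {K : SimplePolygon}
    {s : LinearMap.BilinForm ℝ (localSpace K)} (hs : ∀ v, v ≠ 0 → 0 < s v v) {v : localSpace K}
    (h : discreteBLocal K s v v = 0) : v = 0 := by
  have h1 := bForm_self_nonneg K.carrier (energyProj K v)
  have h2 := self_nonneg_of_pos hs (projRemainder K v)
  rw [discreteBLocal] at h
  have h3 := eq_zero_of_self_eq_zero hs (v := projRemainder K v) (by linarith)
  have h4 := eq_zero_of_mem_polySpace K.isOpen (energyProj_spec K v).1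
    (fn_eq_zero_of_bForm (by linarith))
  exact Subtype.ext ((eq_energyProj_of_projRemainder h3).trans h4)

namespace PolygonalMesh

variable {Ω : Set Plane} (M : PolygonalMesh Ω)
  (s : ∀ k, LinearMap.BilinForm ℝ (localSpace (M.cell k)))

/-- `a_h` as a bilinear form. -/
noncomputable def discreteABilin : LinearMap.BilinForm ℝ M.space :=
  ∑ k, (localDiscreteBilin (M.cell k) (aBilin _) (s k)).compl₁₂
    (M.localPartLinear k) (M.localPartLinear k)

/-- `b_h` as a bilinear form. -/
noncomputable def discreteBBilin : LinearMap.BilinForm ℝ M.space :=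
  ∑ k, (localDiscreteBilin (M.cell k) (bBilin _) (s k)).compl₁₂
    (M.localPartLinear k) (M.localPartLinear k)

theorem discreteABilin_apply (u v : M.space) : M.discreteABilin s u v = M.discreteA s u v := by
  rw [discreteABilin, LinearMap.sum_apply, LinearMap.sum_apply]
  rfl

theorem discreteBBilin_apply (u v : M.space) : M.discreteBBilin s u v = M.discreteB s u v := by
  rw [discreteBBilin, LinearMap.sum_apply, LinearMap.sum_apply]
  rfl

variable {M s}

/-- The Hessians on the cells are restrictions of one `L²` Hessian on `Ω`, so their vanishing leaves
no jump across edges to account for; membership in `H₀²(Ω)` then forces `v = 0`. -/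
theorem discreteA_pos (hΩ : IsOpen Ω) (hb : Bornology.IsBounded Ω)
    (hs : ∀ k v, v ≠ 0 → 0 < s k v v) {v : M.space} (hv : v ≠ 0) : 0 < M.discreteA s v v := by
  have hnn : ∀ k, 0 ≤ discreteALocal (M.cell k) (s k) (M.localPart k v) (M.localPart k v) :=
    fun k => add_nonneg (aForm_self_nonneg _ _) (self_nonneg_of_pos (hs k) _)
  refine lt_of_le_of_ne (Finset.sum_nonneg fun k _ => hnn k) fun h0 => hv ?_
  have h1 := (Finset.sum_eq_zero_iff_of_nonneg fun k _ => hnn k).1 h0.symm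
  have h2 : ∀ i j, (v : Jet Ω).hess i j = 0 := fun i j =>
    M.eq_zero_of_restrictL2 fun k =>
      hess_eq_zero_of_discreteALocal (hs k) (h1 k (Finset.mem_univ k)) i j
  exact Subtype.ext ((zeroExtendable_of_mem_H20 hΩ (Submodule.mem_inf.1 v.2).1).eq_zero hΩ hb h2)

theorem discreteB_pos (hs : ∀ k v, v ≠ 0 → 0 < s k v v) {v : M.space} (hv : v ≠ 0) :
    0 < M.discreteB s v v := by
  have hnn : ∀ k, 0 ≤ discreteBLocal (M.cell k) (s k) (M.localPart k v) (M.localPart k v) :=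
    fun k => add_nonneg (bForm_self_nonneg _ _) (self_nonneg_of_pos (hs k) _)
  refine lt_of_le_of_ne (Finset.sum_nonneg fun k _ => hnn k) fun h0 => hv ?_
  have h1 := (Finset.sum_eq_zero_iff_of_nonneg fun k _ => hnn k).1 h0.symm
  exact M.eq_zero_of_localPart fun k =>
    eq_zero_of_discreteBLocal (hs k) (h1 k (Finset.mem_univ k))

theorem discreteA_comm (hs : ∀ k u v, s k u v = s k v u) (u v : M.space) :
    M.discreteA s u v = M.discreteA s v u := by
  refine Finset.sum_congr rfl fun k _ => ?_
  rw [discreteALocal, discreteALocal, aForm_comm, hs]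

theorem discreteB_comm (hs : ∀ k u v, s k u v = s k v u) (u v : M.space) :
    M.discreteB s u v = M.discreteB s v u := by
  refine Finset.sum_congr rfl fun k _ => ?_
  rw [discreteBLocal, discreteBLocal, bForm_comm, hs]

end PolygonalMesh

/-! ### Assembly of the theorem -/

theorem mainTheorem5 (Ω : Set Plane) (hΩ : IsPolygonalDomain Ω)
    (M : PolygonalMesh Ω) (C : ℝ) (hM : M.IsRegular C)
    (c₀ c₁ c₂ c₃ : ℝ) (hc₀ : 0 < c₀) (hc₁ : 0 < c₁) (hc₂ : 0 < c₂) (hc₃ : 0 < c₃)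
    (s s0 : ∀ k, LinearMap.BilinForm ℝ (localSpace (M.cell k)))
    (hs : ∀ k, IsStabilization (M.cell k) c₀ c₁ c₂ c₃ (s k) (s0 k)) :
    FiniteDimensional ℝ M.space ∧
    ∃ T : Module.End ℝ M.space, M.IsSolutionOperator s s0 T ∧
      ∃ μ : Fin (Module.finrank ℝ M.space) → ℝ,
        (∀ i, 0 < μ i) ∧
        spectrum ℂ (complexify T) = Set.range (fun i => (μ i : ℂ)) ∧
        ∀ z : ℂ,
          Module.finrank ℂ ((complexify T).eigenspace z) = Nat.card {i // (μ i : ℂ) = z} ∧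
          Module.finrank ℂ ((complexify T).maxGenEigenspace z) = Nat.card {i // (μ i : ℂ) = z} := by
  have hfin := hM.finiteDimensional
  refine ⟨hfin, ?_⟩
  obtain ⟨T, hT, b, μ, hμ, hb⟩ := LinearMap.BilinForm.exists_solution_operator
    (M.discreteABilin s) (M.discreteBBilin s0)
    (fun u v => by
      rw [M.discreteABilin_apply, M.discreteABilin_apply]
      exact PolygonalMesh.discreteA_comm (fun k => (hs k).symm) u v)
    (fun v hv => by
      rw [M.discreteABilin_apply]
      exact PolygonalMesh.discreteA_pos hΩ.isOpen hΩ.isBounded (fun k => (hs k).pos) hv)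
    (fun u v => by
      rw [M.discreteBBilin_apply, M.discreteBBilin_apply]
      exact PolygonalMesh.discreteB_comm (fun k => (hs k).symm0) u v)
    (fun v hv => by
      rw [M.discreteBBilin_apply]
      exact PolygonalMesh.discreteB_pos (fun k => (hs k).pos0) hv)
  simp only [M.discreteABilin_apply, M.discreteBBilin_apply] at hT
  exact ⟨T, hT, μ, hμ, complexify_spectrum_of_basis b T μ hb⟩
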